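/- Manifolds and Lie groups are finite-dimensional, smooth, Hausdorff and second countable. Let $M$ be a connected manifold without boundary and let $G$ be a Lie group of diffeomorphisms of $M$ (that is, $G$ is a Lie group, not necessarily connected, with a smooth faithful action on $M$) whose image in $\mathrm{Diff}(M)$ is closed for the $C^\infty$ compact-open topology. Suppose that $G$ preserves either (a) a strictly pseudo-convex CR-structure $\{D,J\}$ on $M$, i.e. $\alpha_*D=D$ and $\alpha_*\circ J=J\circ\alpha_*|_D$ for all $\alpha\in G$, where $D=\ker\omega$ for a contact form $\omega$ and $J$ is a smooth complex structure on the bundle $D$ such that the Levi form $d\omega(J\cdot,\cdot)$ is a positive definite Hermitian form on $D$ (integrability of $J$ is not required); or (b) the conformal class of a Riemannian metric $g$ on $M$, i.e. for every $\alpha\in G$ one has $\alpha^*g=u_\alpha\, g$ with a positive smooth function $u_\alpha$ on $M$. A differentiable $G$-module is a quasi-complete Hausdorff locally convex real topological vector space $V$ with a continuous linear $G$-action such that every orbit map $o_v\colon G\to V$, $g\mapsto g\cdot v$, is smooth and the map $V\to C^\infty(G,V)$, $v\mapsto o_v$, is smooth. For such $V$ let $C^\infty(M,V)$ be the space of smooth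 maps with the $C^\infty$-topology and the $G$-action $(\alpha\cdot f)(x)=\alpha\cdot f(\alpha^{-1}x)$; $\mathbb R$ carries the trivial action. For a locally convex space $W$ with linear $G$-action let $H^r_d(G,W)$ be the $r$-th differentiable cohomology group, i.e. the cohomology of the complex of smooth inhomogeneous cochains $C^\infty(G^r,W)$ with $$\partial\lambda(\alpha_1,\dots,\alpha_{r+1})=\alpha_1\cdot\lambda(\alpha_2,\dots,\alpha_{r+1})+\sum_{i=1}^r(-1)^i\lambda(\alpha_1,\dots,\alpha_i\alpha_{i+1},\dots,\alpha_{r+1})+(-1)^{r+1}\lambda(\alpha_1,\dots,\alpha_r).$$ Then the following are equivalent: 1. $G$ acts properly on $M$. 2. $H^1_d\big(G,C^\infty(M,\mathbb R)\big)=\{0\}$. 3. $H^r_d\big(G,C^\infty(M,V)\big)=\{0\}$ for all $r>0$ and every differentiable $G$-module $V$. -/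

import Mathlib

open Set Filter Topology Manifold ContDiff Bundle

universe uEG uG uEM uM w

noncomputable section

namespace DiffCoh

/-! ### Smooth maps with values in locally convex spaces -/

section Smooth

variable {E : Type*} [AddCommGroup E] [Module ℝ E] [TopologicalSpace E]
  {F : Type*} [AddCommGroup F] [Module ℝ F] [TopologicalSpace F]

/-- The iterated directional derivative `dᵏ f (x; v₀, …, v_{k-1})` of a map between real topological
vector spaces; the last derivative taken is the one in the direction `v₀`.
It is meaningful (for Hausdorff `F`) as soon as the defining limits exist. -/
def iterDirDeriv (f : E → F) : (k : ℕ) → E → (Fin k → E) → F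
  | 0, x, _ => f x
  | k + 1, x, v => limUnder (𝓝[≠] (0 : ℝ)) fun t : ℝ =>
      t⁻¹ • (iterDirDeriv f k (x + t • v 0) (Fin.tail v) - iterDirDeriv f k x (Fin.tail v))

/-- `f` is of class `C^∞` on the open set `U` (in the sense of Michal and Bastiani): all iterated
directional derivatives exist on `U`, and the maps `(x, v) ↦ dᵏ f (x; v)` are continuous on
`U × Eᵏ`. For finite-dimensional `E` this says that all iterated partial derivatives exist and are
continuous. -/
structure IsSmoothOn (f : E → F) (U : Set E) : Prop where
  tendsto : ∀ (k : ℕ), ∀ x ∈ U, ∀ v : Fin (k + 1) → E,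
    Tendsto (fun t : ℝ =>
        t⁻¹ • (iterDirDeriv f k (x + t • v 0) (Fin.tail v) - iterDirDeriv f k x (Fin.tail v)))
      (𝓝[≠] (0 : ℝ)) (𝓝 (iterDirDeriv f (k + 1) x v))
  continuousOn : ∀ k : ℕ,
    ContinuousOn (fun p : E × (Fin k → E) => iterDirDeriv f k p.1 p.2) (U ×ˢ univ)

section Helpers

set_option linter.unusedSectionVars false

variable [ContinuousAdd E] [ContinuousSMul ℝ E] [T2Space F]

theorem eventually_line_mem {U : Set E} (hU : IsOpen U) {x : E} (hx : x ∈ U) (v : E) :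
    ∀ᶠ t : ℝ in 𝓝[≠] (0 : ℝ), x + t • v ∈ U := by
  have hc : Continuous fun t : ℝ => x + t • v := by fun_prop
  have h0 : ∀ᶠ t : ℝ in 𝓝 (0 : ℝ), x + t • v ∈ U :=
    hc.continuousAt.eventually_mem (by simpa using hU.mem_nhds hx)
  exact h0.filter_mono nhdsWithin_le_nhds

theorem iterDirDeriv_eq_of {f : E → F} {U : Set E} (hU : IsOpen U)
    (D : ∀ k : ℕ, E → (Fin k → E) → F) (h0 : ∀ x ∈ U, ∀ v, D 0 x v = f x)
    (hD : ∀ (k : ℕ), ∀ x ∈ U, ∀ v : Fin (k + 1) → E,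
      Tendsto (fun t : ℝ => t⁻¹ • (D k (x + t • v 0) (Fin.tail v) - D k x (Fin.tail v)))
        (𝓝[≠] (0 : ℝ)) (𝓝 (D (k + 1) x v))) :
    ∀ (k : ℕ), ∀ x ∈ U, ∀ v, iterDirDeriv f k x v = D k x v := by
  intro k
  induction k with
  | zero => intro x hx v; exact (h0 x hx v).symm
  | succ k ih =>
    intro x hx v
    refine Tendsto.limUnder_eq ((hD k x hx v).congr' ?_)
    filter_upwards [eventually_line_mem hU hx (v 0)] with t ht
    rw [ih _ ht, ih _ hx]

theorem isSmoothOn_of {f : E → F} {U : Set E} (hU : IsOpen U)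
    (D : ∀ k : ℕ, E → (Fin k → E) → F) (h0 : ∀ x ∈ U, ∀ v, D 0 x v = f x)
    (hD : ∀ (k : ℕ), ∀ x ∈ U, ∀ v : Fin (k + 1) → E,
      Tendsto (fun t : ℝ => t⁻¹ • (D k (x + t • v 0) (Fin.tail v) - D k x (Fin.tail v)))
        (𝓝[≠] (0 : ℝ)) (𝓝 (D (k + 1) x v)))
    (hc : ∀ k : ℕ, ContinuousOn (fun p : E × (Fin k → E) => D k p.1 p.2) (U ×ˢ univ)) :
    IsSmoothOn f U := by
  have key := iterDirDeriv_eq_of hU D h0 hD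
  refine ⟨fun k x hx v => ?_, fun k => ?_⟩
  · rw [key _ x hx v]
    refine (hD k x hx v).congr' ?_
    filter_upwards [eventually_line_mem hU hx (v 0)] with t ht
    rw [key _ _ ht, key _ _ hx]
  · refine (hc k).congr ?_
    rintro ⟨x, v⟩ ⟨hx, -⟩
    exact key k x hx v

theorem IsSmoothOn.zero {U : Set E} (hU : IsOpen U) : IsSmoothOn (fun _ => 0 : E → F) U := by
  refine isSmoothOn_of hU (fun _ _ _ => 0) (fun _ _ _ => rfl) (fun k x _ v => ?_)
    (fun k => continuousOn_const)
  simp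

variable [IsTopologicalAddGroup F] [ContinuousSMul ℝ F]

theorem add_aux {f g : E → F} {U : Set E} (hf : IsSmoothOn f U) (hg : IsSmoothOn g U) (k : ℕ)
    {x : E} (hx : x ∈ U) (v : Fin (k + 1) → E) :
    Tendsto (fun t : ℝ => t⁻¹ •
        ((iterDirDeriv f k (x + t • v 0) (Fin.tail v) + iterDirDeriv g k (x + t • v 0) (Fin.tail v))
          - (iterDirDeriv f k x (Fin.tail v) + iterDirDeriv g k x (Fin.tail v))))
      (𝓝[≠] (0 : ℝ)) (𝓝 (iterDirDeriv f (k + 1) x v + iterDirDeriv g (k + 1) x v)) := by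
  refine ((hf.tendsto k x hx v).add (hg.tendsto k x hx v)).congr fun t => ?_
  rw [← smul_add]
  congr 1
  abel

theorem iterDirDeriv_add {f g : E → F} {U : Set E} (hU : IsOpen U) (hf : IsSmoothOn f U)
    (hg : IsSmoothOn g U) (k : ℕ) {x : E} (hx : x ∈ U) (v : Fin k → E) :
    iterDirDeriv (fun y => f y + g y) k x v = iterDirDeriv f k x v + iterDirDeriv g k x v :=
  iterDirDeriv_eq_of hU (fun k x v => iterDirDeriv f k x v + iterDirDeriv g k x v)
    (fun _ _ _ => rfl) (fun k _ hx v => add_aux hf hg k hx v) k x hx v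

theorem IsSmoothOn.add {f g : E → F} {U : Set E} (hU : IsOpen U) (hf : IsSmoothOn f U)
    (hg : IsSmoothOn g U) : IsSmoothOn (fun y => f y + g y) U :=
  isSmoothOn_of hU (fun k x v => iterDirDeriv f k x v + iterDirDeriv g k x v)
    (fun _ _ _ => rfl) (fun k _ hx v => add_aux hf hg k hx v)
    (fun k => (hf.continuousOn k).add (hg.continuousOn k))

theorem clm_aux {f : E → F} {U : Set E} (hf : IsSmoothOn f U) (L : F →L[ℝ] F) (k : ℕ)
    {x : E} (hx : x ∈ U) (v : Fin (k + 1) → E) :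
    Tendsto (fun t : ℝ => t⁻¹ •
        (L (iterDirDeriv f k (x + t • v 0) (Fin.tail v)) - L (iterDirDeriv f k x (Fin.tail v))))
      (𝓝[≠] (0 : ℝ)) (𝓝 (L (iterDirDeriv f (k + 1) x v))) := by
  refine ((L.continuous.tendsto _).comp (hf.tendsto k x hx v)).congr fun t => ?_
  simp

theorem iterDirDeriv_clm {f : E → F} {U : Set E} (hU : IsOpen U) (hf : IsSmoothOn f U)
    (L : F →L[ℝ] F) (k : ℕ) {x : E} (hx : x ∈ U) (v : Fin k → E) :
    iterDirDeriv (fun y => L (f y)) k x v = L (iterDirDeriv f k x v) :=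
  iterDirDeriv_eq_of hU (fun k x v => L (iterDirDeriv f k x v))
    (fun _ _ _ => rfl) (fun k _ hx v => clm_aux hf L k hx v) k x hx v

theorem IsSmoothOn.clm {f : E → F} {U : Set E} (hU : IsOpen U) (hf : IsSmoothOn f U)
    (L : F →L[ℝ] F) : IsSmoothOn (fun y => L (f y)) U :=
  isSmoothOn_of hU (fun k x v => L (iterDirDeriv f k x v))
    (fun _ _ _ => rfl) (fun k _ hx v => clm_aux hf L k hx v)
    (fun k => L.continuous.comp_continuousOn (hf.continuousOn k))

end Helpers

end Smooth

/-! ### The space `C^∞(X, F)` with the `C^∞`-topology -/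

section SmoothFun

variable (E : Type*) [NormedAddCommGroup E] [NormedSpace ℝ E]
  (X : Type*) [TopologicalSpace X] [ChartedSpace E X]
  (F : Type*) [AddCommGroup F] [Module ℝ F] [TopologicalSpace F]

/-- A map from a manifold `X` modelled on `E` to a locally convex space `F` is smooth if it is
so in all charts of the smooth structure. -/
def IsSmoothMap {X F : Type*} [TopologicalSpace X] [ChartedSpace E X]
    [AddCommGroup F] [Module ℝ F] [TopologicalSpace F] (f : X → F) : Prop :=
  ∀ e ∈ IsManifold.maximalAtlas 𝓘(ℝ, E) ∞ X, IsSmoothOn (fun y => f (e.symm y)) e.target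

variable [T2Space F] [IsTopologicalAddGroup F] [ContinuousSMul ℝ F]

/-- The vector space of smooth maps `X → F`. -/
def smoothSubmodule : Submodule ℝ (X → F) where
  carrier := {f | IsSmoothMap E f}
  zero_mem' := fun e _ => IsSmoothOn.zero e.open_target
  add_mem' := fun hf hg e he => (hf e he).add e.open_target (hg e he)
  smul_mem' := fun c _ hf e he =>
    (hf e he).clm e.open_target (c • ContinuousLinearMap.id ℝ F)

/-- The space `C^∞(X, F)`. Its topology is the `C^∞`-topology defined below. -/
def SmoothFun : Type _ := {f : X → F // IsSmoothMap E f}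

instance : AddCommGroup (SmoothFun E X F) := inferInstanceAs (AddCommGroup (smoothSubmodule E X F))

instance : Module ℝ (SmoothFun E X F) := inferInstanceAs (Module ℝ (smoothSubmodule E X F))

variable {E X F}

/-- Bundle a smooth map. -/
def SmoothFun.mk (f : X → F) (hf : IsSmoothMap E f) : SmoothFun E X F := ⟨f, hf⟩

/-- The `k`-th derivative of a smooth map in a chart `e`, as a continuous map on
`e.target × Eᵏ`. -/
def chartJet (e : IsManifold.maximalAtlas 𝓘(ℝ, E) ∞ X) (k : ℕ) :
    SmoothFun E X F →ₗ[ℝ] C(e.1.target × (Fin k → E), F) where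
  toFun f := ⟨fun p => iterDirDeriv (fun y => f.1 (e.1.symm y)) k p.1 p.2, by
    have h := (f.2 e.1 e.2).continuousOn k
    exact h.comp_continuous (f := fun p : e.1.target × (Fin k → E) => ((p.1 : E), p.2))
      (by fun_prop) (fun p => ⟨p.1.2, mem_univ _⟩)⟩
  map_add' f g := by
    ext p
    exact iterDirDeriv_add e.1.open_target (f.2 e.1 e.2) (g.2 e.1 e.2) k p.1.2 p.2
  map_smul' c f := by
    ext p
    exact iterDirDeriv_clm e.1.open_target (f.2 e.1 e.2) (c • ContinuousLinearMap.id ℝ F) k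
      p.1.2 p.2

/-- The `C^∞`-topology on `C^∞(X, F)`: uniform convergence on compact sets of all derivatives in
all charts. -/
instance : TopologicalSpace (SmoothFun E X F) :=
  ⨅ (e : IsManifold.maximalAtlas 𝓘(ℝ, E) ∞ X), ⨅ (k : ℕ),
    TopologicalSpace.induced (chartJet e k) inferInstance

theorem continuous_chartJet (e : IsManifold.maximalAtlas 𝓘(ℝ, E) ∞ X) (k : ℕ) :
    Continuous (chartJet (F := F) e k) :=
  continuous_iff_le_induced.2 ((iInf_le _ e).trans (iInf_le _ k))

theorem continuous_chartJet_comp (e e' : IsManifold.maximalAtlas 𝓘(ℝ, E) ∞ X)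
    (ht : e.1.target ⊆ e'.1.target) (L : F →L[ℝ] F) (T : SmoothFun E X F → SmoothFun E X F)
    (hT : ∀ f y, (T f).1 (e.1.symm y) = L (f.1 (e'.1.symm y))) (k : ℕ) :
    Continuous fun f => chartJet e k (T f) := by
  let i : C(e.1.target × (Fin k → E), e'.1.target × (Fin k → E)) :=
    ⟨fun p => (Set.inclusion ht p.1, p.2),
      ((continuous_inclusion ht).comp continuous_fst).prodMk continuous_snd⟩
  have h := ((ContinuousMap.continuous_postcomp ⟨L, L.continuous⟩).comp
    (ContinuousMap.continuous_precomp i)).comp (continuous_chartJet (F := F) e' k)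
  refine h.congr fun f => ?_
  ext p
  change L (iterDirDeriv (fun y => f.1 (e'.1.symm y)) k p.1 p.2) =
    iterDirDeriv (fun y => (T f).1 (e.1.symm y)) k p.1 p.2
  simp only [hT]
  exact (iterDirDeriv_clm e'.1.open_target (f.2 e'.1 e'.2) L k (ht p.1.2) p.2).symm

instance : IsTopologicalAddGroup (SmoothFun E X F) :=
  topologicalAddGroup_iInf fun e => topologicalAddGroup_iInf fun k =>
    topologicalAddGroup_induced (chartJet (F := F) e k)

instance : ContinuousSMul ℝ (SmoothFun E X F) :=
  continuousSMul_iInf fun e => continuousSMul_iInf fun k =>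
    continuousSMul_induced (chartJet (F := F) e k)

instance [IsManifold 𝓘(ℝ, E) ∞ X] : T2Space (SmoothFun E X F) := by
  refine T2Space.of_injective_continuous (f := fun (f : SmoothFun E X F) (x : X) => f.1 x)
    (fun f g h => Subtype.ext h) (continuous_pi fun x => ?_)
  have he : chartAt E x ∈ IsManifold.maximalAtlas 𝓘(ℝ, E) ∞ X :=
    IsManifold.chart_mem_maximalAtlas x
  have h := continuous_chartJet (F := F) (X := X) ⟨chartAt E x, he⟩ 0
  have h2 := (continuous_eval_const (F := C((chartAt E x).target × (Fin 0 → E), F))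
    ((⟨chartAt E x x, mem_chart_target E x⟩, Fin.elim0) :
      (chartAt E x).target × (Fin 0 → E))).comp h
  refine h2.congr fun f => ?_
  change f.1 ((chartAt E x).symm (chartAt E x x)) = f.1 x
  rw [(chartAt E x).left_inv (mem_chart_source E x)]

end SmoothFun

/-! ### Differentiable modules -/

section Modules

variable {EG : Type*} [NormedAddCommGroup EG] [NormedSpace ℝ EG]
  {G : Type*} [Group G] [TopologicalSpace G] [ChartedSpace EG G]
  {EM : Type*} [NormedAddCommGroup EM] [NormedSpace ℝ EM]
  {M : Type*} [TopologicalSpace M] [ChartedSpace EM M] [IsManifold 𝓘(ℝ, EM) ∞ M]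
  [MulAction G M] [ContMDiffSMul 𝓘(ℝ, EG) 𝓘(ℝ, EM) ∞ G M]
  {V : Type*} [AddCommGroup V] [Module ℝ V] [TopologicalSpace V] [T2Space V]
  [IsTopologicalAddGroup V] [ContinuousSMul ℝ V]

variable (EG) in
/-- A linear action `ρ` of the Lie group `G` on the locally convex space `V` makes `V` a
differentiable `G`-module if it is continuous, all orbit maps `o_v : g ↦ g · v` are smooth, and
`V → C^∞(G, V)`, `v ↦ o_v`, is smooth. -/
structure IsDifferentiableModule (ρ : G →* (V →L[ℝ] V)) : Prop where
  continuous_action : Continuous fun p : G × V => ρ p.1 p.2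
  smooth_orbit : ∀ v : V, IsSmoothMap EG fun g => ρ g v
  smooth_orbitMap :
    IsSmoothOn (fun v => (SmoothFun.mk (fun g => ρ g v) (smooth_orbit v) : SmoothFun EG G V)) univ

/-- The chart `x ↦ e (g • x)`. -/
theorem smul_chart_mem (g : G) {e : OpenPartialHomeomorph M EM}
    (he : e ∈ IsManifold.maximalAtlas 𝓘(ℝ, EM) ∞ M) :
    (Diffeomorph.smul (M := M) 𝓘(ℝ, EG) 𝓘(ℝ, EM) ∞ g).toHomeomorph.transOpenPartialHomeomorph e ∈
      IsManifold.maximalAtlas 𝓘(ℝ, EM) ∞ M := by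
  set d : M ≃ₘ⟮𝓘(ℝ, EM), 𝓘(ℝ, EM)⟯ M := Diffeomorph.smul 𝓘(ℝ, EG) 𝓘(ℝ, EM) ∞ g
  refine OpenPartialHomeomorph.mem_maximalAtlas_of_contMDiffOn _ ?_ ?_
  · exact (contMDiffOn_of_mem_maximalAtlas he).comp d.contMDiff.contMDiffOn (fun x hx => hx)
  · exact d.symm.contMDiff.comp_contMDiffOn (contMDiffOn_symm_of_mem_maximalAtlas he)

variable (EG) in
/-- The action `(α · f)(x) = α · f(α⁻¹ x)` of `G` on `C^∞(M, V)`. -/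
def smoothFunAction (ρ : G →* (V →L[ℝ] V)) :
    G →* (SmoothFun EM M V →L[ℝ] SmoothFun EM M V) where
  toFun α :=
    { toFun := fun f => SmoothFun.mk (fun x => ρ α (f.1 (α⁻¹ • x))) fun e he =>
        (f.2 _ (smul_chart_mem (EG := EG) α he)).clm e.open_target (ρ α)
      map_add' := fun f g => Subtype.ext (funext fun x => map_add (ρ α) _ _)
      map_smul' := fun c f => Subtype.ext (funext fun x => map_smul (ρ α) c _)
      cont := by
        refine continuous_iInf_rng.2 fun e => continuous_iInf_rng.2 fun k =>
          continuous_induced_rng.2 ?_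
        exact continuous_chartJet_comp e ⟨_, smul_chart_mem (EG := EG) α e.2⟩ subset_rfl (ρ α) _
          (fun _ _ => rfl) k }
  map_one' := by
    ext f
    refine Subtype.ext (funext fun x => ?_)
    change ρ 1 (f.1 ((1 : G)⁻¹ • x)) = f.1 x
    simp
  map_mul' α β := by
    ext f
    refine Subtype.ext (funext fun x => ?_)
    change ρ (α * β) (f.1 ((α * β)⁻¹ • x)) = ρ α (ρ β (f.1 (β⁻¹ • α⁻¹ • x)))
    simp [mul_smul]

end Modules

/-! ### Differentiable cohomology -/

section Cohomology

variable {G : Type*} [Group G] {W : Type*} [AddCommGroup W] [Module ℝ W] [TopologicalSpace W]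

/-- The inhomogeneous coboundary operator
`∂λ(α₁,…,α_{r+1}) = α₁ · λ(α₂,…,α_{r+1}) + ∑_{i=1}^r (-1)^i λ(α₁,…,αᵢαᵢ₊₁,…,α_{r+1})
+ (-1)^{r+1} λ(α₁,…,αᵣ)`. -/
def coboundary (ρ : G →* (W →L[ℝ] W)) (r : ℕ) :
    ((Fin r → G) → W) →ₗ[ℝ] ((Fin (r + 1) → G) → W) where
  toFun c a := ρ (a 0) (c (Fin.tail a))
    + ∑ i : Fin r, (-1 : ℝ) ^ ((i : ℕ) + 1) • c (Fin.contractNth i.castSucc (· * ·) a)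
    + (-1 : ℝ) ^ (r + 1) • c (Fin.init a)
  map_add' c d := by
    funext a
    simp only [Pi.add_apply, map_add, smul_add, Finset.sum_add_distrib]
    abel
  map_smul' s c := by
    funext a
    simp only [Pi.smul_apply, map_smul, RingHom.id_apply, smul_add, Finset.smul_sum]
    simp only [smul_comm s]

variable (EG : Type*) [NormedAddCommGroup EG] [NormedSpace ℝ EG]
  [TopologicalSpace G] [ChartedSpace EG G] [T2Space W] [IsTopologicalAddGroup W]
  [ContinuousSMul ℝ W]

variable (G W) in
/-- The differentiable `r`-cochains `C^∞(Gʳ, W)`. -/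
def cochains (r : ℕ) : Submodule ℝ ((Fin r → G) → W) :=
  letI : ChartedSpace (Fin r → EG) (Fin r → G) := piChartedSpace (fun _ => EG) (fun _ => G)
  smoothSubmodule (Fin r → EG) (Fin r → G) W

/-- The differentiable `r`-cocycles. -/
def cocycles (ρ : G →* (W →L[ℝ] W)) (r : ℕ) : Submodule ℝ ((Fin r → G) → W) :=
  cochains G W EG r ⊓ LinearMap.ker (coboundary ρ r)

/-- The coboundaries of differentiable cochains. -/
def coboundaries (ρ : G →* (W →L[ℝ] W)) : (r : ℕ) → Submodule ℝ ((Fin r → G) → W)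
  | 0 => ⊥
  | r + 1 => (cochains G W EG r).map (coboundary ρ r)

/-- The differentiable cohomology `H^r_d(G, W)`: cocycles modulo coboundaries. -/
abbrev DiffCohomology (ρ : G →* (W →L[ℝ] W)) (r : ℕ) : Type _ :=
  cocycles EG ρ r ⧸ (coboundaries EG ρ r).submoduleOf (cocycles EG ρ r)

end Cohomology

/-! ### The diffeomorphism group -/

section Diffeo

variable (EM : Type*) [NormedAddCommGroup EM] [NormedSpace ℝ EM]
  (M : Type*) [TopologicalSpace M] [ChartedSpace EM M]

/-- The `C^∞` compact-open topology on `Diff(M)`, generated by the sets of diffeomorphisms `g` with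
`g(K) ⊆ V` whose derivatives up to order `k` in charts `(U, φ)`, `(V, ψ)` are `ε`-close on the
compact set `K ⊆ U` to those of a given diffeomorphism `f` with `f(K) ⊆ V`. -/
@[reducible] def diffTopology : TopologicalSpace (M ≃ₘ⟮𝓘(ℝ, EM), 𝓘(ℝ, EM)⟯ M) :=
  TopologicalSpace.generateFrom
    {N | ∃ f : M ≃ₘ⟮𝓘(ℝ, EM), 𝓘(ℝ, EM)⟯ M,
      ∃ φ ∈ IsManifold.maximalAtlas 𝓘(ℝ, EM) ∞ M, ∃ ψ ∈ IsManifold.maximalAtlas 𝓘(ℝ, EM) ∞ M,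
      ∃ K : Set M, IsCompact K ∧ K ⊆ φ.source ∧ MapsTo f K ψ.source ∧
      ∃ k : ℕ, ∃ ε : ℝ, 0 < ε ∧
        N = {g : M ≃ₘ⟮𝓘(ℝ, EM), 𝓘(ℝ, EM)⟯ M | MapsTo g K ψ.source ∧ ∀ j ≤ k, ∀ x ∈ K,
          ‖iteratedFDeriv ℝ j (fun y => ψ (g (φ.symm y))) (φ x)
            - iteratedFDeriv ℝ j (fun y => ψ (f (φ.symm y))) (φ x)‖ < ε}}

variable (EG : Type*) [NormedAddCommGroup EG] [NormedSpace ℝ EG]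
  (G : Type*) [Group G] [TopologicalSpace G] [ChartedSpace EG G]
  [MulAction G M] [ContMDiffSMul 𝓘(ℝ, EG) 𝓘(ℝ, EM) ∞ G M]

/-- The image of the smoothly acting group `G` in `Diff(M)` is closed. -/
def IsClosedInDiff : Prop :=
  IsClosed[diffTopology EM M]
    (range fun g : G => (Diffeomorph.smul 𝓘(ℝ, EG) 𝓘(ℝ, EM) ∞ g : M ≃ₘ⟮𝓘(ℝ, EM), 𝓘(ℝ, EM)⟯ M))

end Diffeo

/-! ### Geometric structures -/

section Geometry

variable {E : Type*} [NormedAddCommGroup E] [NormedSpace ℝ E]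
  {M : Type*} [TopologicalSpace M] [ChartedSpace E M]

/-- The coordinate expression `((φ⁻¹)^* θ)_y`, `φ` the preferred chart at `x`, of a `1`-form `θ`. -/
def localForm (θ : ∀ x : M, TangentSpace 𝓘(ℝ, E) x →L[ℝ] ℝ) (x : M) (y : E) : E →L[ℝ] ℝ :=
  (θ ((chartAt E x).symm y)).comp (mfderiv 𝓘(ℝ, E) 𝓘(ℝ, E) (chartAt E x).symm y)

/-- The exterior derivative `dθ` of a smooth `1`-form `θ` at `x`, computed in the chart at `x`. -/
def extDerivForm (θ : ∀ x : M, TangentSpace 𝓘(ℝ, E) x →L[ℝ] ℝ) (x : M)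
    (v w : TangentSpace 𝓘(ℝ, E) x) : ℝ :=
  let T : TangentSpace 𝓘(ℝ, E) x →L[ℝ] E := mfderiv 𝓘(ℝ, E) 𝓘(ℝ, E) (chartAt E x) x
  let Dθ : E →L[ℝ] E →L[ℝ] ℝ := fderiv ℝ (localForm θ x) (chartAt E x x)
  Dθ (T v) (T w) - Dθ (T w) (T v)

variable [IsManifold 𝓘(ℝ, E) ∞ M]

/-- `{θ, J}` is a pseudo-Hermitian structure with underlying distribution `D = ker θ`: `θ` is a
smooth nowhere vanishing `1`-form and the Levi form `dθ(J·,·)` is a positive definite Hermitian form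
on `D`. (Then `dθ` is nondegenerate on `D`, so `θ` is a contact form.) -/
structure IsPseudoHermitian (D : ∀ x : M, Submodule ℝ (TangentSpace 𝓘(ℝ, E) x))
    (J : ∀ x : M, D x →ₗ[ℝ] D x) (θ : ∀ x : M, TangentSpace 𝓘(ℝ, E) x →L[ℝ] ℝ) : Prop where
  contMDiff : ContMDiff 𝓘(ℝ, E) (𝓘(ℝ, E).prod 𝓘(ℝ, E →L[ℝ] ℝ)) ∞
    fun x => TotalSpace.mk' (E →L[ℝ] ℝ) (E := fun x : M => TangentSpace 𝓘(ℝ, E) x →L[ℝ] ℝ) x (θ x)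
  ne_zero : ∀ x, θ x ≠ 0
  mem_iff : ∀ x (v : TangentSpace 𝓘(ℝ, E) x), v ∈ D x ↔ θ x v = 0
  levi_invariant : ∀ x (v w : D x),
    extDerivForm θ x (J x v : TangentSpace 𝓘(ℝ, E) x) (J x w : TangentSpace 𝓘(ℝ, E) x) =
      extDerivForm θ x (v : TangentSpace 𝓘(ℝ, E) x) (w : TangentSpace 𝓘(ℝ, E) x)
  levi_pos : ∀ x (v : D x), v ≠ 0 →
    0 < extDerivForm θ x (J x v : TangentSpace 𝓘(ℝ, E) x) (v : TangentSpace 𝓘(ℝ, E) x)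

variable (E M) in
/-- A strictly pseudo-convex `CR`-structure `{D, J}`: a smooth complex structure `J` on a
distribution `D` which is induced by a pseudo-Hermitian structure `{θ, J}`. Formal integrability of
`J` is not required. -/
structure CRStructure where
  /-- the contact distribution -/
  D : ∀ x : M, Submodule ℝ (TangentSpace 𝓘(ℝ, E) x)
  /-- the complex structure on the contact distribution -/
  J : ∀ x : M, D x →ₗ[ℝ] D x
  J_J : ∀ x (v : D x), J x (J x v) = -v
  /-- `J` maps smooth local sections of `D` to smooth local sections. -/
  smooth_J : ∀ (U : Set M), IsOpen U → ∀ X : ∀ x : M, D x,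
    ContMDiffOn 𝓘(ℝ, E) 𝓘(ℝ, E).tangent ∞
      (fun x => (⟨x, (X x : TangentSpace 𝓘(ℝ, E) x)⟩ : TangentBundle 𝓘(ℝ, E) M)) U →
    ContMDiffOn 𝓘(ℝ, E) 𝓘(ℝ, E).tangent ∞
      (fun x => (⟨x, (J x (X x) : TangentSpace 𝓘(ℝ, E) x)⟩ : TangentBundle 𝓘(ℝ, E) M)) U
  exists_pseudoHermitian : ∃ θ, IsPseudoHermitian D J θ

variable (G : Type*) [Group G] [MulAction G M]

/-- `G` acts by `CR`-automorphisms: `α_* D = D` and `α_* ∘ J = J ∘ α_*` on `D`, for all `α ∈ G`. -/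
def CRStructure.IsPreservedBy (S : CRStructure E M) : Prop :=
  ∀ (α : G) (x : M),
    (S.D x).map (mfderiv 𝓘(ℝ, E) 𝓘(ℝ, E) (fun y : M => α • y) x).toLinearMap = S.D (α • x) ∧
    ∀ (v : S.D x) (w : S.D (α • x)),
      (w : TangentSpace 𝓘(ℝ, E) (α • x)) = mfderiv 𝓘(ℝ, E) 𝓘(ℝ, E) (fun y : M => α • y) x v →
      (S.J (α • x) w : TangentSpace 𝓘(ℝ, E) (α • x)) =
        mfderiv 𝓘(ℝ, E) 𝓘(ℝ, E) (fun y : M => α • y) x (S.J x v)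

/-- `G` preserves the conformal class of the Riemannian metric `g`: every `α ∈ G` satisfies
`α^* g = u · g` for some smooth positive function `u`. -/
def PreservesConformalClass
    (g : ContMDiffRiemannianMetric 𝓘(ℝ, E) ∞ E (fun x : M => TangentSpace 𝓘(ℝ, E) x)) : Prop :=
  ∀ α : G, ∃ u : M → ℝ, ContMDiff 𝓘(ℝ, E) 𝓘(ℝ, ℝ) ∞ u ∧ (∀ x, 0 < u x) ∧
    ∀ (x : M) (v w : TangentSpace 𝓘(ℝ, E) x),
      g.inner (α • x) (mfderiv 𝓘(ℝ, E) 𝓘(ℝ, E) (fun y : M => α • y) x v)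
        (mfderiv 𝓘(ℝ, E) 𝓘(ℝ, E) (fun y : M => α • y) x w) = u x * g.inner x v w

end Geometry

end DiffCoh

end

noncomputable section

set_option maxSynthPendingDepth 3

namespace DiffCoh

/-! ### Weak boundedness and weak differentiability in locally convex spaces -/

section Weak

/-! Properness gives vanishing by averaging. A proper action has a smooth cut-off `χ` on `M` such
that `γ ↦ χ(γ⁻¹x)` is supported in a compact set, locally uniformly in `x`, and has Haar integral
`1` for every `x` (`exists_normalized_cutoff`). For a cocycle `c` put `h(a)(x) = ∫ χ(γ⁻¹x) c(a,
(∏a)⁻¹γ)(x) dγ`. Integrating the cocycle identity against `χ` gives `∂h = ±c`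
(`exists_coboundary_eq_of_properSMul`).

The analysis behind this is done by testing against continuous functionals. In a quasi-complete
space weakly smooth maps are smooth (`WeaklySmoothOn.isSmoothOn`), compactly supported continuous
functions have weak integrals (`exists_weak_integral`), and a smooth map `X → C^∞(M, V)` is the same
as a weakly smooth map on `X × M` (`contMDiff_uncurry`, `isSmoothMap_of_contMDiff_uncurry`).

Conversely, the geometric structure is preserved up to a factor `u`: `α^*g = u_α g`, or `α^*ω = u_α
ω` for the contact form. This factor is a multiplicative cocycle, smooth in both variables, so `log
|u|` is an additive cocycle in `C^∞(M, ℝ)`. If it is the coboundary of `f`, rescaling by `e^{-f}`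
makes the metric invariant, and makes the contact form invariant up to sign. In the CR case the Levi
form and the Reeb field of the rescaled form then assemble into an invariant Riemannian metric.

It remains that a closed group of isometries acts properly (`properSMul_of_isClosedInDiff`). On a
connected manifold an ultrafilter of isometries converging at one point converges at all points. By
the Koszul formula the second derivative of an isometry is a smooth function of its `1`-jet, so the
limit is smooth and all derivatives converge. Closedness puts the limit into the group, and the open
mapping theorem for `σ`-compact groups turns pointwise convergence into convergence in the Lie
group. -/

theorem exists_linearMap_abs_le_mul_norm {E : Type*} [SeminormedAddCommGroup E] [NormedSpace ℝ E]
    (g : StrongDual ℝ E) : ∃ l : E →ₗ[ℝ] ℝ, (∀ v, l v = g v) ∧ ∃ C : ℝ, ∀ v, ‖l v‖ ≤ C * ‖v‖ :=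
  ⟨g.toLinearMap, fun _ => rfl, ‖g‖, g.le_opNorm⟩

/-- The points `s i` act as functionals on the dual, which is complete whether or not `E` is, so
Banach–Steinhaus applies there; a norming functional carries the bound back to `s i`. -/
theorem exists_norm_le_of_dual_bounded {E : Type*} [SeminormedAddCommGroup E] [NormedSpace ℝ E]
    {ι : Type*} (s : ι → E) (h : ∀ g : StrongDual ℝ E, ∃ C, ∀ i, |g (s i)| ≤ C) :
    ∃ C, ∀ i, ‖s i‖ ≤ C := by
  obtain ⟨C, hC⟩ := banach_steinhaus (g := fun i => NormedSpace.inclusionInDoubleDual ℝ E (s i))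
    (fun g => by simpa using h g)
  refine ⟨C, fun i => ?_⟩
  obtain ⟨g, hg, hgs⟩ := exists_dual_vector'' ℝ (s i)
  have h1 := (NormedSpace.inclusionInDoubleDual ℝ E (s i)).le_opNorm g
  rw [NormedSpace.dual_def, hgs] at h1
  have h2 : ‖s i‖ ≤ ‖NormedSpace.inclusionInDoubleDual ℝ E (s i)‖ * ‖g‖ := by simpa using h1
  have h3 := hC i
  nlinarith [norm_nonneg (NormedSpace.inclusionInDoubleDual ℝ E (s i)), norm_nonneg g]

variable {V : Type*} [AddCommGroup V] [Module ℝ V]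

section Top

variable [TopologicalSpace V] [IsTopologicalAddGroup V] [ContinuousSMul ℝ V]

/-- A weakly bounded family is bounded for every continuous seminorm. -/
theorem exists_seminorm_le_of_weakly_bounded {p : Seminorm ℝ V} (hp : Continuous p) {ι : Type*}
    (s : ι → V) (h : ∀ ℓ : V →L[ℝ] ℝ, ∃ C, ∀ i, |ℓ (s i)| ≤ C) : ∃ C, ∀ i, p (s i) ≤ C := by
  -- `V` is viewed with the seminorm `p` alone. A `p`-bounded functional is also continuous for the
  -- original topology, because `p` is, so the hypothesis covers it.
  let N : SeminormedAddCommGroup V := p.toAddGroupSeminorm.toSeminormedAddCommGroup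
  let S : @NormedSpace ℝ V _ N :=
    @NormedSpace.mk ℝ V _ N ‹Module ℝ V› (fun a b => (map_smul_eq_mul p a b).le)
  refine @exists_norm_le_of_dual_bounded V N S ι s fun g => ?_
  have hb : ∃ l : V →ₗ[ℝ] ℝ, (∀ v, l v = g v) ∧ ∃ C : ℝ, ∀ v, ‖l v‖ ≤ C * p v :=
    @exists_linearMap_abs_le_mul_norm V N S g
  obtain ⟨l, hlg, C, hC⟩ := hb
  have hl : Continuous l := by
    refine continuous_of_continuousAt_zero l.toAddMonoidHom ?_
    have : Tendsto (fun v => C * p v) (𝓝 0) (𝓝 0) := by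
      have := (hp.tendsto 0).const_mul C
      simpa using this
    have h0 : Tendsto (fun v => l v) (𝓝 0) (𝓝 0) := squeeze_zero_norm hC this
    simpa [ContinuousAt] using h0
  obtain ⟨C', hC'⟩ := h ⟨l, hl⟩
  exact ⟨C', fun i => by rw [← hlg]; exact hC' i⟩

variable [LocallyConvexSpace ℝ V]

theorem tendsto_of_forall_seminorm {α : Type*} {l : Filter α} {f : α → V} {y : V}
    (h : ∀ p : Seminorm ℝ V, Continuous p → Tendsto (fun a => p (f a - y)) l (𝓝 0)) :
    Tendsto f l (𝓝 y) := by
  have hw := with_gaugeSeminormFamily (𝕜 := ℝ) (E := V)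
  rw [hw.tendsto_nhds]
  intro i ε hε
  exact (h _ (hw.continuous_seminorm i)).eventually_lt_const hε

theorem exists_dual_ne [T2Space V] {x y : V} (h : ∀ ℓ : V →L[ℝ] ℝ, ℓ x = ℓ y) : x = y := by
  by_contra hne
  obtain ⟨ℓ, hℓ⟩ := geometric_hahn_banach_point_point hne
  exact hℓ.ne (h ℓ)

variable {E : Type*} [NormedAddCommGroup E] [NormedSpace ℝ E]

/-- A map is weakly smooth if its composition with every continuous functional is smooth. -/
def WeaklySmoothOn (f : E → V) (U : Set E) : Prop :=
  ∀ ℓ : V →L[ℝ] ℝ, ContDiffOn ℝ ∞ (fun x => ℓ (f x)) U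

/-- By the mean value inequality the quotients `‖y - x‖⁻¹ • (f y - f x)` are weakly bounded near
`x`, hence bounded in every continuous seminorm. So `f` satisfies a Lipschitz estimate at `x` for
each seminorm. -/
theorem continuousOn_of_weakly_contDiffOn [FiniteDimensional ℝ E] {f : E → V} {U : Set E}
    (hU : IsOpen U) (hf : ∀ ℓ : V →L[ℝ] ℝ, ContDiffOn ℝ 1 (fun x => ℓ (f x)) U) :
    ContinuousOn f U := by
  have : ProperSpace E := FiniteDimensional.proper ℝ E
  intro x hx
  refine ContinuousAt.continuousWithinAt ?_
  obtain ⟨r, hr, hrU⟩ := Metric.nhds_basis_closedBall.mem_iff.1 (hU.mem_nhds hx)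
  refine tendsto_of_forall_seminorm fun p hp => ?_
  obtain ⟨C, hC⟩ := exists_seminorm_le_of_weakly_bounded hp
    (fun y : Metric.closedBall x r => ‖(y : E) - x‖⁻¹ • (f y - f x)) fun ℓ => by
      have hd : ContinuousOn (fderiv ℝ fun y => ℓ (f y)) (Metric.closedBall x r) :=
        ((hf ℓ).continuousOn_fderiv_of_isOpen hU le_rfl).mono hrU
      obtain ⟨C, hC⟩ := (isCompact_closedBall x r).exists_bound_of_continuousOn hd
      refine ⟨C, fun y => ?_⟩
      have h1 := (convex_closedBall x r).norm_image_sub_le_of_norm_fderiv_le (𝕜 := ℝ)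
        (f := fun y => ℓ (f y)) (C := C)
        (fun z hz => ((hf ℓ).differentiableOn one_ne_zero).differentiableAt (hU.mem_nhds (hrU hz)))
        hC (Metric.mem_closedBall_self hr.le) y.2
      simp only [map_smul, map_sub, smul_eq_mul, abs_mul, abs_inv, abs_norm]
      have hC0 : 0 ≤ C := (norm_nonneg _).trans (hC x (Metric.mem_closedBall_self hr.le))
      rw [Real.norm_eq_abs] at h1
      exact inv_mul_le_of_le_mul₀ (norm_nonneg _) hC0 (by linarith)
  have hlim : Tendsto (fun y => C * ‖y - x‖) (𝓝 x) (𝓝 0) := by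
    have : Continuous fun y => C * ‖y - x‖ := by fun_prop
    simpa using this.tendsto x
  refine squeeze_zero' (Eventually.of_forall fun y => apply_nonneg p _) ?_ hlim
  filter_upwards [Metric.closedBall_mem_nhds x hr] with y hy
  have h2 := hC ⟨y, hy⟩
  simp only [map_smul_eq_mul, norm_inv, norm_norm] at h2
  rcases eq_or_ne y x with rfl | hne
  · simp
  · have h0 : 0 < ‖y - x‖ := norm_pos_iff.2 (sub_ne_zero.2 hne)
    rw [inv_mul_le_iff₀ h0] at h2
    linarith

theorem WeaklySmoothOn.continuousOn [FiniteDimensional ℝ E] {f : E → V} {U : Set E}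
    (hU : IsOpen U) (hf : WeaklySmoothOn f U) : ContinuousOn f U :=
  continuousOn_of_weakly_contDiffOn hU fun ℓ => (hf ℓ).of_le (by simp)

end Top

/-- The mean value inequality is applied twice: to `φ'`, then to `s ↦ φ s - s φ'(0)` on `[-|t|,
|t|]`. -/
theorem exists_abs_sub_sub_le_sq {φ : ℝ → ℝ} {O : Set ℝ} (hO : IsOpen O)
    (hφ : ContDiffOn ℝ 2 φ O) {r : ℝ} (hr : 0 ≤ r) (hrO : Icc (-r) r ⊆ O) :
    ∃ C, 0 ≤ C ∧ ∀ t ∈ Icc (-r) r, |φ t - φ 0 - t * deriv φ 0| ≤ C * |t| ^ 2 := by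
  have hφ' : ContDiffOn ℝ 1 (deriv φ) O :=
    ((contDiffOn_succ_iff_deriv_of_isOpen (n := 1) hO).1
      (by simpa [one_add_one_eq_two] using hφ)).2.2
  have hdd : ContinuousOn (deriv (deriv φ)) (Icc (-r) r) :=
    (hφ'.continuousOn_deriv_of_isOpen hO le_rfl).mono hrO
  obtain ⟨C, hC⟩ := isCompact_Icc.exists_bound_of_continuousOn hdd
  have h0 : (0 : ℝ) ∈ Icc (-r) r := ⟨by linarith, hr⟩
  refine ⟨C, (norm_nonneg _).trans (hC 0 h0), fun t ht => ?_⟩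
  have hd1 : ∀ s ∈ Icc (-r) r, ‖deriv φ s - deriv φ 0‖ ≤ C * ‖s - 0‖ := fun s hs =>
    (convex_Icc (-r) r).norm_image_sub_le_of_norm_deriv_le
      (fun z hz => (hφ'.differentiableOn one_ne_zero).differentiableAt (hO.mem_nhds (hrO hz)))
      hC h0 hs
  have hsub : Icc (-|t|) |t| ⊆ Icc (-r) r := Icc_subset_Icc (neg_le_neg (abs_le.2 ht)) (abs_le.2 ht)
  have hdφ : ∀ z ∈ Icc (-|t|) |t|, HasDerivAt (fun s => φ s - s * deriv φ 0)
      (deriv φ z - deriv φ 0) z := fun z hz => by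
    have := ((hφ.differentiableOn two_ne_zero).differentiableAt
      (hO.mem_nhds (hrO (hsub hz)))).hasDerivAt
    have h := this.sub ((hasDerivAt_id z).mul_const (deriv φ 0))
    rw [one_mul] at h
    exact h
  have h2 := (convex_Icc (-|t|) |t|).norm_image_sub_le_of_norm_deriv_le
    (f := fun s => φ s - s * deriv φ 0) (C := C * |t|) (x := 0) (y := t)
    (fun z hz => (hdφ z hz).differentiableAt)
    (fun z hz => by
      rw [(hdφ z hz).deriv]
      refine (hd1 z (hsub hz)).trans ?_
      rw [sub_zero, Real.norm_eq_abs]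
      exact mul_le_mul_of_nonneg_left (abs_le.2 hz) ((norm_nonneg _).trans (hC 0 h0)))
    (by simp) ⟨neg_abs_le t, le_abs_self t⟩
  simp only [Real.norm_eq_abs, sub_zero, zero_mul] at h2
  calc |φ t - φ 0 - t * deriv φ 0| = |φ t - t * deriv φ 0 - φ 0| := by ring_nf
    _ ≤ _ := h2
    _ = _ := by ring

variable [UniformSpace V] [IsUniformAddGroup V] [ContinuousSMul ℝ V] [LocallyConvexSpace ℝ V]
  [QuasiCompleteSpace ℝ V]

/-- A weakly `C^2` curve in a quasi-complete space is differentiable. -/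
theorem exists_tendsto_slope_of_weakly_contDiffOn [T2Space V] {γ : ℝ → V} {O : Set ℝ} (hO : IsOpen O)
    (h0 : (0 : ℝ) ∈ O) (hγ : ∀ ℓ : V →L[ℝ] ℝ, ContDiffOn ℝ 2 (fun t => ℓ (γ t)) O) :
    ∃ d, Tendsto (fun t : ℝ => t⁻¹ • (γ t - γ 0)) (𝓝[≠] (0 : ℝ)) (𝓝 d) := by
  obtain ⟨r, hr, hrO⟩ := Metric.nhds_basis_closedBall.mem_iff.1 (hO.mem_nhds h0)
  rw [Real.closedBall_eq_Icc, zero_sub, zero_add] at hrO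
  let q : ℝ → V := fun t => t⁻¹ • (γ t - γ 0)
  let I : Set ℝ := Icc (-r) r \ {0}
  -- Second order control yields a linear rate of weak convergence of the quotients, with a constant
  -- depending on `ℓ`.
  have key : ∀ ℓ : V →L[ℝ] ℝ, ∃ C, 0 ≤ C ∧ ∀ t ∈ I, |ℓ (q t) - deriv (fun t => ℓ (γ t)) 0|
      ≤ C * |t| := fun ℓ => by
    obtain ⟨C, hC0, hC⟩ := exists_abs_sub_sub_le_sq hO (hγ ℓ) hr.le hrO
    refine ⟨C, hC0, fun t ht => ?_⟩
    have ht0 : t ≠ 0 := ht.2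
    have h1 := hC t ht.1
    have h2 : ℓ (γ t) - ℓ (γ 0) - t * deriv (fun t => ℓ (γ t)) 0
        = t * (ℓ (q t) - deriv (fun t => ℓ (γ t)) 0) := by
      simp only [q, map_smul, map_sub, smul_eq_mul]
      field_simp
    rw [h2, abs_mul, pow_two] at h1
    have : 0 < |t| := abs_pos.2 ht0
    nlinarith
  have hI : I ∈ 𝓝[≠] (0 : ℝ) :=
    sdiff_mem_nhdsWithin_compl (Icc_mem_nhds (by linarith) hr) {0}
  have hbdd : Bornology.IsVonNBounded ℝ (q '' I) := by
    rw [(with_gaugeSeminormFamily (𝕜 := ℝ) (E := V)).image_isVonNBounded_iff_seminorm_bounded]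
    intro i
    obtain ⟨C, hC⟩ := exists_seminorm_le_of_weakly_bounded
      ((with_gaugeSeminormFamily (𝕜 := ℝ) (E := V)).continuous_seminorm i)
      (fun t : I => q t) fun ℓ => by
        obtain ⟨C, hC0, hC⟩ := key ℓ
        refine ⟨|deriv (fun t => ℓ (γ t)) 0| + C * r, fun t => ?_⟩
        have h1 := hC t t.2
        have h2 : |(t : ℝ)| ≤ r := abs_le.2 t.2.1
        have h3 := abs_sub_abs_le_abs_sub (ℓ (q t)) (deriv (fun t => ℓ (γ t)) 0)
        nlinarith
    exact ⟨|C| + 1, by positivity, fun x hx =>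
      ((hC ⟨x, hx⟩).trans (le_abs_self C)).trans_lt (by linarith)⟩
  -- By the linear rate, `(|s| + |t|)⁻¹ • (q t - q s)` is weakly bounded, hence bounded in each
  -- seminorm, which makes `q` Cauchy at `0`.
  have hcau : Cauchy (map q (𝓝[≠] (0 : ℝ))) := by
    rw [cauchy_map_iff]
    refine ⟨inferInstance, ?_⟩
    rw [uniformity_eq_comap_nhds_zero, tendsto_comap_iff]
    refine tendsto_of_forall_seminorm fun p hp => ?_
    obtain ⟨C, hC⟩ := exists_seminorm_le_of_weakly_bounded hp
      (fun t : I × I => (|(t.1 : ℝ)| + |(t.2 : ℝ)|)⁻¹ • (q t.2 - q t.1)) fun ℓ => by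
        obtain ⟨C, hC0, hC⟩ := key ℓ
        refine ⟨C, fun t => ?_⟩
        have h1 := hC t.1 t.1.2
        have h2 := hC t.2 t.2.2
        have h3 := abs_sub_le (ℓ (q t.2)) (deriv (fun t => ℓ (γ t)) 0) (ℓ (q t.1))
        rw [abs_sub_comm (deriv (fun t => ℓ (γ t)) 0) (ℓ (q t.1))] at h3
        have hp : 0 < |(t.1 : ℝ)| + |(t.2 : ℝ)| :=
          add_pos_of_pos_of_nonneg (abs_pos.2 t.1.2.2) (abs_nonneg _)
        rw [map_smul, smul_eq_mul, abs_mul, abs_inv, abs_of_pos hp, inv_mul_le_iff₀ hp, map_sub]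
        nlinarith
    have hlim : Tendsto (fun t : ℝ × ℝ => C * (|t.1| + |t.2|)) (𝓝[≠] (0 : ℝ) ×ˢ 𝓝[≠] (0 : ℝ))
        (𝓝 0) := by
      have : Continuous fun t : ℝ × ℝ => C * (|t.1| + |t.2|) := by fun_prop
      have h := this.tendsto (0, 0)
      rw [nhds_prod_eq] at h
      simpa using h.mono_left (prod_mono nhdsWithin_le_nhds nhdsWithin_le_nhds)
    refine squeeze_zero' (Eventually.of_forall fun y => apply_nonneg p _) ?_ hlim
    filter_upwards [prod_mem_prod hI hI] with t ht
    have h2 := hC (⟨t.1, ht.1⟩, ⟨t.2, ht.2⟩)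
    have hp : 0 < |t.1| + |t.2| := add_pos_of_pos_of_nonneg (abs_pos.2 ht.1.2) (abs_nonneg _)
    simp only [map_smul_eq_mul, norm_inv, Real.norm_eq_abs, abs_of_pos hp] at h2
    rw [inv_mul_le_iff₀ hp] at h2
    simp only [Function.comp, sub_zero]
    linarith
  -- Quasi-completeness concerns only bounded closed sets, which is why `q` was first shown to be
  -- bounded on `I`.
  have hcompl : IsComplete (closure (q '' I)) :=
    QuasiCompleteSpace.quasiComplete (𝕜 := ℝ) hbdd.closure isClosed_closure
  obtain ⟨d, -, hd⟩ := hcompl _ hcau (le_principal_iff.2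
    (mem_of_superset (image_mem_map hI) subset_closure))
  exact ⟨d, hd⟩

end Weak

/-! ### Weakly smooth maps into quasi-complete spaces are smooth. -/

section WeakSmooth

variable {E : Type*} [NormedAddCommGroup E] [NormedSpace ℝ E]

theorem iterDirDeriv_eq_iteratedFDeriv {F : Type*} [NormedAddCommGroup F] [NormedSpace ℝ F]
    {f : E → F} {U : Set E} (hU : IsOpen U) (hf : ContDiffOn ℝ ∞ f U) (k : ℕ) {x : E} (hx : x ∈ U)
    (v : Fin k → E) : iterDirDeriv f k x v = iteratedFDeriv ℝ k f x v := by
  refine iterDirDeriv_eq_of hU (fun k x v => iteratedFDeriv ℝ k f x v) (fun _ _ _ => by simp) ?_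
    k x hx v
  intro k x hx v
  have h1 : DifferentiableAt ℝ (iteratedFDeriv ℝ k f) x :=
    ((hf.contDiffAt (hU.mem_nhds hx)).differentiableAt_iteratedFDeriv
      (by exact_mod_cast ENat.natCast_lt_top k))
  have h2 : HasFDerivAt (fun y => iteratedFDeriv ℝ k f y (Fin.tail v))
      ((ContinuousMultilinearMap.apply ℝ (fun _ : Fin k => E) F (Fin.tail v)).comp
        (fderiv ℝ (iteratedFDeriv ℝ k f) x)) x :=
    (ContinuousMultilinearMap.apply ℝ (fun _ : Fin k => E) F (Fin.tail v)).hasFDerivAt.comp x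
      h1.hasFDerivAt
  have h3 := (h2.hasLineDerivAt (v 0)).tendsto_slope_zero
  rw [iteratedFDeriv_succ_apply_left]
  exact h3

variable {V : Type*} [AddCommGroup V] [Module ℝ V] [UniformSpace V] [IsUniformAddGroup V]
  [ContinuousSMul ℝ V] [LocallyConvexSpace ℝ V] [QuasiCompleteSpace ℝ V] [T2Space V]

theorem WeaklySmoothOn.exists_tendsto_slope {f : E → V} {U : Set E} (hU : IsOpen U)
    (hf : WeaklySmoothOn f U) {x : E} (hx : x ∈ U) (v : E) :
    ∃ d, Tendsto (fun t : ℝ => t⁻¹ • (f (x + t • v) - f x)) (𝓝[≠] (0 : ℝ)) (𝓝 d) := by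
  have hc : ContDiff ℝ 2 fun t : ℝ => x + t • v := by fun_prop
  have := exists_tendsto_slope_of_weakly_contDiffOn (γ := fun t : ℝ => f (x + t • v))
    (hU.preimage hc.continuous) (by simpa using hx)
    fun ℓ => (contDiffOn_infty.1 (hf ℓ) 2).comp hc.contDiffOn fun t ht => ht
  simpa using this

/-- The two claims feed each other in an induction on `k`. If functionals commute with the `k`-th
derivative, that derivative is itself weakly smooth, so its slopes converge and `limUnder` is a
genuine limit; functionals commute with this limit, which gives the claim for `k + 1`. -/
theorem WeaklySmoothOn.apply_iterDirDeriv_and_tendsto {f : E → V} {U : Set E}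
    (hU : IsOpen U) (hf : WeaklySmoothOn f U) (k : ℕ) :
    (∀ x ∈ U, ∀ (v : Fin k → E) (ℓ : V →L[ℝ] ℝ),
      ℓ (iterDirDeriv f k x v) = iteratedFDeriv ℝ k (fun y => ℓ (f y)) x v) ∧
    ∀ x ∈ U, ∀ v : Fin (k + 1) → E,
      Tendsto (fun t : ℝ =>
        t⁻¹ • (iterDirDeriv f k (x + t • v 0) (Fin.tail v) - iterDirDeriv f k x (Fin.tail v)))
      (𝓝[≠] (0 : ℝ)) (𝓝 (iterDirDeriv f (k + 1) x v)) := by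
  have step : ∀ k, (∀ x ∈ U, ∀ (v : Fin k → E) (ℓ : V →L[ℝ] ℝ),
      ℓ (iterDirDeriv f k x v) = iteratedFDeriv ℝ k (fun y => ℓ (f y)) x v) →
      ∀ x ∈ U, ∀ v : Fin (k + 1) → E,
      Tendsto (fun t : ℝ =>
        t⁻¹ • (iterDirDeriv f k (x + t • v 0) (Fin.tail v) - iterDirDeriv f k x (Fin.tail v)))
      (𝓝[≠] (0 : ℝ)) (𝓝 (iterDirDeriv f (k + 1) x v)) := by
    intro k hk x hx v
    have hw : WeaklySmoothOn (fun y => iterDirDeriv f k y (Fin.tail v)) U := fun ℓ => by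
      have h1 : ContDiffOn ℝ ∞ (fun y => iteratedFDeriv ℝ k (fun y => ℓ (f y)) y (Fin.tail v)) U :=
        fun y hy => by
          have h2 : ContDiffAt ℝ ∞ (iteratedFDeriv ℝ k (fun y => ℓ (f y))) y :=
            ((hf ℓ).contDiffAt (hU.mem_nhds hy)).iteratedFDeriv_right (by exact_mod_cast le_top)
          exact ((ContinuousMultilinearMap.apply ℝ (fun _ : Fin k => E) ℝ
            (Fin.tail v)).contDiff.contDiffAt.comp y h2).contDiffWithinAt
      exact h1.congr fun y hy => hk y hy _ ℓ
    obtain ⟨d, hd⟩ := hw.exists_tendsto_slope hU hx (v 0)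
    have : iterDirDeriv f (k + 1) x v = d := hd.limUnder_eq
    rw [this]
    exact hd
  have h1 : ∀ x ∈ U, ∀ (v : Fin k → E) (ℓ : V →L[ℝ] ℝ),
      ℓ (iterDirDeriv f k x v) = iteratedFDeriv ℝ k (fun y => ℓ (f y)) x v := by
    induction k with
    | zero => intro x hx v ℓ; simp [iterDirDeriv]
    | succ k ih =>
      intro x hx v ℓ
      rw [← iterDirDeriv_eq_iteratedFDeriv hU (hf ℓ) _ hx]
      refine (Tendsto.limUnder_eq ?_).symm
      refine ((ℓ.continuous.tendsto _).comp (step k ih x hx v)).congr' ?_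
      filter_upwards [eventually_line_mem hU hx (v 0)] with t ht
      simp only [Function.comp, map_smul, map_sub, ih _ ht, ih _ hx,
        iterDirDeriv_eq_iteratedFDeriv hU (hf ℓ) _ ht, iterDirDeriv_eq_iteratedFDeriv hU (hf ℓ) _ hx]
  exact ⟨h1, step k h1⟩

set_option synthInstance.maxHeartbeats 200000 in
theorem _root_.ContDiffWithinAt.continuousMultilinear_apply {X F : Type*} [NormedAddCommGroup X]
    [NormedSpace ℝ X] [NormedAddCommGroup F] [NormedSpace ℝ F] {n : WithTop ℕ∞} {k : ℕ}
    {c : X → ContinuousMultilinearMap ℝ (fun _ : Fin k => E) F} {v : X → Fin k → E} {s : Set X}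
    {x : X} (hc : ContDiffWithinAt ℝ n c s x) (hv : ContDiffWithinAt ℝ n v s x) :
    ContDiffWithinAt ℝ n (fun x => c x (v x)) s x := by
  induction k with
  | zero =>
    have := (continuousMultilinearCurryFin0 ℝ E F).contDiff.contDiffAt.comp_contDiffWithinAt x hc
    refine this.congr_of_eventuallyEq (Eventually.of_forall fun y => ?_) ?_ <;>
    · simp only [Function.comp, continuousMultilinearCurryFin0_apply]
      congr 1
      exact Subsingleton.elim _ _
  | succ k ih =>
    have hL : ContDiff ℝ n (continuousMultilinearCurryLeftEquiv ℝ (fun _ : Fin (k + 1) => E) F) :=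
      LinearIsometryEquiv.contDiff (E := E [×(k + 1)]→L[ℝ] F) (F := E →L[ℝ] E [×k]→L[ℝ] F) _
    have h1 := hL.contDiffAt.comp_contDiffWithinAt x hc
    have hv' := contDiffWithinAt_pi.1 hv
    have h2 := h1.clm_apply (hv' 0)
    have h3 := ih (v := fun x => Fin.tail (v x)) h2
      (contDiffWithinAt_pi.2 fun i => hv' i.succ)
    refine h3.congr_of_eventuallyEq (Eventually.of_forall fun y => ?_) ?_ <;>
    · change _ = (c _) (Fin.cons (v _ 0) (Fin.tail (v _)))
      rw [Fin.cons_self_tail]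

theorem contDiffOn_iteratedFDeriv_apply {F : Type*} [NormedAddCommGroup F] [NormedSpace ℝ F]
    {f : E → F} {U : Set E} (hU : IsOpen U) (hf : ContDiffOn ℝ ∞ f U) (k : ℕ) :
    ContDiffOn ℝ ∞ (fun p : E × (Fin k → E) => iteratedFDeriv ℝ k f p.1 p.2) (U ×ˢ univ) := by
  have h2 : ContDiffOn ℝ ∞ (fun p : E × (Fin k → E) => iteratedFDeriv ℝ k f p.1) (U ×ˢ univ) :=
    ContDiffOn.comp (g := iteratedFDeriv ℝ k f) (t := U) (fun y hy =>
      ((hf.contDiffAt (hU.mem_nhds hy)).iteratedFDeriv_right (by exact_mod_cast le_top)).contDiffWithinAt)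
      contDiff_fst.contDiffOn (fun p hp => hp.1)
  intro p hp
  exact (h2 p hp).continuousMultilinear_apply contDiff_snd.contDiffWithinAt

/-- For continuity of the derivatives, `(x, v) ↦ dᵏ f (x; v)` is regarded as a map on `U × Eᵏ`; it
is again weakly smooth there, hence continuous. -/
theorem WeaklySmoothOn.isSmoothOn [FiniteDimensional ℝ E] {f : E → V} {U : Set E}
    (hU : IsOpen U) (hf : WeaklySmoothOn f U) : IsSmoothOn f U := by
  refine ⟨fun k => (hf.apply_iterDirDeriv_and_tendsto hU k).2, fun k => ?_⟩
  refine WeaklySmoothOn.continuousOn (hU.prod isOpen_univ) fun ℓ => ?_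
  refine (contDiffOn_iteratedFDeriv_apply hU (hf ℓ) k).congr fun p hp => ?_
  exact (hf.apply_iterDirDeriv_and_tendsto hU k).1 p.1 hp.1 p.2 ℓ

end WeakSmooth

/-! ### Smoothness from continuous partial derivatives -/

section Partial

variable {N : Type*} [NormedAddCommGroup N] [NormedSpace ℝ N] {ι : Type*} [Fintype ι]

theorem abs_sub_sub_le_of_hasLineDerivAt {f g : N → ℝ} {y b : N} {c L ε : ℝ}
    (hd : ∀ t, |t| ≤ |c| → HasLineDerivAt ℝ f (g (y + t • b)) (y + t • b) b)
    (hg : ∀ t, |t| ≤ |c| → |g (y + t • b) - L| ≤ ε) :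
    |f (y + c • b) - f y - c * L| ≤ ε * |c| := by
  have hder : ∀ t ∈ Icc (-|c|) |c|, HasDerivAt (fun t : ℝ => f (y + t • b) - t * L)
      (g (y + t • b) - L) t := fun t ht => by
    have h1 : HasDerivAt (fun s : ℝ => f (y + t • b + s • b)) (g (y + t • b)) (t - t) := by
      rw [sub_self]; exact hd t (abs_le.2 ht)
    have h2 := h1.comp_sub_const t t
    have h3 : HasDerivAt (fun s : ℝ => f (y + s • b)) (g (y + t • b)) t := by
      refine h2.congr_of_eventuallyEq (Eventually.of_forall fun s => ?_)
      simp only [add_assoc, ← add_smul, add_sub_cancel]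
    have h4 := h3.sub ((hasDerivAt_id t).mul_const L)
    rw [one_mul] at h4
    exact h4
  have := (convex_Icc (-|c|) |c|).norm_image_sub_le_of_norm_deriv_le (C := ε) (x := 0) (y := c)
    (fun t ht => (hder t ht).differentiableAt)
    (fun t ht => by rw [(hder t ht).deriv]; exact hg t (abs_le.2 ht))
    (by simp) ⟨neg_abs_le c, le_abs_self c⟩
  simp only [Real.norm_eq_abs, zero_smul, add_zero, zero_mul, sub_zero] at this
  calc |f (y + c • b) - f y - c * L| = |f (y + c • b) - c * L - f y| := by ring_nf
    _ ≤ _ := this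

/-- The increment is made one coordinate at a time, and on each segment the mean value inequality
compares `f` with its linear part. -/
theorem hasFDerivAt_of_hasLineDerivAt_basis [FiniteDimensional ℝ N] (b : Module.Basis ι ℝ N)
    {f : N → ℝ} {g : ι → N → ℝ} {O : Set N} (hO : IsOpen O) (hg : ∀ i, ContinuousOn (g i) O)
    (hf : ∀ i, ∀ x ∈ O, HasLineDerivAt ℝ f (g i x) x (b i)) {x : N} (hx : x ∈ O) :
    HasFDerivAt f (∑ i, g i x • (b.coord i).toContinuousLinearMap) x := by
  classical
  rw [hasFDerivAt_iff_isLittleO_nhds_zero, Asymptotics.isLittleO_iff]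
  intro ε hε
  let C : ι → ℝ := fun i => ‖(b.coord i).toContinuousLinearMap‖
  have hC : ∀ i w, |b.coord i w| ≤ C i * ‖w‖ := fun i w =>
    (b.coord i).toContinuousLinearMap.le_opNorm w
  have hC0 : ∀ i, 0 ≤ C i := fun i => norm_nonneg _
  have hS0 : 0 ≤ ∑ i, C i := Finset.sum_nonneg fun i _ => hC0 i
  -- Every partial sum of the coordinate expansion of `w` has norm at most `K‖w‖`, so the broken
  -- path from `x` to `x + w` stays in the `δ`-ball once `(K + 1)‖w‖ < δ`.
  set K : ℝ := ∑ i, C i * ‖b i‖ with hK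
  have hK0 : 0 ≤ K := Finset.sum_nonneg fun i _ => mul_nonneg (hC0 i) (norm_nonneg _)
  set η : ℝ := ε / (∑ i, C i + 1) with hη
  have hη0 : 0 < η := by positivity
  have hev : ∀ᶠ y in 𝓝 x, y ∈ O ∧ ∀ i, |g i y - g i x| ≤ η := by
    refine Eventually.and (hO.mem_nhds hx) (eventually_all.2 fun i => ?_)
    have := (hg i).continuousAt (hO.mem_nhds hx)
    filter_upwards [Metric.tendsto_nhds.1 this η hη0] with y hy
    exact hy.le
  obtain ⟨δ, hδ, hball⟩ := Metric.eventually_nhds_iff.1 hev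
  have hpos : 0 < δ / (K + 1) := by positivity
  filter_upwards [Metric.ball_mem_nhds (0 : N) hpos] with w hw
  rw [mem_ball_zero_iff, lt_div_iff₀ (by positivity)] at hw
  have key : ∀ s : Finset ι, |f (x + ∑ i ∈ s, b.coord i w • b i) - f x
      - ∑ i ∈ s, b.coord i w * g i x| ≤ η * ∑ i ∈ s, |b.coord i w| := by
    intro s
    induction s using Finset.induction_on with
    | empty => simp
    | insert j s hj ih =>
      have hmem : ∀ t, |t| ≤ |b.coord j w| →
          dist (x + ∑ i ∈ s, b.coord i w • b i + t • b j) x < δ := fun t ht => by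
        rw [dist_eq_norm, add_assoc, add_sub_cancel_left]
        calc ‖∑ i ∈ s, b.coord i w • b i + t • b j‖
            ≤ ∑ i ∈ s, ‖b.coord i w • b i‖ + ‖t • b j‖ :=
              (norm_add_le _ _).trans (add_le_add_left (norm_sum_le _ _) _)
          _ ≤ ∑ i ∈ s, C i * ‖w‖ * ‖b i‖ + C j * ‖w‖ * ‖b j‖ := by
              refine add_le_add (Finset.sum_le_sum fun i _ => ?_) ?_
              · rw [norm_smul]
                exact mul_le_mul_of_nonneg_right (hC i w) (norm_nonneg _)
              · rw [norm_smul]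
                exact mul_le_mul_of_nonneg_right (ht.trans (hC j w)) (norm_nonneg _)
          _ = ∑ i ∈ insert j s, C i * ‖w‖ * ‖b i‖ := by
              rw [Finset.sum_insert hj, add_comm]
          _ ≤ ∑ i, C i * ‖w‖ * ‖b i‖ := Finset.sum_le_sum_of_subset_of_nonneg
              (Finset.subset_univ _) fun i _ _ =>
                mul_nonneg (mul_nonneg (hC0 i) (norm_nonneg _)) (norm_nonneg _)
          _ = K * ‖w‖ := by
              rw [hK, Finset.sum_mul]
              exact Finset.sum_congr rfl fun i _ => by ring
          _ < δ := by nlinarith [norm_nonneg w]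
      have h1 := abs_sub_sub_le_of_hasLineDerivAt (f := f) (g := g j) (b := b j)
        (y := x + ∑ i ∈ s, b.coord i w • b i) (c := b.coord j w) (L := g j x) (ε := η)
        (fun t ht => hf j _ (hball (hmem t ht)).1) (fun t ht => (hball (hmem t ht)).2 j)
      rw [Finset.sum_insert hj, Finset.sum_insert hj, Finset.sum_insert hj,
        add_comm (b.coord j w • b j), ← add_assoc]
      have h2 := abs_add_le (f (x + ∑ i ∈ s, b.coord i w • b i + b.coord j w • b j)
        - f (x + ∑ i ∈ s, b.coord i w • b i) - b.coord j w * g j x)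
        (f (x + ∑ i ∈ s, b.coord i w • b i) - f x - ∑ i ∈ s, b.coord i w * g i x)
      refine le_trans (le_of_eq ?_) (h2.trans ((add_le_add h1 ih).trans (le_of_eq ?_)))
      · congr 1; ring
      · ring
  have h1 := key Finset.univ
  simp only [Module.Basis.coord_apply, b.sum_repr] at h1
  simp only [sum_apply, smul_apply,
    LinearMap.coe_toContinuousLinearMap', Module.Basis.coord_apply, smul_eq_mul, Real.norm_eq_abs]
  have h2 : ∑ i, |b.repr w i| ≤ (∑ i, C i) * ‖w‖ := by
    rw [Finset.sum_mul]
    exact Finset.sum_le_sum fun i _ => hC i w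
  calc |f (x + w) - f x - ∑ i, g i x * b.repr w i|
      = |f (x + w) - f x - ∑ i, b.repr w i * g i x| := by simp only [mul_comm]
    _ ≤ η * ∑ i, |b.repr w i| := h1
    _ ≤ η * ((∑ i, C i) * ‖w‖) := mul_le_mul_of_nonneg_left h2 hη0.le
    _ ≤ η * ((∑ i, C i + 1) * ‖w‖) := by
        refine mul_le_mul_of_nonneg_left ?_ hη0.le
        nlinarith [norm_nonneg w]
    _ = ε * ‖w‖ := by rw [hη]; field_simp

/-- A family of continuous functions which is closed under partial derivatives consists of smooth
functions. -/
theorem contDiffOn_of_family [FiniteDimensional ℝ N] (b : Module.Basis ι ℝ N) {O : Set N}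
    (hO : IsOpen O) (𝓕 : Set (N → ℝ)) (hc : ∀ F ∈ 𝓕, ContinuousOn F O)
    (hd : ∀ F ∈ 𝓕, ∀ i, ∃ F' ∈ 𝓕, ∀ x ∈ O, HasLineDerivAt ℝ F (F' x) x (b i)) :
    ∀ F ∈ 𝓕, ContDiffOn ℝ ∞ F O := by
  suffices h : ∀ n : ℕ, ∀ F ∈ 𝓕, ContDiffOn ℝ n F O from
    fun F hF => contDiffOn_infty.2 fun n => h n F hF
  intro n
  induction n with
  | zero => exact fun F hF => contDiffOn_zero.2 (hc F hF)
  | succ n ih =>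
    intro F hF
    choose g hg hgd using hd F hF
    rw [Nat.cast_add, Nat.cast_one,
      contDiffOn_succ_iff_hasFDerivWithinAt_of_uniqueDiffOn hO.uniqueDiffOn]
    refine ⟨by simp, fun x => ∑ i, g i x • (b.coord i).toContinuousLinearMap, ?_, fun x hx =>
      (hasFDerivAt_of_hasLineDerivAt_basis b hO (fun i => hc _ (hg i)) hgd hx).hasFDerivWithinAt⟩
    exact ContDiffOn.sum fun i _ => (ih _ (hg i)).smul contDiffOn_const

end Partial

/-! ### Continuous convergence -/

section Convergence

/-- A filter form of the tube lemma: for compact `K` the filter `l ×ˢ 𝓝ˢ K` is the supremum of the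
filters `l ×ˢ 𝓝 y`, `y ∈ K`. -/
theorem _root_.IsCompact.eventually_forall_of_prod {α Y : Type*} [TopologicalSpace Y]
    {l : Filter α} {K : Set Y} (hK : IsCompact K) {P : α → Y → Prop}
    (hP : ∀ y ∈ K, ∀ᶠ z : α × Y in l ×ˢ 𝓝 y, P z.1 z.2) : ∀ᶠ a in l, ∀ y ∈ K, P a y := by
  simp only [← eventually_iSup, ← hK.prod_nhdsSet_eq_biSup] at hP
  exact hP.curry.mono fun _ h => h.self_of_nhdsSet

/-- Joint convergence in index and point is local in the point, so it is easier to check than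
uniform convergence on compact sets. Limits in `SmoothFun` are verified through it. -/
theorem tendsto_continuousMap_of_continuous_convergence {α Z F : Type*} [TopologicalSpace Z]
    [TopologicalSpace F] {l : Filter α} {f : α → C(Z, F)} {g : C(Z, F)}
    (h : ∀ z, Tendsto (fun p : α × Z => f p.1 p.2) (l ×ˢ 𝓝 z) (𝓝 (g z))) :
    Tendsto f l (𝓝 g) := by
  rw [ContinuousMap.tendsto_nhds_compactOpen]
  intro K hK U hU hgK
  exact hK.eventually_forall_of_prod fun z hz => h z (hU.mem_nhds (hgK hz))

variable {E : Type*} [NormedAddCommGroup E] [NormedSpace ℝ E]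
  {X : Type*} [TopologicalSpace X] [ChartedSpace E X]
  {F : Type*} [AddCommGroup F] [Module ℝ F] [TopologicalSpace F]
  [T2Space F] [IsTopologicalAddGroup F] [ContinuousSMul ℝ F]

theorem tendsto_smoothFun_iff {α : Type*} {l : Filter α} {T : α → SmoothFun E X F}
    {f : SmoothFun E X F} :
    Tendsto T l (𝓝 f) ↔ ∀ (e : IsManifold.maximalAtlas 𝓘(ℝ, E) ∞ X) (k : ℕ),
      Tendsto (fun a => chartJet e k (T a)) l (𝓝 (chartJet e k f)) := by
  simp only [nhds_iInf, tendsto_iInf, nhds_induced, tendsto_comap_iff, Function.comp_def]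

/-- A mean value theorem with values in `V`: a slope lies in any closed convex set containing the
intermediate derivatives, since otherwise Hahn–Banach would separate it and contradict the scalar
mean value theorem. The limit is joint in `t` and `y`. -/
theorem tendsto_slope_of_forall_dual {V : Type*} [AddCommGroup V] [Module ℝ V]
    [TopologicalSpace V] [IsTopologicalAddGroup V] [ContinuousSMul ℝ V] [LocallyConvexSpace ℝ V]
    {Y : Type*} [TopologicalSpace Y] {φ ψ : ℝ → Y → V} {y₀ : Y}
    (hψ : ContinuousAt (fun p : ℝ × Y => ψ p.1 p.2) (0, y₀))
    (hd : ∀ᶠ p : ℝ × Y in 𝓝 (0, y₀), ∀ ℓ : V →L[ℝ] ℝ,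
      HasDerivAt (fun t => ℓ (φ t p.2)) (ℓ (ψ p.1 p.2)) p.1) :
    Tendsto (fun p : ℝ × Y => p.1⁻¹ • (φ p.1 p.2 - φ 0 p.2)) (𝓝[≠] (0 : ℝ) ×ˢ 𝓝 y₀)
      (𝓝 (ψ 0 y₀)) := by
  refine tendsto_of_forall_seminorm fun p hp => ?_
  rw [Metric.tendsto_nhds]
  intro ε hε
  have hcl : IsClosed {v | p (v - ψ 0 y₀) ≤ ε / 2} :=
    isClosed_le (hp.comp (continuous_id.sub continuous_const)) continuous_const
  have hconv : Convex ℝ {v | p (v - ψ 0 y₀) ≤ ε / 2} := by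
    have h1 := p.convex_closedBall (ψ 0 y₀) (ε / 2)
    convert h1 using 1
    ext v
    simp [Seminorm.mem_closedBall]
  have hev : ∀ᶠ q : ℝ × Y in 𝓝 (0, y₀), p (ψ q.1 q.2 - ψ 0 y₀) ≤ ε / 2 := by
    have h1 : Tendsto (fun q : ℝ × Y => p (ψ q.1 q.2 - ψ 0 y₀)) (𝓝 (0, y₀)) (𝓝 0) := by
      have := hp.continuousAt.tendsto.comp (hψ.sub (continuousAt_const (y := ψ 0 y₀)))
      simpa [Function.comp_def] using this
    exact (h1.eventually_lt_const (half_pos hε)).mono fun q hq => hq.le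
  rw [nhds_prod_eq] at hd hev
  obtain ⟨P, hP, Q, hQ, hPQ⟩ := eventually_prod_iff.1 (hd.and hev)
  obtain ⟨δ, hδ, hδP⟩ := Metric.eventually_nhds_iff.1 hP
  have hδ' : ∀ᶠ t : ℝ in 𝓝[≠] (0 : ℝ), |t| < δ ∧ t ≠ 0 := by
    refine Eventually.and ?_ self_mem_nhdsWithin
    refine nhdsWithin_le_nhds ?_
    filter_upwards [Metric.ball_mem_nhds (0 : ℝ) hδ] with t ht
    simpa using ht
  filter_upwards [prod_mem_prod hδ' hQ] with q hq
  obtain ⟨⟨hq1, hq0⟩, hq2⟩ := hq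
  suffices h : q.1⁻¹ • (φ q.1 q.2 - φ 0 q.2) ∈ {v | p (v - ψ 0 y₀) ≤ ε / 2} by
    rw [Real.dist_eq, sub_zero, abs_of_nonneg (apply_nonneg p _)]
    exact lt_of_le_of_lt h (half_lt_self hε)
  by_contra hnot
  obtain ⟨ℓ, u, hu1, hu2⟩ := geometric_hahn_banach_closed_point hconv hcl hnot
  have hder : ∀ s : ℝ, |s| < δ →
      HasDerivAt (fun t => ℓ (φ t q.2)) (ℓ (ψ s q.2)) s ∧ ℓ (ψ s q.2) < u := fun s hs =>
    ⟨(hPQ (hδP (by simpa using hs)) hq2).1 ℓ, hu1 _ (hPQ (hδP (by simpa using hs)) hq2).2⟩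
  have hmvt : ∃ s, |s| < δ ∧ ℓ (q.1⁻¹ • (φ q.1 q.2 - φ 0 q.2)) = ℓ (ψ s q.2) := by
    rcases lt_or_gt_of_ne hq0 with h0 | h0
    · have habs : ∀ s ∈ Icc q.1 0, |s| < δ := fun s hs => by
        rw [abs_of_nonpos hs.2]; rw [abs_of_neg h0] at hq1; linarith [hs.1]
      obtain ⟨s, hs, hs'⟩ := exists_hasDerivAt_eq_slope (fun t => ℓ (φ t q.2))
        (fun t => ℓ (ψ t q.2)) h0
        (fun s hs => (hder s (habs s hs)).1.continuousAt.continuousWithinAt)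
        (fun s hs => (hder s (habs s (Ioo_subset_Icc_self hs))).1)
      refine ⟨s, habs s (Ioo_subset_Icc_self hs), ?_⟩
      rw [hs', map_smul, map_sub, smul_eq_mul]
      field_simp
      ring
    · have habs : ∀ s ∈ Icc 0 q.1, |s| < δ := fun s hs => by
        rw [abs_of_nonneg hs.1]; rw [abs_of_pos h0] at hq1; linarith [hs.2]
      obtain ⟨s, hs, hs'⟩ := exists_hasDerivAt_eq_slope (fun t => ℓ (φ t q.2))
        (fun t => ℓ (ψ t q.2)) h0
        (fun s hs => (hder s (habs s hs)).1.continuousAt.continuousWithinAt)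
        (fun s hs => (hder s (habs s (Ioo_subset_Icc_self hs))).1)
      refine ⟨s, habs s (Ioo_subset_Icc_self hs), ?_⟩
      rw [hs', map_smul, map_sub, smul_eq_mul]
      field_simp
      ring
  obtain ⟨s, hs, hs'⟩ := hmvt
  exact absurd (hu2.trans (hs' ▸ (hder s hs).2)) (lt_irrefl _)

end Convergence

/-! ### Powers of a manifold -/

section Pi

variable {E : Type*} [NormedAddCommGroup E] [NormedSpace ℝ E]
  {X : Type*} [TopologicalSpace X] [ChartedSpace E X]

/-- The product charts on a finite power of a manifold. -/
instance (priority := 50) powChartedSpace (r : ℕ) : ChartedSpace (Fin r → E) (Fin r → X) :=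
  piChartedSpace (fun _ => E) (fun _ => X)

variable [IsManifold 𝓘(ℝ, E) ∞ X]

instance (priority := 50) isManifold_pow (r : ℕ) : IsManifold 𝓘(ℝ, Fin r → E) ∞ (Fin r → X) := by
  refine isManifold_of_contDiffOn _ _ _ ?_
  rintro _ _ ⟨f, hf, rfl⟩ ⟨f', hf', rfl⟩
  refine contDiffOn_pi.2 fun i => ?_
  have h1 : ContMDiffOn 𝓘(ℝ, E) 𝓘(ℝ, E) ∞ (f' i) (f' i).source :=
    contMDiffOn_of_mem_maximalAtlas (IsManifold.subset_maximalAtlas (hf' i (mem_univ i)))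
  have h2 : ContMDiffOn 𝓘(ℝ, E) 𝓘(ℝ, E) ∞ (f i).symm (f i).target :=
    contMDiffOn_symm_of_mem_maximalAtlas (IsManifold.subset_maximalAtlas (hf i (mem_univ i)))
  have h3 := contMDiffOn_iff_contDiffOn.1 (h1.comp' h2)
  refine h3.comp (contDiff_apply ℝ E i).contDiffOn fun y hy => ?_
  have hy1 := hy.1
  simp only [mfld_simps, OpenPartialHomeomorph.pi, PartialEquiv.pi] at hy1
  exact ⟨hy1.1 i (mem_univ i), hy1.2 i (mem_univ i)⟩

variable {H : Type*} [TopologicalSpace H] {E' : Type*} [NormedAddCommGroup E'] [NormedSpace ℝ E']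
  {J : ModelWithCorners ℝ E' H} {Y : Type*} [TopologicalSpace Y] [ChartedSpace H Y]

theorem contMDiff_pow_apply {r : ℕ} (i : Fin r) :
    ContMDiff 𝓘(ℝ, Fin r → E) 𝓘(ℝ, E) ∞ fun a : Fin r → X => a i := by
  intro a
  have h1 : ContMDiffAt 𝓘(ℝ, Fin r → E) 𝓘(ℝ, Fin r → E) ∞ (chartAt (Fin r → E) a) a :=
    contMDiffAt_of_mem_maximalAtlas (IsManifold.chart_mem_maximalAtlas a)
      (mem_chart_source _ a)
  have h2 : ContMDiffAt 𝓘(ℝ, Fin r → E) 𝓘(ℝ, E) ∞ (fun y : Fin r → E => y i)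
      (chartAt (Fin r → E) a a) := (contDiff_apply ℝ E i).contMDiff.contMDiffAt
  have h3 : ContMDiffAt 𝓘(ℝ, E) 𝓘(ℝ, E) ∞ (chartAt E (a i)).symm (chartAt E (a i) (a i)) :=
    contMDiffAt_symm_of_mem_maximalAtlas (IsManifold.chart_mem_maximalAtlas (a i))
      (mem_chart_target _ _)
  refine ((h3.comp a (h2.comp a h1)).congr_of_eventuallyEq ?_)
  filter_upwards [(continuous_apply i).continuousAt.eventually_mem
    (chart_source_mem_nhds E (a i))] with b hb
  exact ((chartAt E (a i)).left_inv hb).symm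

theorem contMDiff_pow {r : ℕ} {g : Y → Fin r → X}
    (hg : ∀ i, ContMDiff J 𝓘(ℝ, E) ∞ fun y => g y i) : ContMDiff J 𝓘(ℝ, Fin r → E) ∞ g := by
  intro y
  have h1 : ContMDiffAt J 𝓘(ℝ, Fin r → E) ∞
      (fun z => chartAt (Fin r → E) (g y) (g z)) y := by
    refine contMDiffAt_pi_space.2 fun i => ?_
    exact ContMDiffAt.comp y (g := chartAt E (g y i)) (contMDiffAt_of_mem_maximalAtlas
      (IsManifold.chart_mem_maximalAtlas (g y i)) (mem_chart_source E (g y i))) (hg i y)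
  have h2 : ContMDiffAt 𝓘(ℝ, Fin r → E) 𝓘(ℝ, Fin r → E) ∞ (chartAt (Fin r → E) (g y)).symm
      (chartAt (Fin r → E) (g y) (g y)) :=
    contMDiffAt_symm_of_mem_maximalAtlas (IsManifold.chart_mem_maximalAtlas (g y))
      (mem_chart_target _ _)
  refine (h2.comp y h1).congr_of_eventuallyEq ?_
  have hc : Continuous g := continuous_pi fun i => (hg i).continuous
  filter_upwards [hc.continuousAt.eventually_mem
    (chart_source_mem_nhds (Fin r → E) (g y))] with b hb
  exact ((chartAt (Fin r → E) (g y)).left_inv hb).symm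

end Pi

/-! ### Smooth families of smooth maps -/

section Charts

variable {EX : Type*} [NormedAddCommGroup EX] [NormedSpace ℝ EX]
  {X : Type*} [TopologicalSpace X] [ChartedSpace EX X] [IsManifold 𝓘(ℝ, EX) ∞ X]
  {EM : Type*} [NormedAddCommGroup EM] [NormedSpace ℝ EM]
  {M : Type*} [TopologicalSpace M] [ChartedSpace EM M] [IsManifold 𝓘(ℝ, EM) ∞ M]

theorem contMDiff_prod_of_charts {F : X × M → ℝ}
    (h : ∀ e ∈ IsManifold.maximalAtlas 𝓘(ℝ, EX) ∞ X, ∀ e' ∈ IsManifold.maximalAtlas 𝓘(ℝ, EM) ∞ M,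
      ContDiffOn ℝ ∞ (fun p : EX × EM => F (e.symm p.1, e'.symm p.2)) (e.target ×ˢ e'.target)) :
    ContMDiff (𝓘(ℝ, EX).prod 𝓘(ℝ, EM)) 𝓘(ℝ, ℝ) ∞ F := by
  rintro ⟨x, m⟩
  have he := IsManifold.chart_mem_maximalAtlas (I := 𝓘(ℝ, EX)) (n := ∞) x
  have he' := IsManifold.chart_mem_maximalAtlas (I := 𝓘(ℝ, EM)) (n := ∞) m
  have h1 : ContMDiffAt (𝓘(ℝ, EX).prod 𝓘(ℝ, EM)) 𝓘(ℝ, EX × EM) ∞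
      (fun p : X × M => (chartAt EX x p.1, chartAt EM m p.2)) (x, m) :=
    ((contMDiffAt_of_mem_maximalAtlas he (mem_chart_source _ x)).comp (x, m)
      contMDiffAt_fst).prodMk_space
      ((contMDiffAt_of_mem_maximalAtlas he' (mem_chart_source _ m)).comp (x, m) contMDiffAt_snd)
  have h2 := ((h _ he _ he').contDiffAt (x := (chartAt EX x x, chartAt EM m m))
    (((chartAt EX x).open_target.prod (chartAt EM m).open_target).mem_nhds
      ⟨mem_chart_target _ x, mem_chart_target _ m⟩)).contMDiffAt
  refine (ContMDiffAt.comp (x, m) h2 h1).congr_of_eventuallyEq ?_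
  filter_upwards [prod_mem_nhds (chart_source_mem_nhds EX x) (chart_source_mem_nhds EM m)] with p hp
  change F p = F (_, _)
  rw [(chartAt EX x).left_inv hp.1, (chartAt EM m).left_inv hp.2]

theorem contDiffOn_charts_of_contMDiff {F : X × M → ℝ}
    (hF : ContMDiff (𝓘(ℝ, EX).prod 𝓘(ℝ, EM)) 𝓘(ℝ, ℝ) ∞ F) {e : OpenPartialHomeomorph X EX}
    (he : e ∈ IsManifold.maximalAtlas 𝓘(ℝ, EX) ∞ X) {e' : OpenPartialHomeomorph M EM}
    (he' : e' ∈ IsManifold.maximalAtlas 𝓘(ℝ, EM) ∞ M) :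
    ContDiffOn ℝ ∞ (fun p : EX × EM => F (e.symm p.1, e'.symm p.2)) (e.target ×ˢ e'.target) := by
  rw [← contMDiffOn_iff_contDiffOn]
  have h1 : ContMDiffOn 𝓘(ℝ, EX × EM) 𝓘(ℝ, EX) ∞ (fun p : EX × EM => e.symm p.1)
      (e.target ×ˢ e'.target) :=
    (contMDiffOn_symm_of_mem_maximalAtlas he).comp contDiff_fst.contMDiff.contMDiffOn
      fun p hp => hp.1
  have h2 : ContMDiffOn 𝓘(ℝ, EX × EM) 𝓘(ℝ, EM) ∞ (fun p : EX × EM => e'.symm p.2)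
      (e.target ×ˢ e'.target) :=
    (contMDiffOn_symm_of_mem_maximalAtlas he').comp contDiff_snd.contMDiff.contMDiffOn
      fun p hp => hp.2
  exact hF.comp_contMDiffOn (h1.prodMk h2)

end Charts

/-! ### From smooth families in `C^∞(M, V)` to functions on the product. -/

section Uncurry

variable {EX : Type*} [NormedAddCommGroup EX] [NormedSpace ℝ EX] [FiniteDimensional ℝ EX]
  {X : Type*} [TopologicalSpace X] [ChartedSpace EX X] [IsManifold 𝓘(ℝ, EX) ∞ X]
  {EM : Type*} [NormedAddCommGroup EM] [NormedSpace ℝ EM] [FiniteDimensional ℝ EM]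
  {M : Type*} [TopologicalSpace M] [ChartedSpace EM M] [IsManifold 𝓘(ℝ, EM) ∞ M]
  {V : Type*} [AddCommGroup V] [Module ℝ V] [TopologicalSpace V] [T2Space V]
  [IsTopologicalAddGroup V] [ContinuousSMul ℝ V]

/-- The functions `Φ` are the mixed derivatives with the `X`-derivatives taken first. They are
closed under partial derivatives: an `X`-derivative passes through the continuous linear map
`chartJet`, and an `M`-derivative is simply one more outer derivative. They are continuous because
evaluation is jointly continuous over a locally compact chart domain. -/
theorem contDiffOn_uncurry {Λ : EX → SmoothFun EM M V} {U : Set EX} (hU : IsOpen U)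
    (hΛ : IsSmoothOn Λ U) (ℓ : V →L[ℝ] ℝ) {e' : OpenPartialHomeomorph M EM}
    (he' : e' ∈ IsManifold.maximalAtlas 𝓘(ℝ, EM) ∞ M) :
    ContDiffOn ℝ ∞ (fun p : EX × EM => ℓ ((Λ p.1).1 (e'.symm p.2))) (U ×ˢ e'.target) := by
  let Φ : (k : ℕ) → (Fin k → EX) → (j : ℕ) → (Fin j → EM) → EX × EM → ℝ := fun k v j w p =>
    ℓ (iterDirDeriv (fun y => (iterDirDeriv Λ k p.1 v).1 (e'.symm y)) j p.2 w)
  let 𝓕 : Set (EX × EM → ℝ) := {F | ∃ k v j w, F = Φ k v j w}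
  let b := (Module.finBasis ℝ EX).prod (Module.finBasis ℝ EM)
  refine contDiffOn_of_family b (hU.prod e'.open_target) 𝓕 ?_ ?_ _
    ⟨0, Fin.elim0, 0, Fin.elim0, rfl⟩
  · rintro _ ⟨k, v, j, w, rfl⟩
    rw [continuousOn_iff_continuous_domRestrict]
    have hD : Continuous fun p : U ×ˢ e'.target => iterDirDeriv Λ k (p : EX × EM).1 v :=
      (hΛ.continuousOn k).comp_continuous (f := fun p : U ×ˢ e'.target => ((p : EX × EM).1, v))
        (by fun_prop) fun p => ⟨p.2.1, mem_univ _⟩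
    have hJ := (continuous_chartJet (F := V) ⟨e', he'⟩ j).comp hD
    have hp : Continuous fun p : U ×ˢ e'.target =>
        ((⟨(p : EX × EM).2, p.2.2⟩, w) : e'.target × (Fin j → EM)) := by fun_prop
    have : LocallyCompactSpace e'.target := e'.open_target.locallyCompactSpace
    exact ℓ.continuous.comp (hJ.eval hp)
  · rintro _ ⟨k, v, j, w, rfl⟩ (i | i)
    · refine ⟨_, ⟨k + 1, Fin.cons (Module.finBasis ℝ EX i) v, j, w, rfl⟩, ?_⟩
      rintro ⟨x, y⟩ ⟨hx, hy⟩
      have h1 := hΛ.tendsto k x hx (Fin.cons (Module.finBasis ℝ EX i) v)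
      rw [Fin.cons_zero, Fin.tail_cons] at h1
      have h2 := (((continuous_eval_const (F := C(e'.target × (Fin j → EM), V))
        (⟨y, hy⟩, w)).comp (continuous_chartJet (F := V) ⟨e', he'⟩ j)).tendsto _).comp h1
      have h3 := (ℓ.continuous.tendsto _).comp h2
      rw [HasLineDerivAt, hasDerivAt_iff_tendsto_slope_zero]
      refine h3.congr fun t => ?_
      simp only [Function.comp, map_smul, map_sub, ContinuousMap.coe_smul, ContinuousMap.coe_sub,
        Pi.smul_apply, Pi.sub_apply]
      have hb : b (Sum.inl i) = (Module.finBasis ℝ EX i, 0) := by simp [b]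
      rw [hb]
      simp only [zero_add, zero_smul, add_zero, Prod.smul_mk, Prod.mk_add_mk, smul_zero]
      rfl
    · refine ⟨_, ⟨k, v, j + 1, Fin.cons (Module.finBasis ℝ EM i) w, rfl⟩, ?_⟩
      rintro ⟨x, y⟩ ⟨hx, hy⟩
      have h1 := ((iterDirDeriv Λ k x v).2 e' he').tendsto j y hy
        (Fin.cons (Module.finBasis ℝ EM i) w)
      rw [Fin.cons_zero, Fin.tail_cons] at h1
      have h3 := (ℓ.continuous.tendsto _).comp h1
      rw [HasLineDerivAt, hasDerivAt_iff_tendsto_slope_zero]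
      refine h3.congr fun t => ?_
      have hb : b (Sum.inr i) = (0, Module.finBasis ℝ EM i) := by simp [b]
      rw [hb]
      simp only [Function.comp, map_smul, map_sub, zero_add, zero_smul, add_zero, Prod.smul_mk,
        Prod.mk_add_mk, smul_zero]
      rfl

theorem contMDiff_uncurry {Λ : X → SmoothFun EM M V} (hΛ : IsSmoothMap EX Λ) (ℓ : V →L[ℝ] ℝ) :
    ContMDiff (𝓘(ℝ, EX).prod 𝓘(ℝ, EM)) 𝓘(ℝ, ℝ) ∞ fun p : X × M => ℓ ((Λ p.1).1 p.2) :=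
  contMDiff_prod_of_charts fun e he _ he' =>
    contDiffOn_uncurry e.open_target (hΛ e he) ℓ he'

theorem isSmoothOn_const {E F : Type*} [AddCommGroup E] [Module ℝ E] [TopologicalSpace E]
    [ContinuousAdd E] [ContinuousSMul ℝ E] [AddCommGroup F] [Module ℝ F] [TopologicalSpace F]
    [T2Space F] {U : Set E} (hU : IsOpen U) (c : F) : IsSmoothOn (fun _ : E => c) U := by
  refine isSmoothOn_of hU (fun k _ _ => if k = 0 then c else 0) (fun _ _ _ => rfl)
    (fun k x _ v => ?_) (fun k => continuousOn_const)
  simp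

theorem SmoothFun.contMDiff (f : SmoothFun EM M V) (ℓ : V →L[ℝ] ℝ) :
    ContMDiff 𝓘(ℝ, EM) 𝓘(ℝ, ℝ) ∞ fun m => ℓ (f.1 m) := by
  -- The constant family with value `f`, restricted to the diagonal of `M × M`.
  have h := contMDiff_uncurry (EX := EM) (X := M) (Λ := fun _ => f)
    (fun e _ => isSmoothOn_const e.open_target f) ℓ
  exact h.comp (contMDiff_id.prodMk contMDiff_id)

end Uncurry

/-! ### From weakly smooth functions on a product to smooth families in `C^∞(M, V)`. -/

section Curry

/-- Induction on `j`: each step interchanges two derivatives of the scalar function `G`, by symmetry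
of the second derivative. -/
theorem fderiv_iteratedFDeriv_apply {N : Type*} [NormedAddCommGroup N] [NormedSpace ℝ N]
    {g : N → ℝ} {O : Set N} (hO : IsOpen O) (hg : ContDiffOn ℝ ∞ g O) (a : N) (j : ℕ) :
    ∀ p ∈ O, ∀ w : Fin j → N, fderiv ℝ (fun p => iteratedFDeriv ℝ j g p w) p a =
      iteratedFDeriv ℝ j (fun q => fderiv ℝ g q a) p w := by
  induction j with
  | zero => intro p _ w; simp
  | succ j ih =>
    intro p hp w
    let G : N → ℝ := fun q => iteratedFDeriv ℝ j g q (Fin.tail w)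
    have hG : ContDiffOn ℝ ∞ G O := by
      have h := contDiffOn_iteratedFDeriv_apply hO hg j
      exact h.comp (contDiff_id.prodMk contDiff_const).contDiffOn fun q hq => ⟨hq, mem_univ _⟩
    have hga : ContDiffOn ℝ ∞ (fun q => fderiv ℝ g q a) O :=
      (hg.fderiv_of_isOpen hO (by exact_mod_cast le_top)).clm_apply contDiffOn_const
    have hs : ∀ {f : N → ℝ}, ContDiffOn ℝ ∞ f O → ∀ q ∈ O, iteratedFDeriv ℝ (j + 1) f q w
        = fderiv ℝ (fun q => iteratedFDeriv ℝ j f q (Fin.tail w)) q (w 0) := fun {f} hf q hq => by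
      rw [iteratedFDeriv_succ_apply_left]
      have hd : DifferentiableAt ℝ (iteratedFDeriv ℝ j f) q :=
        ((hf.contDiffAt (hO.mem_nhds hq)).differentiableAt_iteratedFDeriv
          (by exact_mod_cast ENat.natCast_lt_top j))
      rw [fderiv_continuousMultilinear_apply_const_apply hd]
    have h1 : fderiv ℝ (fun p => iteratedFDeriv ℝ (j + 1) g p w) p
        = fderiv ℝ (fun q => fderiv ℝ G q (w 0)) p :=
      Filter.EventuallyEq.fderiv_eq (by
        filter_upwards [hO.mem_nhds hp] with q hq using hs hg q hq)
    have h2 : fderiv ℝ (fun q => iteratedFDeriv ℝ j (fun q => fderiv ℝ g q a) q (Fin.tail w)) p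
        = fderiv ℝ (fun q => fderiv ℝ G q a) p :=
      Filter.EventuallyEq.fderiv_eq (by
        filter_upwards [hO.mem_nhds hp] with q hq using (ih q hq _).symm)
    rw [hs hga p hp, h1, h2]
    have hG2 : DifferentiableAt ℝ (fderiv ℝ G) p :=
      ((hG.fderiv_of_isOpen hO (m := ∞) (by exact_mod_cast le_top)).contDiffAt
        (hO.mem_nhds hp)).differentiableAt (by simp)
    rw [fderiv_clm_apply hG2 (differentiableAt_const _),
      fderiv_clm_apply hG2 (differentiableAt_const _)]
    have hG' : ContDiffOn ℝ 2 G O := contDiffOn_infty.1 hG 2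
    have hsymm : IsSymmSndFDerivAt ℝ G p :=
      (hG'.contDiffAt (hO.mem_nhds hp)).isSymmSndFDerivAt (by simp)
    simpa using hsymm.eq a (w 0)

variable {F : Type*} [AddCommGroup F] [Module ℝ F] [TopologicalSpace F] [T2Space F]
  {A B : Type*} [NormedAddCommGroup A] [NormedSpace ℝ A] [NormedAddCommGroup B] [NormedSpace ℝ B]

theorem iterDirDeriv_slice_fst {K : A × B → F} {U : Set A} {W : Set B} (hU : IsOpen U)
    (hK : IsSmoothOn K (U ×ˢ W)) {y : B} (hy : y ∈ W) (k : ℕ) {x : A} (hx : x ∈ U)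
    (v : Fin k → A) : iterDirDeriv (fun x => K (x, y)) k x v =
      iterDirDeriv K k (x, y) fun i => (v i, 0) := by
  refine iterDirDeriv_eq_of hU (fun k x v => iterDirDeriv K k (x, y) fun i => (v i, 0))
    (fun _ _ _ => rfl) (fun k x hx v => ?_) k x hx v
  have := hK.tendsto k (x, y) ⟨hx, hy⟩ (fun i => (v i, 0))
  simpa [Fin.tail_def] using this

theorem iterDirDeriv_slice_snd {K : A × B → F} {U : Set A} {W : Set B} (hW : IsOpen W)
    (hK : IsSmoothOn K (U ×ˢ W)) {x : A} (hx : x ∈ U) (k : ℕ) {y : B} (hy : y ∈ W)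
    (w : Fin k → B) : iterDirDeriv (fun y => K (x, y)) k y w =
      iterDirDeriv K k (x, y) fun i => (0, w i) := by
  refine iterDirDeriv_eq_of hW (fun k y w => iterDirDeriv K k (x, y) fun i => (0, w i))
    (fun _ _ _ => rfl) (fun k y hy w => ?_) k y hy w
  have := hK.tendsto k (x, y) ⟨hx, hy⟩ (fun i => (0, w i))
  simpa [Fin.tail_def] using this


variable {V : Type*} [AddCommGroup V] [Module ℝ V] [UniformSpace V] [IsUniformAddGroup V]
  [ContinuousSMul ℝ V] [LocallyConvexSpace ℝ V] [QuasiCompleteSpace ℝ V] [T2Space V]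
  [FiniteDimensional ℝ A] [FiniteDimensional ℝ B]

/-- Base point and directions are all treated as variables, so that the result can be differentiated
again in `y` and is jointly continuous. -/
theorem WeaklySmoothOn.iterDirDeriv_fst {H : A × B → V} {U : Set A} {W : Set B} (hU : IsOpen U)
    (hW : IsOpen W) (hH : WeaklySmoothOn H (U ×ˢ W)) (k : ℕ) :
    WeaklySmoothOn (fun p : (A × (Fin k → A)) × B =>
      iterDirDeriv (fun x => H (x, p.2)) k p.1.1 p.1.2) ((U ×ˢ univ) ×ˢ W) := fun ℓ => by
  have h1 := contDiffOn_iteratedFDeriv_apply (hU.prod hW) (hH ℓ) k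
  have h2 : ContDiff ℝ ∞ fun p : (A × (Fin k → A)) × B =>
      (((p.1.1, p.2), fun i => (p.1.2 i, 0)) : (A × B) × (Fin k → A × B)) := by fun_prop
  refine (h1.comp h2.contDiffOn fun p hp => ⟨⟨hp.1.1, hp.2⟩, mem_univ _⟩).congr fun p hp => ?_
  beta_reduce
  rw [iterDirDeriv_slice_fst hU (hH.isSmoothOn (hU.prod hW)) hp.2 k hp.1.1]
  exact (hH.apply_iterDirDeriv_and_tendsto (hU.prod hW) k).1 _ ⟨hp.1.1, hp.2⟩ _ ℓ

theorem WeaklySmoothOn.isSmoothOn_iterDirDeriv_fst {H : A × B → V} {U : Set A} {W : Set B}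
    (hU : IsOpen U) (hW : IsOpen W) (hH : WeaklySmoothOn H (U ×ˢ W)) (k : ℕ) {x : A} (hx : x ∈ U)
    (v : Fin k → A) : IsSmoothOn (fun y => iterDirDeriv (fun x => H (x, y)) k x v) W := by
  refine WeaklySmoothOn.isSmoothOn hW fun ℓ => ?_
  have h2 : ContDiff ℝ ∞ fun y : B => (((x, v), y) : (A × (Fin k → A)) × B) := by fun_prop
  exact (hH.iterDirDeriv_fst hU hW k ℓ).comp h2.contDiffOn fun y hy => ⟨⟨hx, mem_univ _⟩, hy⟩

theorem WeaklySmoothOn.continuousOn_mixed {H : A × B → V} {U : Set A} {W : Set B}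
    (hU : IsOpen U) (hW : IsOpen W) (hH : WeaklySmoothOn H (U ×ˢ W)) (k j : ℕ) :
    ContinuousOn (fun p : (A × (Fin k → A)) × B × (Fin j → B) =>
      iterDirDeriv (fun y => iterDirDeriv (fun x => H (x, y)) k p.1.1 p.1.2) j p.2.1 p.2.2)
      ((U ×ˢ univ) ×ˢ W ×ˢ univ) := by
  have h1 := (hH.iterDirDeriv_fst hU hW k).isSmoothOn ((hU.prod isOpen_univ).prod hW)
  have h2 : Continuous fun p : (A × (Fin k → A)) × B × (Fin j → B) =>
      (((p.1, p.2.1), fun i => (0, p.2.2 i)) :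
        ((A × (Fin k → A)) × B) × (Fin j → (A × (Fin k → A)) × B)) := by fun_prop
  refine ((h1.continuousOn j).comp h2.continuousOn fun p hp =>
    ⟨⟨hp.1, hp.2.1⟩, mem_univ _⟩).congr fun p hp => ?_
  exact iterDirDeriv_slice_snd hW h1 hp.1 j hp.2.1 p.2.2

theorem WeaklySmoothOn.apply_mixed {H : A × B → V} {U : Set A} {W : Set B}
    (hU : IsOpen U) (hW : IsOpen W) (hH : WeaklySmoothOn H (U ×ˢ W)) (k j : ℕ) (ℓ : V →L[ℝ] ℝ)
    {x : A} (hx : x ∈ U) {y : B} (hy : y ∈ W) (v : Fin k → A) (w : Fin j → B) :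
    ℓ (iterDirDeriv (fun y => iterDirDeriv (fun x => H (x, y)) k x v) j y w) =
      iteratedFDeriv ℝ j (fun q => iteratedFDeriv ℝ k (fun q => ℓ (H q)) q fun i => (v i, 0))
        (x, y) fun i => (0, w i) := by
  have h2 : ContDiff ℝ ∞ fun q : A × B => (((q.1, v), q.2) : (A × (Fin k → A)) × B) := by fun_prop
  have h3 : WeaklySmoothOn (fun q : A × B => iterDirDeriv (fun x => H (x, q.2)) k q.1 v)
      (U ×ˢ W) := fun ℓ => (hH.iterDirDeriv_fst hU hW k ℓ).comp h2.contDiffOn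
        fun q hq => ⟨⟨hq.1, mem_univ _⟩, hq.2⟩
  rw [iterDirDeriv_slice_snd hW (h3.isSmoothOn (hU.prod hW)) hx j hy w,
    (h3.apply_iterDirDeriv_and_tendsto (hU.prod hW) j).1 _ ⟨hx, hy⟩ _ ℓ]
  congr 1
  refine Filter.EventuallyEq.eq_of_nhds (Filter.EventuallyEq.iteratedFDeriv ℝ ?_ j)
  filter_upwards [(hU.prod hW).mem_nhds (show (x, y) ∈ U ×ˢ W from ⟨hx, hy⟩)] with q hq
  rw [iterDirDeriv_slice_fst hU (hH.isSmoothOn (hU.prod hW)) hq.2 k hq.1]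
  exact (hH.apply_iterDirDeriv_and_tendsto (hU.prod hW) k).1 _ hq _ ℓ

/-- The derivative in `t` acts outside the `y`-derivatives, whereas the formula has all
`x`-derivatives inside. After applying `ℓ` everything is finite-dimensional calculus, and
`fderiv_iteratedFDeriv_apply` moves it inside. -/
theorem WeaklySmoothOn.hasDerivAt_mixed {H : A × B → V} {U : Set A} {W : Set B}
    (hU : IsOpen U) (hW : IsOpen W) (hH : WeaklySmoothOn H (U ×ˢ W)) (k j : ℕ) (ℓ : V →L[ℝ] ℝ)
    {x : A} {y : B} (hy : y ∈ W) (v : Fin (k + 1) → A) (w : Fin j → B) {t : ℝ}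
    (ht : x + t • v 0 ∈ U) :
    HasDerivAt (fun t : ℝ => ℓ (iterDirDeriv (fun y =>
      iterDirDeriv (fun x => H (x, y)) k (x + t • v 0) (Fin.tail v)) j y w))
      (ℓ (iterDirDeriv (fun y =>
        iterDirDeriv (fun x => H (x, y)) (k + 1) (x + t • v 0) v) j y w)) t := by
  have hO := hU.prod hW
  let g : A × B → ℝ := fun q =>
    iteratedFDeriv ℝ k (fun q => ℓ (H q)) q fun i => (Fin.tail v i, 0)
  have hg : ContDiffOn ℝ ∞ g (U ×ˢ W) :=
    (contDiffOn_iteratedFDeriv_apply hO (hH ℓ) k).comp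
      (contDiff_id.prodMk contDiff_const).contDiffOn fun q hq => ⟨hq, mem_univ _⟩
  have hmem : (x + t • v 0, y) ∈ U ×ˢ W := ⟨ht, hy⟩
  have hR : ContDiffOn ℝ ∞ (fun q => iteratedFDeriv ℝ j g q fun i => (0, w i)) (U ×ˢ W) :=
    (contDiffOn_iteratedFDeriv_apply hO hg j).comp
      (contDiff_id.prodMk contDiff_const).contDiffOn fun q hq => ⟨hq, mem_univ _⟩
  have hd : HasDerivAt (fun t : ℝ => ((x + t • v 0, y) : A × B)) (v 0, 0) t := by
    have h1 : HasDerivAt (fun t : ℝ => x + t • v 0) (v 0) t := by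
      simpa using ((hasDerivAt_id t).smul_const (v 0)).const_add x
    exact h1.prodMk (hasDerivAt_const t y)
  have hcomp := ((hR.contDiffAt (hO.mem_nhds hmem)).differentiableAt
    (by simp)).hasFDerivAt.comp_hasDerivAt t hd
  rw [fderiv_iteratedFDeriv_apply hO hg _ j _ hmem] at hcomp
  rw [hH.apply_mixed hU hW (k + 1) j ℓ ht hy]
  have heq : iteratedFDeriv ℝ j (fun q => fderiv ℝ g q (v 0, 0)) (x + t • v 0, y)
      = iteratedFDeriv ℝ j (fun q => iteratedFDeriv ℝ (k + 1) (fun q => ℓ (H q)) q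
        fun i => (v i, 0)) (x + t • v 0, y) := by
    refine Filter.EventuallyEq.eq_of_nhds (Filter.EventuallyEq.iteratedFDeriv ℝ ?_ j)
    filter_upwards [hO.mem_nhds hmem] with q hq
    have hdq : DifferentiableAt ℝ (iteratedFDeriv ℝ k fun q => ℓ (H q)) q :=
      (((hH ℓ).contDiffAt (hO.mem_nhds hq)).differentiableAt_iteratedFDeriv
        (by exact_mod_cast ENat.natCast_lt_top k))
    rw [iteratedFDeriv_succ_apply_left]
    exact fderiv_continuousMultilinear_apply_const_apply hdq _ _
  rw [heq] at hcomp
  refine hcomp.congr_of_eventuallyEq ?_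
  have hc : Continuous fun t : ℝ => x + t • v 0 := by fun_prop
  filter_upwards [hc.continuousAt.eventually_mem (hU.mem_nhds ht)] with s hs
  exact hH.apply_mixed hU hW k j ℓ hs hy (Fin.tail v) w

-- The limit is joint in `t` and in the point `z` of the jet space of `B`; this is what makes the
-- slopes converge in the `C^∞`-topology and not only pointwise.
attribute [local irreducible] iterDirDeriv in
theorem WeaklySmoothOn.tendsto_slope_mixed {H : A × B → V} {U : Set A} {W : Set B}
    (hU : IsOpen U) (hW : IsOpen W) (hH : WeaklySmoothOn H (U ×ˢ W)) (k j : ℕ)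
    {x : A} (hx : x ∈ U) (v : Fin (k + 1) → A) {z : B × (Fin j → B)} (hz : z.1 ∈ W) :
    Tendsto (fun p : ℝ × (B × (Fin j → B)) => p.1⁻¹ •
        (iterDirDeriv (fun y => iterDirDeriv (fun x => H (x, y)) k (x + p.1 • v 0) (Fin.tail v))
          j p.2.1 p.2.2 -
        iterDirDeriv (fun y => iterDirDeriv (fun x => H (x, y)) k x (Fin.tail v)) j p.2.1 p.2.2))
      (𝓝[≠] (0 : ℝ) ×ˢ 𝓝 z)
      (𝓝 (iterDirDeriv (fun y => iterDirDeriv (fun x => H (x, y)) (k + 1) x v) j z.1 z.2)) := by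
  have hx0 : x + (0 : ℝ) • v 0 ∈ U := by simpa using hx
  have hmix := hH.continuousOn_mixed hU hW (k + 1) j
  have hline : Continuous fun t : ℝ => x + t • v 0 := by fun_prop
  have hO : IsOpen ((U ×ˢ (univ : Set (Fin (k + 1) → A))) ×ˢ W ×ˢ (univ : Set (Fin j → B))) :=
    (hU.prod isOpen_univ).prod (hW.prod isOpen_univ)
  have hc : Continuous fun p : ℝ × (B × (Fin j → B)) =>
      (((x + p.1 • v 0, v), p.2) : (A × (Fin (k + 1) → A)) × B × (Fin j → B)) := by fun_prop
  have hm : (((x + (0 : ℝ) • v 0, v), z) : (A × (Fin (k + 1) → A)) × B × (Fin j → B)) ∈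
      (U ×ˢ (univ : Set (Fin (k + 1) → A))) ×ˢ W ×ˢ (univ : Set (Fin j → B)) :=
    ⟨⟨hx0, mem_univ _⟩, hz, mem_univ _⟩
  have hψ : ContinuousAt (fun p : ℝ × (B × (Fin j → B)) => iterDirDeriv (fun y => iterDirDeriv
      (fun x => H (x, y)) (k + 1) (x + p.1 • v 0) v) j p.2.1 p.2.2) (0, z) :=
    (hmix.continuousAt (hO.mem_nhds hm)).comp_of_eq hc.continuousAt rfl
  have hev : ∀ᶠ p : ℝ × (B × (Fin j → B)) in 𝓝 ((0 : ℝ), z), x + p.1 • v 0 ∈ U ∧ p.2.1 ∈ W :=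
    Eventually.and
      ((hline.comp continuous_fst).continuousAt.eventually_mem (hU.mem_nhds hx0))
      ((continuous_fst.comp continuous_snd).continuousAt.eventually_mem (hW.mem_nhds hz))
  have hlim := tendsto_slope_of_forall_dual (Y := B × (Fin j → B)) (y₀ := z)
    (φ := fun t z => iterDirDeriv (fun y => iterDirDeriv
      (fun x => H (x, y)) k (x + t • v 0) (Fin.tail v)) j z.1 z.2)
    (ψ := fun t z => iterDirDeriv (fun y => iterDirDeriv
      (fun x => H (x, y)) (k + 1) (x + t • v 0) v) j z.1 z.2)
    hψ (hev.mono fun p hp ℓ => hH.hasDerivAt_mixed hU hW k j ℓ hp.2 v p.2.2 hp.1)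
  simpa only [zero_smul, add_zero] using hlim

theorem WeaklySmoothOn.continuousAt_mixed {H : A × B → V} {U : Set A} {W : Set B}
    (hU : IsOpen U) (hW : IsOpen W) (hH : WeaklySmoothOn H (U ×ˢ W)) (k j : ℕ)
    {p : A × (Fin k → A)} (hp : p.1 ∈ U) {z : B × (Fin j → B)} (hz : z.1 ∈ W) :
    Tendsto (fun q : (A × (Fin k → A)) × B × (Fin j → B) => iterDirDeriv (fun y => iterDirDeriv
        (fun x => H (x, y)) k q.1.1 q.1.2) j q.2.1 q.2.2) (𝓝 p ×ˢ 𝓝 z)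
      (𝓝 (iterDirDeriv (fun y => iterDirDeriv (fun x => H (x, y)) k p.1 p.2) j z.1 z.2)) := by
  rw [← nhds_prod_eq]
  have hO : IsOpen ((U ×ˢ (univ : Set (Fin k → A))) ×ˢ W ×ˢ (univ : Set (Fin j → B))) :=
    (hU.prod isOpen_univ).prod (hW.prod isOpen_univ)
  exact (hH.continuousOn_mixed hU hW k j).continuousAt (x := (p, z))
    (hO.mem_nhds ⟨⟨hp, mem_univ _⟩, hz, mem_univ _⟩)

variable {EX : Type*} [NormedAddCommGroup EX] [NormedSpace ℝ EX] [FiniteDimensional ℝ EX]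
  {X : Type*} [TopologicalSpace X] [ChartedSpace EX X] [IsManifold 𝓘(ℝ, EX) ∞ X]
  {EM : Type*} [NormedAddCommGroup EM] [NormedSpace ℝ EM] [FiniteDimensional ℝ EM]
  {M : Type*} [TopologicalSpace M] [ChartedSpace EM M] [IsManifold 𝓘(ℝ, EM) ∞ M]

/-- The derivatives of `Λ` are the pointwise `x`-derivatives. They are smooth in the point of `M`,
and the mixed limits above are exactly convergence of all jets in the compact-open topology. -/
theorem isSmoothOn_of_weaklySmoothOn_uncurry {Λ : EX → SmoothFun EM M V} {U : Set EX}
    (hU : IsOpen U) (h : ∀ e' ∈ IsManifold.maximalAtlas 𝓘(ℝ, EM) ∞ M,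
      WeaklySmoothOn (fun p : EX × EM => (Λ p.1).1 (e'.symm p.2)) (U ×ˢ e'.target)) :
    IsSmoothOn Λ U := by
  classical
  have hsm : ∀ (k : ℕ) (x : EX), x ∈ U → ∀ v : Fin k → EX,
      IsSmoothMap EM fun m : M => iterDirDeriv (fun x => (Λ x).1 m) k x v :=
    fun k x hx v e' he' => (h e' he').isSmoothOn_iterDirDeriv_fst hU e'.open_target k hx v
  -- Off `U` the value `0` only makes `D` total; differentiation takes place inside the open set
  -- `U`.
  let D : (k : ℕ) → EX → (Fin k → EX) → SmoothFun EM M V := fun k x v =>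
    if hx : x ∈ U then SmoothFun.mk _ (hsm k x hx v) else 0
  have hD : ∀ (k : ℕ) (x : EX) (v : Fin k → EX) (e' : IsManifold.maximalAtlas 𝓘(ℝ, EM) ∞ M)
      (j : ℕ) (z : e'.1.target × (Fin j → EM)), x ∈ U → chartJet e' j (D k x v) z =
      iterDirDeriv (fun y => iterDirDeriv (fun x => (Λ x).1 (e'.1.symm y)) k x v) j z.1 z.2 :=
    fun k x v e' j z hx => by
      simp only [D, dif_pos hx]
      rfl
  refine isSmoothOn_of hU D (fun x hx v => ?_) (fun k x hx v => ?_) (fun k => ?_)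
  · simp only [D, dif_pos hx]
    rfl
  · rw [tendsto_smoothFun_iff]
    intro e' j
    refine tendsto_continuousMap_of_continuous_convergence fun z => ?_
    have hlim := ((h e'.1 e'.2).tendsto_slope_mixed hU e'.1.open_target k j hx v
      (z := ((z.1 : EM), z.2)) z.1.2).comp
      (tendsto_id.prodMap (((continuous_subtype_val.comp continuous_fst).prodMk
        continuous_snd).tendsto z))
    rw [hD _ _ _ _ _ _ hx]
    refine hlim.congr' ?_
    have hev : ∀ᶠ p : ℝ × e'.1.target × (Fin j → EM) in 𝓝[≠] (0 : ℝ) ×ˢ 𝓝 z,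
        x + p.1 • v 0 ∈ U :=
      (eventually_line_mem hU hx (v 0)).prod_inl _
    filter_upwards [hev] with p hp
    rw [map_smul, map_sub, ContinuousMap.smul_apply, ContinuousMap.sub_apply,
      hD _ _ _ _ _ _ hp, hD _ _ _ _ _ _ hx]
    rfl
  · intro p hp
    rw [ContinuousWithinAt, tendsto_smoothFun_iff]
    intro e' j
    refine tendsto_continuousMap_of_continuous_convergence fun z => ?_
    rw [hD _ _ _ _ _ _ hp.1]
    have hlim := ((h e'.1 e'.2).continuousAt_mixed hU e'.1.open_target k j hp.1
      (z := ((z.1 : EM), z.2)) z.1.2).comp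
      (tendsto_id.prodMap (((continuous_subtype_val.comp continuous_fst).prodMk
        continuous_snd).tendsto z))
    refine (hlim.mono_left (prod_mono (nhdsWithin_le_nhds (s := U ×ˢ univ)) le_rfl)).congr' ?_
    have hev : ∀ᶠ q : (EX × (Fin k → EX)) × e'.1.target × (Fin j → EM) in
        𝓝[U ×ˢ univ] p ×ˢ 𝓝 z, q.1.1 ∈ U :=
      Eventually.prod_inl (p := fun q : EX × (Fin k → EX) => q.1 ∈ U)
        (eventually_mem_nhdsWithin.mono fun q hq => hq.1) _
    filter_upwards [hev] with q hq
    exact (hD _ _ _ _ _ _ hq).symm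

theorem isSmoothMap_of_contMDiff_uncurry {Λ : X → SmoothFun EM M V}
    (h : ∀ ℓ : V →L[ℝ] ℝ, ContMDiff (𝓘(ℝ, EX).prod 𝓘(ℝ, EM)) 𝓘(ℝ, ℝ) ∞
      fun p : X × M => ℓ ((Λ p.1).1 p.2)) : IsSmoothMap EX Λ := fun e he =>
  isSmoothOn_of_weaklySmoothOn_uncurry e.open_target fun _ he' ℓ =>
    contDiffOn_charts_of_contMDiff (h ℓ) he he'

theorem isSmoothMap_of_contMDiff {f : M → V}
    (h : ∀ ℓ : V →L[ℝ] ℝ, ContMDiff 𝓘(ℝ, EM) 𝓘(ℝ, ℝ) ∞ fun m => ℓ (f m)) : IsSmoothMap EM f :=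
  fun _ he => WeaklySmoothOn.isSmoothOn (OpenPartialHomeomorph.open_target _) fun ℓ =>
    contMDiffOn_iff_contDiffOn.1 ((h ℓ).comp_contMDiffOn (contMDiffOn_symm_of_mem_maximalAtlas he))

end Curry

/-! ### Integration over the group -/

section Integral

open MeasureTheory

variable {V : Type*} [AddCommGroup V] [Module ℝ V] [UniformSpace V] [IsUniformAddGroup V]
  [ContinuousSMul ℝ V] [LocallyConvexSpace ℝ V] [QuasiCompleteSpace ℝ V]

/-- Continuous compactly supported functions with values in a quasi-complete space have a weak
integral. -/
theorem exists_weak_integral {G : Type*} [TopologicalSpace G] [MeasurableSpace G]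
    [T2Space G] [BorelSpace G] (μ : Measure G) [IsFiniteMeasureOnCompacts μ] {f : G → V} {K : Set G}
    (hf : Continuous f) (hK : IsCompact K) (hfK : ∀ x ∉ K, f x = 0) :
    ∃ I : V, ∀ ℓ : V →L[ℝ] ℝ, ℓ I = ∫ x, ℓ (f x) ∂μ := by
  have hint : ∀ ℓ : V →L[ℝ] ℝ, ∫ x, ℓ (f x) ∂μ = ∫ x in K, ℓ (f x) ∂μ := fun ℓ =>
    (setIntegral_eq_integral_of_forall_compl_eq_zero fun x hx => by rw [hfK x hx, map_zero]).symm
  by_cases hm : μ K = 0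
  · refine ⟨0, fun ℓ => ?_⟩
    rw [map_zero, hint, Measure.restrict_eq_zero.2 hm, integral_zero_measure]
  have hKf : μ K ≠ ⊤ := hK.measure_ne_top
  have hm' : μ.real K ≠ 0 := (ENNReal.toReal_ne_zero).2 ⟨hm, hKf⟩
  -- Quasi-completeness makes this hull compact. The mean value of `f` over `K` is found in it by
  -- the finite intersection property, with one closed condition for each functional.
  have hC : IsCompact (closedAbsConvexHull ℝ (f '' K)) :=
    isCompact_closedAbsConvexHull_of_totallyBounded (hK.image hf).totallyBounded
  have hne : (closedAbsConvexHull ℝ (f '' K) ∩ ⋂ ℓ : V →L[ℝ] ℝ,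
      {c | ℓ c = (μ.real K)⁻¹ * ∫ x, ℓ (f x) ∂μ}).Nonempty := by
    refine hC.inter_iInter_nonempty _
      (fun ℓ => isClosed_eq ℓ.continuous continuous_const) fun u => ?_
    -- For finitely many functionals the average of `L ∘ f` is an ordinary integral in `u → ℝ`, and
    -- it lies in the compact convex image of the hull.
    let L : V →L[ℝ] (u → ℝ) := ContinuousLinearMap.pi fun i => i.1
    have hcont : Continuous fun x => L (f x) := L.continuous.comp hf
    have hi : IntegrableOn (fun x => L (f x)) K μ := hcont.continuousOn.integrableOn_compact hK
    have hmem : (⨍ x in K, L (f x) ∂μ) ∈ L '' closedAbsConvexHull ℝ (f '' K) := by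
      refine Convex.set_average_mem ?_ (hC.image L.continuous).isClosed hm hKf ?_ hi
      · exact (absConvex_convexClosedHull (𝕜 := ℝ) (s := f '' K)).2.linear_image L.toLinearMap
      · filter_upwards [ae_restrict_mem hK.measurableSet] with x hx
        exact mem_image_of_mem _ (subset_closedAbsConvexHull (mem_image_of_mem f hx))
    obtain ⟨c, hc, hcL⟩ := hmem
    refine ⟨c, hc, mem_iInter₂.2 fun ℓ hℓ => ?_⟩
    have h1 := congrArg (ContinuousLinearMap.proj (R := ℝ) (φ := fun _ : u => ℝ) ⟨ℓ, hℓ⟩) hcL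
    rw [setAverage_eq, map_smul, ← ContinuousLinearMap.integral_comp_comm _ hi] at h1
    change ℓ c = _
    rw [hint]
    exact h1
  obtain ⟨c, -, hc⟩ := hne
  refine ⟨μ.real K • c, fun ℓ => ?_⟩
  have h1 : ℓ c = (μ.real K)⁻¹ * ∫ x, ℓ (f x) ∂μ := mem_iInter.1 hc ℓ
  rw [map_smul, h1, smul_eq_mul, mul_inv_cancel_left₀ hm']

variable {E : Type*} [NormedAddCommGroup E] [NormedSpace ℝ E]
  {EG : Type*} [NormedAddCommGroup EG] [NormedSpace ℝ EG]
  {G : Type*} [TopologicalSpace G] [ChartedSpace EG G]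

theorem contMDiffOn_fderiv_fst [IsManifold 𝓘(ℝ, EG) ∞ G] {F : E × G → ℝ} {U : Set E}
    (hU : IsOpen U)
    (hF : ContMDiffOn (𝓘(ℝ, E).prod 𝓘(ℝ, EG)) 𝓘(ℝ, ℝ) ∞ F (U ×ˢ univ)) :
    ContMDiffOn (𝓘(ℝ, E).prod 𝓘(ℝ, EG)) 𝓘(ℝ, E →L[ℝ] ℝ) ∞
      (fun p : E × G => fderiv ℝ (fun x => F (x, p.2)) p.1) (U ×ˢ univ) := by
  intro p hp
  refine ContMDiffAt.contMDiffWithinAt ?_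
  have hO : IsOpen (U ×ˢ (univ : Set G)) := hU.prod isOpen_univ
  have h1 : ContMDiffAt ((𝓘(ℝ, E).prod 𝓘(ℝ, EG)).prod 𝓘(ℝ, E)) 𝓘(ℝ, ℝ) ∞
      (Function.uncurry fun (q : E × G) (x : E) => F (x, q.2)) (p, p.1) := by
    have hF' := hF.contMDiffAt (hO.mem_nhds hp)
    exact ContMDiffAt.comp (p, p.1) (f := fun z : (E × G) × E => (z.2, z.1.2)) hF'
      (contMDiffAt_snd.prodMk (contMDiffAt_snd.comp _ contMDiffAt_fst))
  have h2 := ContMDiffAt.mfderiv (fun (q : E × G) (x : E) => F (x, q.2)) Prod.fst h1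
    contMDiffAt_fst (m := ∞) (by simp)
  simpa only [inTangentCoordinates_model_space, mfderiv_eq_fderiv] using h2

variable [MeasurableSpace G] [BorelSpace G] (μ : Measure G) [IsFiniteMeasureOnCompacts μ]
  [SecondCountableTopology G] [T2Space G]

/-- Differentiation under the integral, dominated by a constant on `K`. The induction runs over all
`F` at once because `p ↦ F' p v` satisfies the same hypotheses. -/
theorem contDiffOn_parametric_integral [IsManifold 𝓘(ℝ, EG) ∞ G] [FiniteDimensional ℝ E]
    {U : Set E} (hU : IsOpen U) {K : Set G} (hK : IsCompact K) (n : ℕ) :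
    ∀ F : E × G → ℝ, ContMDiffOn (𝓘(ℝ, E).prod 𝓘(ℝ, EG)) 𝓘(ℝ, ℝ) ∞ F (U ×ˢ univ) →
      (∀ x ∈ U, ∀ γ ∉ K, F (x, γ) = 0) → ContDiffOn ℝ n (fun x => ∫ γ, F (x, γ) ∂μ) U := by
  have : ProperSpace E := FiniteDimensional.proper ℝ E
  induction n with
  | zero =>
    intro F hF hFK
    refine contDiffOn_zero.2 ?_
    exact continuousOn_integral_of_compact_support hK (f := fun x γ => F (x, γ))
      hF.continuousOn fun x γ hx hγ => hFK x hx γ hγ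
  | succ n ih =>
    intro F hF hFK
    let F' : E × G → E →L[ℝ] ℝ := fun p => fderiv ℝ (fun x => F (x, p.2)) p.1
    have hF' := contMDiffOn_fderiv_fst hU hF
    have hF'K : ∀ x ∈ U, ∀ γ ∉ K, F' (x, γ) = 0 := fun x hx γ hγ => by
      have : (fun x => F (x, γ)) =ᶠ[𝓝 x] fun _ => 0 := by
        filter_upwards [hU.mem_nhds hx] with y hy using hFK y hy γ hγ
      change fderiv ℝ (fun x => F (x, γ)) x = 0
      rw [this.fderiv_eq, fderiv_fun_const]
      rfl
    have hcF : ∀ x ∈ U, Continuous fun γ => F (x, γ) := fun x hx =>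
      hF.continuousOn.comp_continuous (by fun_prop) fun γ => ⟨hx, mem_univ _⟩
    have hcF' : ∀ x ∈ U, Continuous fun γ => F' (x, γ) := fun x hx =>
      hF'.continuousOn.comp_continuous (f := fun γ => (x, γ)) (by fun_prop)
        fun γ => ⟨hx, mem_univ _⟩
    have hiF : ∀ x ∈ U, Integrable (fun γ => F (x, γ)) μ := fun x hx =>
      (hcF x hx).integrable_of_hasCompactSupport (HasCompactSupport.intro hK (hFK x hx))
    have hiF' : ∀ x ∈ U, Integrable (fun γ => F' (x, γ)) μ := fun x hx =>
      (hcF' x hx).integrable_of_hasCompactSupport (HasCompactSupport.intro hK (hF'K x hx))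
    have hder : ∀ x ∈ U, HasFDerivAt (fun x => ∫ γ, F (x, γ) ∂μ) (∫ γ, F' (x, γ) ∂μ) x := by
      intro x hx
      obtain ⟨r, hr, hrU⟩ := Metric.nhds_basis_closedBall.mem_iff.1 (hU.mem_nhds hx)
      obtain ⟨C, hC⟩ := ((isCompact_closedBall x r).prod hK).exists_bound_of_continuousOn
        (hF'.continuousOn.mono (prod_mono hrU (subset_univ K)))
      refine hasFDerivAt_integral_of_dominated_of_fderiv_le (F := fun x γ => F (x, γ))
        (F' := fun x γ => F' (x, γ)) (bound := K.indicator fun _ => C)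
        (Metric.ball_mem_nhds x hr) ?_ (hiF x hx)
        (hcF' x hx).aestronglyMeasurable ?_ ?_ ?_
      · filter_upwards [hU.mem_nhds hx] with y hy using (hcF y hy).aestronglyMeasurable
      · refine Eventually.of_forall fun γ y hy => ?_
        by_cases hγ : γ ∈ K
        · rw [indicator_of_mem hγ]
          exact hC (y, γ) ⟨Metric.ball_subset_closedBall hy, hγ⟩
        · rw [indicator_of_notMem hγ, hF'K y (hrU (Metric.ball_subset_closedBall hy)) γ hγ,
            norm_zero]
      · exact (integrable_indicator_iff hK.measurableSet).2
          (integrableOn_const hK.measure_ne_top)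
      · refine Eventually.of_forall fun γ y hy => ?_
        have hyU := hrU (Metric.ball_subset_closedBall hy)
        have h1 : ContMDiffAt 𝓘(ℝ, E) 𝓘(ℝ, ℝ) ∞ (fun x => F (x, γ)) y :=
          (hF.contMDiffAt ((hU.prod isOpen_univ).mem_nhds ⟨hyU, mem_univ γ⟩)).comp y
            (f := fun x => (x, γ)) (contMDiffAt_id.prodMk contMDiffAt_const)
        exact (h1.contDiffAt.differentiableAt (by simp)).hasFDerivAt
    rw [Nat.cast_add, Nat.cast_one,
      contDiffOn_succ_iff_hasFDerivWithinAt_of_uniqueDiffOn hU.uniqueDiffOn]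
    refine ⟨by simp, fun x => ∫ γ, F' (x, γ) ∂μ, ?_, fun x hx => (hder x hx).hasFDerivWithinAt⟩
    rw [contDiffOn_clm_apply]
    intro v
    have h2 := ih (fun p => F' p v)
      (hF'.clm_apply contMDiffOn_const) fun x hx γ hγ => by rw [hF'K x hx γ hγ]; rfl
    refine h2.congr fun x hx => ?_
    exact ContinuousLinearMap.integral_apply (hiF' x hx) v

theorem contMDiff_parametric_integral [IsManifold 𝓘(ℝ, EG) ∞ G] [FiniteDimensional ℝ E]
    {H : Type*} [TopologicalSpace H] {I : ModelWithCorners ℝ E H} [I.Boundaryless]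
    {Y : Type*} [TopologicalSpace Y] [ChartedSpace H Y] [IsManifold I ∞ Y] {F : Y × G → ℝ}
    (hF : ContMDiff (I.prod 𝓘(ℝ, EG)) 𝓘(ℝ, ℝ) ∞ F)
    (hK : ∀ y₀, ∃ K : Set G, IsCompact K ∧ ∀ᶠ y in 𝓝 y₀, ∀ γ ∉ K, F (y, γ) = 0) :
    ContMDiff I 𝓘(ℝ, ℝ) ∞ fun y => ∫ γ, F (y, γ) ∂μ := by
  intro y₀
  obtain ⟨K, hKc, hK⟩ := hK y₀
  obtain ⟨O, hO, hOo, hy₀⟩ := eventually_nhds_iff.1 hK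
  set e := extChartAt I y₀ with he
  let U : Set E := e.target ∩ e.symm ⁻¹' O
  have hU : IsOpen U :=
    (continuousOn_extChartAt_symm y₀).isOpen_inter_preimage (isOpen_extChartAt_target y₀) hOo
  have h1 : ContMDiffOn (𝓘(ℝ, E).prod 𝓘(ℝ, EG)) 𝓘(ℝ, ℝ) ∞
      (fun p : E × G => F (e.symm p.1, p.2)) (U ×ˢ univ) := by
    have h2 : ContMDiffOn (𝓘(ℝ, E).prod 𝓘(ℝ, EG)) I ∞ (fun p : E × G => e.symm p.1)
        (U ×ˢ univ) :=
      (contMDiffOn_extChartAt_symm y₀).comp contMDiff_fst.contMDiffOn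
        fun p hp => hp.1.1
    exact hF.comp_contMDiffOn (h2.prodMk contMDiff_snd.contMDiffOn)
  have h3 : ContDiffOn ℝ ∞ (fun x => ∫ γ, F (e.symm x, γ) ∂μ) U := contDiffOn_infty.2 fun n =>
    contDiffOn_parametric_integral μ hU hKc n _ h1 fun x hx γ hγ => hO _ hx.2 γ hγ
  have hyU : e y₀ ∈ U := ⟨mem_extChartAt_target y₀, by
    rw [mem_preimage, e.left_inv (mem_extChartAt_source y₀)]; exact hy₀⟩
  have h4 := (h3.contDiffAt (hU.mem_nhds hyU)).contMDiffAt
  refine (h4.comp y₀ (contMDiffAt_extChartAt (n := ∞))).congr_of_eventuallyEq ?_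
  filter_upwards [extChartAt_source_mem_nhds (I := I) y₀] with y hy
  simp only [Function.comp]
  rw [e.left_inv hy]

end Integral

/-! ### Cut-off functions for proper actions -/

section Cutoff

open MeasureTheory MulAction

variable {EG : Type*} [NormedAddCommGroup EG] [NormedSpace ℝ EG]
  {G : Type*} [Group G] [TopologicalSpace G] [ChartedSpace EG G]
  {EM : Type*} [NormedAddCommGroup EM] [NormedSpace ℝ EM] [FiniteDimensional ℝ EM]
  {M : Type*} [TopologicalSpace M] [T2Space M] [SecondCountableTopology M] [ChartedSpace EM M]
  [IsManifold 𝓘(ℝ, EM) ∞ M] [MulAction G M]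

variable (G EM M) in
/-- A proper action admits a nonnegative smooth function whose support meets every orbit and whose
translates form a locally finite family in the sense of compact sets. -/
theorem exists_smooth_cutoff [ProperSMul G M] :
    ∃ φ : M → ℝ, ContMDiff 𝓘(ℝ, EM) 𝓘(ℝ, ℝ) ∞ φ ∧ (∀ x, 0 ≤ φ x) ∧
      (∀ x, ∃ γ : G, φ (γ⁻¹ • x) ≠ 0) ∧
      ∀ K : Set M, IsCompact K → ∃ L : Set G, IsCompact L ∧
        ∀ x ∈ K, ∀ γ ∉ L, φ (γ⁻¹ • x) = 0 := by
  have : LocallyCompactSpace M := Manifold.locallyCompact_of_finiteDimensional 𝓘(ℝ, EM)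
  have : SigmaCompactSpace M := inferInstance
  -- The shift makes `C 0` empty, so the least index reached by an orbit is positive.
  let C : CompactExhaustion M := (CompactExhaustion.choice M).shiftr
  have hC0 : C 0 = ∅ := rfl
  let q : M → Quotient (orbitRel G M) := Quotient.mk _
  have hq : Continuous q := continuous_quotient_mk'
  -- Points of the interior of `C (n + 2)` whose orbit misses `C n`. By properness the orbit space
  -- is Hausdorff, so the saturation of the compact set `C n` is closed and `S` is open.
  let S : Set M := ⋃ n, interior (C (n + 2)) \ q ⁻¹' (q '' C n)
  have hS : IsOpen S := isOpen_iUnion fun n =>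
    isOpen_interior.sdiff (((C.isCompact n).image hq).isClosed.preimage hq)
  obtain ⟨φ, hφS, hφ, hφ0⟩ := hS.exists_contMDiff_support_eq 𝓘(ℝ, EM) (n := ⊤)
  refine ⟨φ, hφ, hφ0, fun x => ?_, fun K hK => ?_⟩
  -- If `m + 1` is the least index reached by the orbit of `x`, a point of the orbit in `C (m + 1)`
  -- belongs to the `m`-th layer of `S`.
  · have hex : ∃ n, ∃ γ : G, γ⁻¹ • x ∈ C n := by
      obtain ⟨n, hn⟩ := C.exists_mem x
      exact ⟨n, 1, by simpa using hn⟩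
    classical
    obtain ⟨γ, hγ⟩ := Nat.find_spec hex
    obtain ⟨m, hm⟩ : ∃ m, Nat.find hex = m + 1 := by
      refine Nat.exists_eq_succ_of_ne_zero fun h0 => ?_
      rw [h0, hC0] at hγ
      exact hγ
    rw [hm] at hγ
    refine ⟨γ, Function.mem_support.1 (hφS ▸ mem_iUnion.2 ⟨m, ?_, ?_⟩)⟩
    · exact C.subset_interior_succ _ hγ
    · rintro ⟨y, hy, hyx⟩
      obtain ⟨g, hg⟩ : ∃ g : G, g • γ⁻¹ • x = y := Quotient.exact hyx
      refine Nat.find_min hex (m := m) (by omega) ⟨γ * g⁻¹, ?_⟩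
      rw [mul_inv_rev, inv_inv, mul_smul, hg]
      exact hy
  · obtain ⟨N, hN⟩ := C.exists_superset_of_isCompact hK
    refine ⟨_, ProperSMul.isCompact_setOfPred_inter_nonempty (G := G) (C.isCompact (N + 1)) hK,
      fun x hx γ hγ => ?_⟩
    -- If `γ⁻¹ • x` lies in layer `n`, its orbit misses `C n` but meets `C N` at `x`, so `n < N` and
    -- `γ⁻¹ • x ∈ C (N + 1)`. Thus `γ` belongs to the compact set of elements moving `C (N + 1)` to
    -- meet `K`.
    by_contra hne
    obtain ⟨n, hn, hn'⟩ := mem_iUnion.1 (hφS ▸ Function.mem_support.2 hne : γ⁻¹ • x ∈ S)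
    refine hγ ⟨x, ⟨γ⁻¹ • x, ?_, by simp⟩, hx⟩
    refine C.subset (?_ : n + 2 ≤ N + 1) (interior_subset hn)
    by_contra hle
    refine hn' ⟨x, C.subset (by omega) (hN hx), ?_⟩
    exact Quotient.sound ⟨γ, by simp⟩

/-- A smooth function of which the integral over each orbit is `1`. -/
theorem exists_normalized_cutoff [IsTopologicalGroup G] [T2Space G]
    [SecondCountableTopology G] [LieGroup 𝓘(ℝ, EG) ∞ G] [ContMDiffSMul 𝓘(ℝ, EG) 𝓘(ℝ, EM) ∞ G M]
    [ProperSMul G M]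
    [MeasurableSpace G] [BorelSpace G] (μ : Measure G) [μ.IsHaarMeasure] :
    ∃ χ : M → ℝ, ContMDiff 𝓘(ℝ, EM) 𝓘(ℝ, ℝ) ∞ χ ∧
      (∀ K : Set M, IsCompact K → ∃ L : Set G, IsCompact L ∧
        ∀ x ∈ K, ∀ γ ∉ L, χ (γ⁻¹ • x) = 0) ∧
      ∀ x, ∫ γ, χ (γ⁻¹ • x) ∂μ = 1 := by
  have : LocallyCompactSpace M := Manifold.locallyCompact_of_finiteDimensional 𝓘(ℝ, EM)
  obtain ⟨φ, hφ, hφ0, hφne, hφK⟩ := exists_smooth_cutoff G EM M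
  have hsm : ContMDiff (𝓘(ℝ, EM).prod 𝓘(ℝ, EG)) 𝓘(ℝ, ℝ) ∞
      (fun p : M × G => φ (p.2⁻¹ • p.1)) :=
    hφ.comp ((ContMDiff.inv contMDiff_snd).smul contMDiff_fst)
  let Φ : M → ℝ := fun x => ∫ γ, φ (γ⁻¹ • x) ∂μ
  have hΦ : ContMDiff 𝓘(ℝ, EM) 𝓘(ℝ, ℝ) ∞ Φ := by
    refine contMDiff_parametric_integral μ hsm fun x => ?_
    obtain ⟨K, hK, hKx⟩ := exists_compact_mem_nhds x
    obtain ⟨L, hL, h⟩ := hφK K hK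
    exact ⟨L, hL, eventually_of_mem hKx h⟩
  have hpos : ∀ x, 0 < Φ x := fun x => by
    obtain ⟨γ, hγ⟩ := hφne x
    obtain ⟨L, hL, h⟩ := hφK {x} isCompact_singleton
    refine Continuous.integral_pos_of_hasCompactSupport_nonneg_nonzero
      (f := fun γ => φ (γ⁻¹ • x)) (x := γ) ?_ ?_ (fun γ => hφ0 _) hγ
    · exact hsm.continuous.comp (by fun_prop : Continuous fun γ : G => (x, γ))
    · exact HasCompactSupport.intro hL fun γ hγ => h x rfl γ hγ
  -- Left invariance of Haar measure. Since `Φ` is constant on orbits, dividing by it normalizes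
  -- every orbit integral to `1`.
  have hinv : ∀ (g : G) x, Φ (g • x) = Φ x := fun g x => by
    change ∫ γ, φ (γ⁻¹ • g • x) ∂μ = ∫ γ, φ (γ⁻¹ • x) ∂μ
    rw [← integral_mul_left_eq_self (fun γ => φ (γ⁻¹ • g • x)) g]
    simp only [mul_inv_rev, mul_smul, inv_smul_smul]
  refine ⟨fun x => φ x / Φ x, ?_, fun K hK => ?_, fun x => ?_⟩
  · intro x
    exact (hφ x).div₀ (hΦ x) (hpos x).ne'
  · obtain ⟨L, hL, h⟩ := hφK K hK
    exact ⟨L, hL, fun x hx γ hγ => by simp only [h x hx γ hγ, zero_div]⟩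
  · simp only [hinv]
    rw [integral_div]
    exact div_self (hpos x).ne'

end Cutoff

/-! ### The contracting homotopy -/

section Homotopy

/-! ### Faces of a tuple with one more entry appended. -/

section Algebra

variable {G : Type*} [Group G] {n : ℕ}

theorem snoc_tail_eq (a : Fin (n + 1) → G) (b : G) :
    (Fin.snoc (Fin.tail a) b : Fin (n + 1) → G) =
      Fin.tail (Fin.snoc a b : Fin (n + 2) → G) := by
  funext i
  induction i using Fin.lastCases with
  | last => rw [Fin.snoc_last, Fin.tail, Fin.succ_last, Fin.snoc_last]
  | cast i => rw [Fin.snoc_castSucc, Fin.tail, Fin.tail, Fin.succ_castSucc, Fin.snoc_castSucc]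

theorem contractNth_castSucc_snoc (a : Fin (n + 1) → G) (b : G) (i : Fin n) :
    Fin.contractNth i.castSucc.castSucc (· * ·) (Fin.snoc a b : Fin (n + 2) → G) =
      Fin.snoc (Fin.contractNth i.castSucc (· * ·) a) b := by
  funext k
  induction k using Fin.lastCases with
  | last =>
    rw [Fin.snoc_last, Fin.contractNth_apply_of_gt _ _ _ _ (by simp), Fin.succ_last, Fin.snoc_last]
  | cast k =>
    rw [Fin.snoc_castSucc]
    rcases lt_trichotomy (k : ℕ) i with h | h | h
    · rw [Fin.contractNth_apply_of_lt _ _ _ _ (by simpa using h),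
        Fin.contractNth_apply_of_lt _ _ _ _ (by simpa using h), Fin.snoc_castSucc]
    · rw [Fin.contractNth_apply_of_eq _ _ _ _ (by simpa using h),
        Fin.contractNth_apply_of_eq _ _ _ _ (by simpa using h), Fin.snoc_castSucc,
        Fin.succ_castSucc, Fin.snoc_castSucc]
    · rw [Fin.contractNth_apply_of_gt _ _ _ _ (by simpa using h),
        Fin.contractNth_apply_of_gt _ _ _ _ (by simpa using h), Fin.succ_castSucc,
        Fin.snoc_castSucc]

theorem contractNth_last_snoc (a : Fin (n + 1) → G) (b : G) :
    Fin.contractNth (Fin.last n).castSucc (· * ·) (Fin.snoc a b : Fin (n + 2) → G) =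
      Fin.snoc (Fin.init a) (a (Fin.last n) * b) := by
  funext k
  induction k using Fin.lastCases with
  | last =>
    rw [Fin.snoc_last, Fin.contractNth_apply_of_eq _ _ _ _ (by simp), Fin.succ_last,
      Fin.snoc_last, Fin.snoc_castSucc]
  | cast k =>
    rw [Fin.snoc_castSucc, Fin.contractNth_apply_of_lt _ _ _ _ (by simp), Fin.snoc_castSucc]
    rfl

variable {W : Type*} [AddCommGroup W] [Module ℝ W] [TopologicalSpace W]

/-- This is the cocycle identity at `(a, b)` solved for the face that drops `b`. The face merging
`b` into the last entry of `a` is listed separately, because it alone changes the appended entry. -/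
theorem sum_snoc_of_coboundary_eq_zero {ρ : G →* (W →L[ℝ] W)} {c : (Fin (n + 1) → G) → W}
    (hc : coboundary ρ (n + 1) c = 0) (a : Fin (n + 1) → G) (b : G) :
    ρ (a 0) (c (Fin.snoc (Fin.tail a) b))
      + ∑ i : Fin n, (-1 : ℝ) ^ ((i : ℕ) + 1) •
          c (Fin.snoc (Fin.contractNth i.castSucc (· * ·) a) b)
      + (-1 : ℝ) ^ (n + 1) • c (Fin.snoc (Fin.init a) (a (Fin.last n) * b)) =
    (-1 : ℝ) ^ (n + 1) • c a := by
  have h := congrFun hc (Fin.snoc a b)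
  change ρ ((Fin.snoc a b : Fin (n + 2) → G) 0) (c (Fin.tail (Fin.snoc a b : Fin (n + 2) → G)))
    + ∑ i : Fin (n + 1), (-1 : ℝ) ^ ((i : ℕ) + 1) •
        c (Fin.contractNth i.castSucc (· * ·) (Fin.snoc a b : Fin (n + 2) → G))
    + (-1 : ℝ) ^ (n + 1 + 1) • c (Fin.init (Fin.snoc a b : Fin (n + 2) → G)) = 0 at h
  rw [Fin.sum_univ_castSucc, Fin.init_snoc, contractNth_last_snoc, ← snoc_tail_eq] at h
  simp only [contractNth_castSucc_snoc, Fin.val_castSucc, Fin.val_last] at h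
  have h0 : (Fin.snoc a b : Fin (n + 2) → G) 0 = a 0 := by
    rw [← Fin.castSucc_zero, Fin.snoc_castSucc]
  rw [h0, pow_succ (-1 : ℝ) (n + 1), mul_neg_one, neg_smul, ← sub_eq_add_neg, sub_eq_zero,
    ← add_assoc] at h
  exact h

/-- The product of the entries of a tuple. -/
def tupleProd (a : Fin n → G) : G := Fin.partialProd a (Fin.last n)

theorem tupleProd_tail (a : Fin (n + 1) → G) : tupleProd a = a 0 * tupleProd (Fin.tail a) := by
  rw [tupleProd, ← Fin.succ_last, Fin.partialProd_succ']
  rfl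

theorem tupleProd_init (a : Fin (n + 1) → G) :
    tupleProd a = tupleProd (Fin.init a) * a (Fin.last n) := by
  rw [tupleProd, ← Fin.succ_last, Fin.partialProd_succ, ← Fin.partialProd_init]
  rfl

theorem tupleProd_contractNth (a : Fin (n + 1) → G) (i : Fin n) :
    tupleProd (Fin.contractNth i.castSucc (· * ·) a) = tupleProd a := by
  rw [tupleProd, Fin.partialProd_contractNth, Function.comp_apply, tupleProd]
  congr 1
  rw [Fin.succ_castSucc, Fin.succAbove_of_le_castSucc _ _
    (Fin.castSucc_le_castSucc_iff.2 (Fin.le_last _)), Fin.succ_last]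

end Algebra

open MeasureTheory

variable {EG : Type*} [NormedAddCommGroup EG] [NormedSpace ℝ EG] [FiniteDimensional ℝ EG]
  {G : Type*} [Group G] [TopologicalSpace G] [T2Space G] [SecondCountableTopology G]
  [ChartedSpace EG G] [LieGroup 𝓘(ℝ, EG) ∞ G]
  {EM : Type*} [NormedAddCommGroup EM] [NormedSpace ℝ EM] [FiniteDimensional ℝ EM]
  {M : Type*} [TopologicalSpace M] [T2Space M] [SecondCountableTopology M] [ChartedSpace EM M]
  [IsManifold 𝓘(ℝ, EM) ∞ M] [MulAction G M] [ContMDiffSMul 𝓘(ℝ, EG) 𝓘(ℝ, EM) ∞ G M]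

theorem contMDiff_tupleProd (n : ℕ) :
    ContMDiff 𝓘(ℝ, Fin n → EG) 𝓘(ℝ, EG) ∞ fun a : Fin n → G => tupleProd a := by
  suffices h : ∀ k : Fin (n + 1), ContMDiff 𝓘(ℝ, Fin n → EG) 𝓘(ℝ, EG) ∞
      fun a : Fin n → G => Fin.partialProd a k from h _
  intro k
  induction k using Fin.induction with
  | zero => simpa only [Fin.partialProd_zero] using contMDiff_const
  | succ k ih =>
    simp only [Fin.partialProd_succ]
    exact ih.mul (contMDiff_pow_apply k)

variable {V : Type*} [AddCommGroup V] [Module ℝ V] [UniformSpace V] [IsUniformAddGroup V]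
  [ContinuousSMul ℝ V] [T2Space V] [LocallyConvexSpace ℝ V] [QuasiCompleteSpace ℝ V]

theorem IsSmoothMap.continuous {F : Type*} [AddCommGroup F] [Module ℝ F] [TopologicalSpace F]
    {f : M → F} (hf : IsSmoothMap EM f) : Continuous f := by
  refine continuous_iff_continuousAt.2 fun x => ?_
  have h := (hf (chartAt EM x) (IsManifold.chart_mem_maximalAtlas x)).continuousOn 0
  have h1 : ContinuousAt (fun y => f ((chartAt EM x).symm y)) (chartAt EM x x) :=
    (h.comp (f := fun y : EM => (y, Fin.elim0)) (by fun_prop) fun y hy =>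
      ⟨hy, mem_univ _⟩).continuousAt ((chartAt EM x).open_target.mem_nhds (mem_chart_target EM x))
  refine (ContinuousAt.comp (g := fun y => f ((chartAt EM x).symm y)) h1
    ((chartAt EM x).continuousAt (mem_chart_source EM x))).congr ?_
  filter_upwards [chart_source_mem_nhds EM x] with y hy
  simp only [Function.comp, (chartAt EM x).left_inv hy]

theorem contMDiff_homotopy_integrand {n : ℕ} {χ : M → ℝ} (hχ : ContMDiff 𝓘(ℝ, EM) 𝓘(ℝ, ℝ) ∞ χ)
    {c : (Fin (n + 1) → G) → SmoothFun EM M V} (hc : IsSmoothMap (Fin (n + 1) → EG) c)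
    (ℓ : V →L[ℝ] ℝ) :
    ContMDiff ((𝓘(ℝ, Fin n → EG).prod 𝓘(ℝ, EM)).prod 𝓘(ℝ, EG)) 𝓘(ℝ, ℝ) ∞
      fun p : ((Fin n → G) × M) × G =>
        ℓ (χ (p.2⁻¹ • p.1.2) • (c (Fin.snoc p.1.1 ((tupleProd p.1.1)⁻¹ * p.2))).1 p.1.2) := by
  simp only [map_smul, smul_eq_mul]
  have ha : ContMDiff ((𝓘(ℝ, Fin n → EG).prod 𝓘(ℝ, EM)).prod 𝓘(ℝ, EG)) 𝓘(ℝ, Fin n → EG) ∞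
      fun p : ((Fin n → G) × M) × G => p.1.1 := contMDiff_fst.comp contMDiff_fst
  have hx : ContMDiff ((𝓘(ℝ, Fin n → EG).prod 𝓘(ℝ, EM)).prod 𝓘(ℝ, EG)) 𝓘(ℝ, EM) ∞
      fun p : ((Fin n → G) × M) × G => p.1.2 := contMDiff_snd.comp contMDiff_fst
  have hγ : ContMDiff ((𝓘(ℝ, Fin n → EG).prod 𝓘(ℝ, EM)).prod 𝓘(ℝ, EG)) 𝓘(ℝ, EG) ∞
      fun p : ((Fin n → G) × M) × G => p.2 := contMDiff_snd
  refine (hχ.comp (hγ.inv.smul hx)).mul ?_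
  refine (contMDiff_uncurry hc ℓ).comp (ContMDiff.prodMk (contMDiff_pow
    (g := fun p : ((Fin n → G) × M) × G =>
      (Fin.snoc p.1.1 ((tupleProd p.1.1)⁻¹ * p.2) : Fin (n + 1) → G)) fun i => ?_) hx)
  induction i using Fin.lastCases with
  | last =>
    simp only [Fin.snoc_last]
    exact ((contMDiff_tupleProd n).comp ha).inv.mul hγ
  | cast i =>
    simp only [Fin.snoc_castSucc]
    exact (contMDiff_pow_apply i).comp ha

/-- Evaluation at a point. -/
def SmoothFun.evalₗ (x : M) : SmoothFun EM M V →ₗ[ℝ] V where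
  toFun f := f.1 x
  map_add' _ _ := rfl
  map_smul' _ _ := rfl

/-- For a proper action, every differentiable cocycle of positive degree with values in
`C^∞(M, V)` is a coboundary. -/
theorem exists_coboundary_eq_of_properSMul [ProperSMul G M] (ρ : G →* (V →L[ℝ] V)) {n : ℕ}
    {c : (Fin (n + 1) → G) → SmoothFun EM M V} (hc : IsSmoothMap (Fin (n + 1) → EG) c)
    (hc0 : coboundary (smoothFunAction EG ρ) (n + 1) c = 0) :
    ∃ h : (Fin n → G) → SmoothFun EM M V, IsSmoothMap (Fin n → EG) h ∧
      coboundary (smoothFunAction EG ρ) n h = c := by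
  have : LocallyCompactSpace G := Manifold.locallyCompact_of_finiteDimensional 𝓘(ℝ, EG)
  have : LocallyCompactSpace M := Manifold.locallyCompact_of_finiteDimensional 𝓘(ℝ, EM)
  have : IsTopologicalGroup G := topologicalGroup_of_lieGroup 𝓘(ℝ, EG) ∞
  let _ : MeasurableSpace G := borel G
  have : BorelSpace G := ⟨rfl⟩
  let μ : Measure G := Measure.haar
  obtain ⟨χ, hχ, hχK, hχ1⟩ := exists_normalized_cutoff (EG := EG) (EM := EM) (M := M) μ
  -- The appended entry is chosen so that the product of the whole tuple is `γ`. This ties it to the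
  -- argument of `χ` in a way compatible with all faces.
  let F : (Fin n → G) → M → G → V := fun a x γ =>
    χ (γ⁻¹ • x) • (c (Fin.snoc a ((tupleProd a)⁻¹ * γ))).1 x
  have hF := fun ℓ : V →L[ℝ] ℝ => contMDiff_homotopy_integrand hχ hc ℓ
  have hFc : ∀ a x, Continuous (F a x) := fun a x =>
    IsSmoothMap.continuous (EM := EG) <| isSmoothMap_of_contMDiff fun ℓ =>
      (hF ℓ).comp (contMDiff_const (c := (a, x)).prodMk contMDiff_id)
  have hFK : ∀ x, ∃ L : Set G, IsCompact L ∧ ∀ᶠ y in 𝓝 x, ∀ γ ∉ L, ∀ a, F a y γ = 0 := by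
    intro x
    obtain ⟨K, hK, hKx⟩ := exists_compact_mem_nhds x
    obtain ⟨L, hL, h⟩ := hχK K hK
    exact ⟨L, hL, eventually_of_mem hKx fun y hy γ hγ a => by simp only [F, h y hy γ hγ, zero_smul]⟩
  have hI : ∀ a x, ∃ I : V, ∀ ℓ : V →L[ℝ] ℝ, ℓ I = ∫ γ, ℓ (F a x γ) ∂μ := fun a x => by
    obtain ⟨L, hL, h⟩ := hFK x
    exact exists_weak_integral μ (hFc a x) hL fun γ hγ => h.self_of_nhds γ hγ a
  have hint : ∀ a x (ℓ : V →L[ℝ] ℝ), Integrable (fun γ => ℓ (F a x γ)) μ := fun a x ℓ => by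
    obtain ⟨L, hL, h⟩ := hFK x
    refine (ℓ.continuous.comp (hFc a x)).integrable_of_hasCompactSupport
      (HasCompactSupport.intro hL fun γ hγ => ?_)
    rw [Function.comp_apply, h.self_of_nhds γ hγ a, map_zero]
  choose I hI using hI
  have hIs : ∀ ℓ : V →L[ℝ] ℝ, ContMDiff (𝓘(ℝ, Fin n → EG).prod 𝓘(ℝ, EM)) 𝓘(ℝ, ℝ) ∞
      fun p : (Fin n → G) × M => ℓ (I p.1 p.2) := fun ℓ => by
    simp only [hI]
    refine contMDiff_parametric_integral μ (hF ℓ) fun p => ?_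
    obtain ⟨L, hL, h⟩ := hFK p.2
    refine ⟨L, hL, (continuous_snd.tendsto p).eventually h |>.mono fun q hq γ hγ => ?_⟩
    change ℓ (F q.1 q.2 γ) = 0
    rw [hq γ hγ, map_zero]
  have hIa : ∀ a, IsSmoothMap EM (I a) := fun a => isSmoothMap_of_contMDiff fun ℓ =>
    (hIs ℓ).comp (contMDiff_const (c := a).prodMk contMDiff_id)
  let h : (Fin n → G) → SmoothFun EM M V := fun a => SmoothFun.mk (I a) (hIa a)
  have hh : IsSmoothMap (Fin n → EG) h := isSmoothMap_of_contMDiff_uncurry hIs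
  -- The sign is that of the last face in `∂`; it is removed by rescaling `h`.
  suffices key : coboundary (smoothFunAction EG ρ) n h = (-1 : ℝ) ^ (n + 1) • c by
    refine ⟨(-1 : ℝ) ^ (n + 1) • h, (smoothSubmodule (Fin n → EG) (Fin n → G) _).smul_mem _ hh, ?_⟩
    rw [map_smul, key, smul_smul, ← mul_pow, neg_one_mul, neg_neg, one_pow, one_smul]
  funext a
  refine Subtype.ext (funext fun x => exists_dual_ne fun ℓ => ?_)
  let ev : SmoothFun EM M V →ₗ[ℝ] ℝ := ℓ.toLinearMap ∘ₗ SmoothFun.evalₗ x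
  -- The common entry to append to `a`: each face of `a` carries its own entry in `F`, and all of
  -- them are expressed through `β γ` because merging entries preserves the product.
  let β : G → G := fun γ => (tupleProd a)⁻¹ * γ
  let T₀ : G → ℝ := fun γ =>
    χ (γ⁻¹ • x) * ev (smoothFunAction EG ρ (a 0) (c (Fin.snoc (Fin.tail a) (β γ))))
  let T : Fin n → G → ℝ := fun i γ =>
    χ (γ⁻¹ • x) * ev (c (Fin.snoc (Fin.contractNth i.castSucc (· * ·) a) (β γ)))
  let T₁ : G → ℝ := fun γ =>
    χ (γ⁻¹ • x) * ev (c (Fin.snoc (Fin.init a) (a (Fin.last n) * β γ)))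
  have e₀ : ∀ γ, (ℓ.comp (ρ (a 0))) (F (Fin.tail a) ((a 0)⁻¹ • x) ((a 0)⁻¹ * γ)) = T₀ γ := by
    intro γ
    simp only [F, T₀, β, map_smul, smul_eq_mul, tupleProd_tail a, mul_inv_rev, inv_inv, mul_smul,
      mul_assoc, smul_inv_smul]
    rfl
  have e : ∀ i γ, ℓ (F (Fin.contractNth i.castSucc (· * ·) a) x γ) = T i γ := by
    intro i γ
    simp only [F, T, β, map_smul, smul_eq_mul, tupleProd_contractNth]
    rfl
  have e₁ : ∀ γ, ℓ (F (Fin.init a) x γ) = T₁ γ := by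
    intro γ
    simp only [F, T₁, β, map_smul, smul_eq_mul, tupleProd_init a, mul_inv_rev, mul_assoc,
      mul_inv_cancel_left]
    rfl
  have i₀ : Integrable T₀ μ := by
    have := (hint (Fin.tail a) ((a 0)⁻¹ • x) (ℓ.comp (ρ (a 0)))).comp_mul_left (a 0)⁻¹
    simpa only [e₀] using this
  have i : ∀ i, Integrable (T i) μ := fun i => by
    simpa only [e] using hint (Fin.contractNth i.castSucc (· * ·) a) x ℓ
  have i₁ : Integrable T₁ μ := by simpa only [e₁] using hint (Fin.init a) x ℓ
  have h₀ : ev (smoothFunAction EG ρ (a 0) (h (Fin.tail a))) = ∫ γ, T₀ γ ∂μ := by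
    refine (hI (Fin.tail a) ((a 0)⁻¹ • x) (ℓ.comp (ρ (a 0)))).trans ?_
    -- Replacing `γ` by `(a 0)⁻¹ * γ` undoes both the translation of `x` and the loss of the factor
    -- `a 0` in the product of the tuple.
    rw [← integral_mul_left_eq_self _ (a 0)⁻¹]
    simp only [e₀]
  have h₂ : ∀ i : Fin n, ev (h (Fin.contractNth i.castSucc (· * ·) a)) = ∫ γ, T i γ ∂μ :=
    fun i => (hI _ x ℓ).trans (by simp only [e])
  have h₁ : ev (h (Fin.init a)) = ∫ γ, T₁ γ ∂μ := (hI _ x ℓ).trans (by simp only [e₁])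
  -- The cocycle identity at `(a, β γ)`, weighted by `χ(γ⁻¹x)`. The right side depends on `γ` only
  -- through the weight, whose integral is `1`.
  have hsum : ∀ γ, T₀ γ + ∑ i : Fin n, (-1 : ℝ) ^ ((i : ℕ) + 1) * T i γ
      + (-1 : ℝ) ^ (n + 1) * T₁ γ = χ (γ⁻¹ • x) * ((-1 : ℝ) ^ (n + 1) * ev (c a)) := fun γ => by
    have h3 := congrArg ev (sum_snoc_of_coboundary_eq_zero hc0 a (β γ))
    simp only [map_add, map_sum, map_smul, smul_eq_mul] at h3
    rw [← h3]
    simp only [T₀, T, T₁, mul_add, Finset.mul_sum, mul_left_comm (χ (γ⁻¹ • x))]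
  change ev (smoothFunAction EG ρ (a 0) (h (Fin.tail a))
    + ∑ i : Fin n, (-1 : ℝ) ^ ((i : ℕ) + 1) • h (Fin.contractNth i.castSucc (· * ·) a)
    + (-1 : ℝ) ^ (n + 1) • h (Fin.init a)) = ev ((-1 : ℝ) ^ (n + 1) • c a)
  simp only [map_add, map_sum, map_smul, smul_eq_mul, h₀, h₁, h₂]
  simp only [← integral_const_mul]
  have i₂ : Integrable (fun γ => ∑ i : Fin n, (-1 : ℝ) ^ ((i : ℕ) + 1) * T i γ) μ :=
    integrable_finsetSum _ fun j _ => (i j).const_mul _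
  have i₃ : Integrable (fun γ => T₀ γ + ∑ i : Fin n, (-1 : ℝ) ^ ((i : ℕ) + 1) * T i γ) μ :=
    i₀.add i₂
  rw [← integral_finsetSum _ fun j _ => (i j).const_mul _, ← integral_add i₀ i₂,
    ← integral_add i₃ (i₁.const_mul _)]
  simp only [hsum]
  rw [integral_mul_const, hχ1, one_mul]

theorem subsingleton_diffCohomology_of_properSMul [ProperSMul G M] (ρ : G →* (V →L[ℝ] V))
    {r : ℕ} (hr : 0 < r) :
    Subsingleton (DiffCohomology EG (smoothFunAction EG (EM := EM) (M := M) ρ) r) := by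
  obtain ⟨n, rfl⟩ : ∃ n, r = n + 1 := ⟨r - 1, by omega⟩
  refine Submodule.Quotient.subsingleton_iff.2 (eq_top_iff.2 fun c _ => ?_)
  obtain ⟨h, hh, hc⟩ := exists_coboundary_eq_of_properSMul ρ c.2.1 (LinearMap.mem_ker.1 c.2.2)
  exact ⟨h, hh, hc⟩

end Homotopy

/-! ### Passage to real coefficients -/

section Retract

variable {EM : Type*} [NormedAddCommGroup EM] [NormedSpace ℝ EM] [FiniteDimensional ℝ EM]
  {M : Type*} [TopologicalSpace M] [ChartedSpace EM M] [IsManifold 𝓘(ℝ, EM) ∞ M]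
  {V : Type*} [AddCommGroup V] [Module ℝ V] [UniformSpace V] [IsUniformAddGroup V]
  [ContinuousSMul ℝ V] [T2Space V] [LocallyConvexSpace ℝ V] [QuasiCompleteSpace ℝ V]
  {V' : Type*} [AddCommGroup V'] [Module ℝ V'] [UniformSpace V'] [IsUniformAddGroup V']
  [ContinuousSMul ℝ V'] [T2Space V'] [LocallyConvexSpace ℝ V'] [QuasiCompleteSpace ℝ V']

/-- Composition of smooth maps with a continuous linear map. -/
def SmoothFun.postcomp (L : V →L[ℝ] V') : SmoothFun EM M V →ₗ[ℝ] SmoothFun EM M V' where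
  toFun f := SmoothFun.mk (fun x => L (f.1 x)) <|
    isSmoothMap_of_contMDiff fun ℓ => f.contMDiff (ℓ.comp L)
  map_add' _ _ := Subtype.ext (funext fun _ => map_add L _ _)
  map_smul' _ _ := Subtype.ext (funext fun _ => map_smul L _ _)

theorem IsSmoothMap.postcomp {EX : Type*} [NormedAddCommGroup EX] [NormedSpace ℝ EX]
    [FiniteDimensional ℝ EX] {X : Type*} [TopologicalSpace X] [ChartedSpace EX X]
    [IsManifold 𝓘(ℝ, EX) ∞ X] {c : X → SmoothFun EM M V} (hc : IsSmoothMap EX c)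
    (L : V →L[ℝ] V') : IsSmoothMap EX fun a => SmoothFun.postcomp L (c a) :=
  isSmoothMap_of_contMDiff_uncurry fun ℓ => contMDiff_uncurry hc (ℓ.comp L)

theorem coboundary_comp {G W W' : Type*} [Group G] [AddCommGroup W] [Module ℝ W]
    [TopologicalSpace W] [AddCommGroup W'] [Module ℝ W'] [TopologicalSpace W']
    {ρ : G →* (W →L[ℝ] W)} {ρ' : G →* (W' →L[ℝ] W')} (T : W →ₗ[ℝ] W')
    (hT : ∀ g w, T (ρ g w) = ρ' g (T w)) (n : ℕ) (c : (Fin n → G) → W) (a : Fin (n + 1) → G) :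
    coboundary ρ' n (fun b => T (c b)) a = T (coboundary ρ n c a) := by
  change _ = T (ρ (a 0) (c (Fin.tail a))
    + ∑ i : Fin n, (-1 : ℝ) ^ ((i : ℕ) + 1) • c (Fin.contractNth i.castSucc (· * ·) a)
    + (-1 : ℝ) ^ (n + 1) • c (Fin.init a))
  simp only [map_add, map_sum, map_smul, hT]
  rfl

variable {EG : Type*} [NormedAddCommGroup EG] [NormedSpace ℝ EG] [FiniteDimensional ℝ EG]
  {G : Type*} [Group G] [TopologicalSpace G] [ChartedSpace EG G] [LieGroup 𝓘(ℝ, EG) ∞ G]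
  [MulAction G M] [ContMDiffSMul 𝓘(ℝ, EG) 𝓘(ℝ, EM) ∞ G M]

theorem SmoothFun.postcomp_smoothFunAction {ρ : G →* (V →L[ℝ] V)} {ρ' : G →* (V' →L[ℝ] V')}
    (L : V →L[ℝ] V') (hL : ∀ g v, L (ρ g v) = ρ' g (L v)) (g : G) (f : SmoothFun EM M V) :
    SmoothFun.postcomp L (smoothFunAction EG ρ g f) =
      smoothFunAction EG ρ' g (SmoothFun.postcomp L f) :=
  Subtype.ext (funext fun _ => hL g _)

/-- Vanishing of cohomology passes to equivariant retracts of the coefficients. -/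
theorem exists_coboundary_eq_of_retract {ρ : G →* (V →L[ℝ] V)} {ρ' : G →* (V' →L[ℝ] V')}
    (J : V →L[ℝ] V') (P : V' →L[ℝ] V) (hJ : ∀ g v, J (ρ g v) = ρ' g (J v))
    (hP : ∀ g v, P (ρ' g v) = ρ g (P v)) (hPJ : ∀ v, P (J v) = v) (n : ℕ)
    (h : Subsingleton (DiffCohomology EG (smoothFunAction EG (EM := EM) (M := M) ρ') (n + 1))) :
    Subsingleton (DiffCohomology EG (smoothFunAction EG (EM := EM) (M := M) ρ) (n + 1)) := by
  refine Submodule.Quotient.subsingleton_iff.2 (eq_top_iff.2 fun c _ => ?_)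
  have hc : IsSmoothMap (Fin (n + 1) → EG) c.1 := c.2.1
  have hc0 : coboundary (smoothFunAction EG ρ) (n + 1) c.1 = 0 := c.2.2
  have hJc : (fun a => SmoothFun.postcomp J (c.1 a)) ∈
      cocycles EG (smoothFunAction EG (EM := EM) (M := M) ρ') (n + 1) := by
    refine ⟨hc.postcomp J, LinearMap.mem_ker.2 (funext fun a => ?_)⟩
    rw [coboundary_comp _ (SmoothFun.postcomp_smoothFunAction J hJ), hc0]
    exact map_zero _
  have h1 : (⟨_, hJc⟩ : cocycles EG (smoothFunAction EG (EM := EM) (M := M) ρ') (n + 1)) ∈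
      (coboundaries EG (smoothFunAction EG (EM := EM) (M := M) ρ') (n + 1)).submoduleOf _ := by
    rw [Submodule.Quotient.subsingleton_iff.1 h]
    trivial
  obtain ⟨b, hb, hbc⟩ := h1
  have hb' : IsSmoothMap (Fin n → EG) b := hb
  refine ⟨fun a => SmoothFun.postcomp P (b a), hb'.postcomp P, ?_⟩
  funext a
  rw [coboundary_comp _ (SmoothFun.postcomp_smoothFunAction P hP), hbc]
  exact Subtype.ext (funext fun x => hPJ _)

/-- Finite-dimensional spaces with the trivial action are differentiable modules. -/
theorem isDifferentiableModule_one (F : Type*) [NormedAddCommGroup F] [NormedSpace ℝ F]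
    [FiniteDimensional ℝ F] : IsDifferentiableModule EG (1 : G →* (F →L[ℝ] F)) := by
  have : CompleteSpace F := FiniteDimensional.complete ℝ F
  refine ⟨continuous_snd, fun v e _ => isSmoothOn_const e.open_target v, ?_⟩
  have h : IsSmoothMap F fun v : F => (SmoothFun.mk (fun _ => v) fun e _ =>
      isSmoothOn_const e.open_target v : SmoothFun EG G F) :=
    isSmoothMap_of_contMDiff_uncurry fun ℓ => ℓ.contMDiff.comp contMDiff_fst
  exact h (OpenPartialHomeomorph.refl F) (IsManifold.subset_maximalAtlas rfl)

end Retract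

/-! ### Isometric actions -/

section Isometric

variable {M : Type*} [PseudoEMetricSpace M] {G : Type*} [Group G] [MulAction G M]
  [IsIsometricSMul G M]

/-- Isometries are equicontinuous, so convergence at `x` persists when the point moves towards `x`.
-/
theorem tendsto_smul_prod_nhds {𝒰 : Filter G} {x y : M}
    (h : Tendsto (fun g : G => g • x) 𝒰 (𝓝 y)) :
    Tendsto (fun p : G × M => p.1 • p.2) (𝒰 ×ˢ 𝓝 x) (𝓝 y) := by
  rw [tendsto_iff_edist_tendsto_0] at h ⊢
  have h1 : Tendsto (fun p : G × M => edist p.2 x) (𝒰 ×ˢ 𝓝 x) (𝓝 0) :=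
    (tendsto_iff_edist_tendsto_0.1 tendsto_id).comp tendsto_snd
  have h2 := h1.add (h.comp (tendsto_fst (f := 𝒰) (g := 𝓝 x)))
  rw [add_zero] at h2
  refine tendsto_of_tendsto_of_tendsto_of_le_of_le tendsto_const_nhds h2 (fun _ => zero_le)
    fun p => ?_
  calc edist (p.1 • p.2) y ≤ edist (p.1 • p.2) (p.1 • x) + edist (p.1 • x) y :=
        edist_triangle _ _ _
    _ = edist p.2 x + edist (p.1 • x) y := by rw [edist_smul_left]

/-- The distance from `g⁻¹ • y` to `x` equals the distance from `y` to `g • x`. -/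
theorem tendsto_inv_smul {𝒰 : Filter G} {x y : M} (h : Tendsto (fun g : G => g • x) 𝒰 (𝓝 y)) :
    Tendsto (fun g : G => g⁻¹ • y) 𝒰 (𝓝 x) := by
  rw [tendsto_iff_edist_tendsto_0] at h ⊢
  refine h.congr fun g => ?_
  rw [← edist_smul_left g (g⁻¹ • y) x, smul_inv_smul, edist_comm]

/-- On a connected locally compact space, an ultrafilter of isometries which converges at one point
converges at every point. -/
theorem exists_tendsto_smul_of_tendsto_smul [LocallyCompactSpace M] [ConnectedSpace M]
    (𝒰 : Ultrafilter G) {x₀ y₀ : M} (h : Tendsto (fun g : G => g • x₀) 𝒰 (𝓝 y₀)) (x : M) :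
    ∃ y, Tendsto (fun g : G => g • x) 𝒰 (𝓝 y) := by
  let A : Set M := {z | ∃ y, Tendsto (fun g : G => g • z) 𝒰 (𝓝 y)}
  -- Each `z` has a neighbourhood on which convergence at one point forces convergence at all
  -- points. This shows at once that `A` is open and closed.
  have hN : ∀ z, ∃ N ∈ 𝓝 z, ∀ z' ∈ N, z' ∈ A → N ⊆ A := by
    intro z
    obtain ⟨K, hK, hKz⟩ := exists_compact_mem_nhds z
    obtain ⟨ρ, hρ, hρK⟩ := EMetric.mem_nhds_iff.1 hKz
    have hρ4 : 0 < ρ / 4 := ENNReal.div_pos hρ.ne' (by simp)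
    have hρ8 : 0 < ρ / 4 / 2 := ENNReal.div_pos hρ4.ne' (by simp)
    -- With radius `ρ/8` any two points of the ball are closer than `ρ/4`, so the four-step triangle
    -- inequality below stays under `ρ`.
    refine ⟨_, Metric.eball_mem_nhds z hρ8, fun z' hz' ⟨w, hw⟩ p hp => ?_⟩
    have hev : ∀ᶠ g in (𝒰 : Filter G), edist (g • z') w < ρ / 4 :=
      hw.eventually (Metric.eball_mem_nhds w hρ4)
    obtain ⟨g₀, hg₀⟩ := hev.exists
    have hzz' : edist z' z < ρ / 4 := lt_of_lt_of_le hz' ENNReal.half_le_self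
    have hpz' : edist p z' < ρ / 4 := by
      calc edist p z' ≤ edist p z + edist z' z := edist_triangle_right _ _ _
        _ < ρ / 4 / 2 + ρ / 4 / 2 := ENNReal.add_lt_add hp hz'
        _ = ρ / 4 := ENNReal.add_halves _
    -- Compared with one fixed `g₀` of the eventual set, the points `g • p` remain in the compact
    -- set `g₀ K`, so the ultrafilter has a limit there.
    have hmem : ∀ᶠ g in (𝒰 : Filter G), g • p ∈ (fun y => g₀ • y) '' K := by
      filter_upwards [hev] with g hg
      refine ⟨g₀⁻¹ • g • p, hρK ?_, smul_inv_smul _ _⟩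
      change edist (g₀⁻¹ • g • p) z < ρ
      rw [← edist_smul_left g₀, smul_inv_smul]
      calc edist (g • p) (g₀ • z)
          ≤ edist (g • p) (g • z') + edist (g • z') w + edist w (g₀ • z')
            + edist (g₀ • z') (g₀ • z) :=
            (edist_triangle _ _ _).trans (add_le_add_left (edist_triangle4 _ _ _ _) _)
        _ < ρ / 4 + ρ / 4 + ρ / 4 + ρ / 4 := by
            rw [edist_smul_left, edist_smul_left, edist_comm w]
            exact ENNReal.add_lt_add (ENNReal.add_lt_add (ENNReal.add_lt_add hpz' hg) hg₀) hzz'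
        _ = ρ := by
            rw [add_assoc, ← two_mul, ← mul_two, mul_comm 2, mul_assoc]
            norm_num
            exact ENNReal.div_mul_cancel (by simp) (by simp)
    have hKc : IsCompact ((fun y => g₀ • y) '' K) := hK.image (isometry_smul M g₀).continuous
    obtain ⟨y, -, hy⟩ := hKc.ultrafilter_le_nhds (𝒰.map fun g => g • p) (le_principal_iff.2 hmem)
    exact ⟨y, hy⟩
  have hA : IsClopen A := by
    constructor
    · refine ⟨isOpen_iff_mem_nhds.2 fun z hz => ?_⟩
      obtain ⟨N, hN, h⟩ := hN z
      filter_upwards [hN] with z' hz' hzA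
      exact hz (h z' hz' hzA (mem_of_mem_nhds hN))
    · refine isOpen_iff_mem_nhds.2 fun z hz => ?_
      obtain ⟨N, hN, h⟩ := hN z
      exact mem_of_superset hN (h z (mem_of_mem_nhds hN) hz)
  exact eq_univ_iff_forall.1 (hA.eq_univ ⟨x₀, y₀, h⟩) x

theorem leftInverse_of_tendsto_smul [T2Space M] {𝒰 : Filter G} [𝒰.NeBot] {h h' : M → M}
    (hh : ∀ x, Tendsto (fun g : G => g • x) 𝒰 (𝓝 (h x)))
    (hh' : ∀ x, Tendsto (fun g : G => g⁻¹ • x) 𝒰 (𝓝 (h' x))) : Function.LeftInverse h' h :=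
  fun x => tendsto_nhds_unique (hh' (h x)) (tendsto_inv_smul (hh x))

theorem rightInverse_of_tendsto_smul [T2Space M] {𝒰 : Filter G} [𝒰.NeBot] {h h' : M → M}
    (hh : ∀ x, Tendsto (fun g : G => g • x) 𝒰 (𝓝 (h x)))
    (hh' : ∀ x, Tendsto (fun g : G => g⁻¹ • x) 𝒰 (𝓝 (h' x))) : Function.RightInverse h' h := by
  intro x
  refine tendsto_nhds_unique (hh (h' x)) ?_
  have := tendsto_inv_smul (G := G) (𝒰 := 𝒰.map fun g => g⁻¹) (x := x) (y := h' x) (hh' x)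
  rw [tendsto_map'_iff] at this
  simpa only [Function.comp_def, inv_inv] using this

variable (G) in
/-- The group `G` with the topology of pointwise convergence on `M`. -/
def PointwiseGroup (_ : Type*) : Type _ := G

instance : Group (PointwiseGroup G M) := inferInstanceAs (Group G)

instance : MulAction (PointwiseGroup G M) M := inferInstanceAs (MulAction G M)

instance : IsIsometricSMul (PointwiseGroup G M) M := inferInstanceAs (IsIsometricSMul G M)

instance : TopologicalSpace (PointwiseGroup G M) :=
  TopologicalSpace.induced (fun g (x : M) => g • x) inferInstance

theorem PointwiseGroup.tendsto_iff {α : Type*} {l : Filter α} {f : α → PointwiseGroup G M}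
    {g : PointwiseGroup G M} :
    Tendsto f l (𝓝 g) ↔ ∀ x : M, Tendsto (fun a => f a • x) l (𝓝 (g • x)) := by
  rw [(Topology.IsInducing.induced (fun (g : PointwiseGroup G M) (x : M) => g • x)
    ).tendsto_nhds_iff, tendsto_pi_nhds]
  rfl

theorem PointwiseGroup.tendsto_smul (g : PointwiseGroup G M) (x : M) :
    Tendsto (fun g : PointwiseGroup G M => g • x) (𝓝 g) (𝓝 (g • x)) :=
  PointwiseGroup.tendsto_iff.1 tendsto_id x

instance : IsTopologicalGroup (PointwiseGroup G M) where
  continuous_mul := by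
    refine continuous_iff_continuousAt.2 fun ⟨g, h⟩ => PointwiseGroup.tendsto_iff.2 fun x => ?_
    have h3 := (tendsto_smul_prod_nhds (g.tendsto_smul (h • x))).comp
      (tendsto_fst.prodMk ((h.tendsto_smul x).comp (tendsto_snd (f := 𝓝 g) (g := 𝓝 h))))
    rw [← nhds_prod_eq] at h3
    simp only [mul_smul]
    exact h3
  continuous_inv := by
    refine continuous_iff_continuousAt.2 fun g => PointwiseGroup.tendsto_iff.2 fun x => ?_
    have h2 := tendsto_inv_smul (g.tendsto_smul (g⁻¹ • x))
    rwa [smul_inv_smul] at h2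

/-- The identity map from `G` to `PointwiseGroup G M`. -/
def toPointwiseGroup (G M : Type*) [PseudoEMetricSpace M] [Group G] [MulAction G M]
    [IsIsometricSMul G M] : G ≃* PointwiseGroup G M := MulEquiv.refl G

/-- An isometric action of a `σ`-compact group is proper if ultrafilters converging at
one point converge pointwise to elements of the group. -/
theorem properSMul_of_exists_pointwise_limit [T2Space M] [LocallyCompactSpace M] [Nonempty M]
    [FaithfulSMul G M] [TopologicalSpace G] [IsTopologicalGroup G] [SigmaCompactSpace G]
    [ContinuousSMul G M]
    (H : ∀ (𝒰 : Ultrafilter G) (x₀ y₀ : M), Tendsto (fun g : G => g • x₀) 𝒰 (𝓝 y₀) →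
      ∃ g₀ : G, ∀ x : M, Tendsto (fun g : G => g • x) 𝒰 (𝓝 (g₀ • x))) : ProperSMul G M := by
  have : T2Space (PointwiseGroup G M) := by
    refine T2Space.of_injective_continuous (f := fun (g : PointwiseGroup G M) (x : M) => g • x)
      (fun g g' h => ?_) continuous_induced_dom
    exact FaithfulSMul.eq_of_smul_eq_smul (M := G) (α := M) (congrFun h)
  have hcont : Continuous (toPointwiseGroup G M) := by
    refine continuous_iff_continuousAt.2 fun g => PointwiseGroup.tendsto_iff.2 fun x => ?_
    exact (continuous_id.smul continuous_const : Continuous fun g : G => g • x).tendsto g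
  -- The elements carrying `x₀` into a compact neighbourhood of it form a neighbourhood of `1`,
  -- which is compact because `H` supplies limits of its ultrafilters inside the group.
  have : LocallyCompactSpace (PointwiseGroup G M) := by
    obtain ⟨x₀⟩ := ‹Nonempty M›
    obtain ⟨K, hK, hKx⟩ := exists_compact_mem_nhds x₀
    let L : Set (PointwiseGroup G M) := {g | g • x₀ ∈ K}
    have hL : IsCompact L := by
      refine isCompact_iff_ultrafilter_le_nhds.2 fun 𝒰 h𝒰 => ?_
      obtain ⟨y₀, hy₀, hy⟩ := hK.ultrafilter_le_nhds
        (𝒰.map fun g => g • x₀) (le_principal_iff.2 (le_principal_iff.1 h𝒰 : L ∈ 𝒰))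
      obtain ⟨g₀, hg₀⟩ := H (𝒰.map (toPointwiseGroup G M).symm) x₀ y₀ hy
      refine ⟨toPointwiseGroup G M g₀, ?_, PointwiseGroup.tendsto_iff.2 hg₀⟩
      have h1 : Tendsto (fun g => g • x₀) (𝒰 : Filter (PointwiseGroup G M)) (𝓝 (g₀ • x₀)) :=
        hg₀ x₀
      change g₀ • x₀ ∈ K
      rwa [tendsto_nhds_unique h1 hy]
    have hL1 : L ∈ 𝓝 (1 : PointwiseGroup G M) := by
      refine (PointwiseGroup.tendsto_smul 1 x₀).eventually_mem ?_
      rwa [one_smul]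
    exact hL.locallyCompactSpace_of_mem_nhds_of_group hL1
  -- Open mapping theorem: a continuous surjective homomorphism from a `σ`-compact group onto a
  -- locally compact Hausdorff group is open. Hence the given topology of `G` is that of pointwise
  -- convergence.
  have hopen : IsOpenMap (toPointwiseGroup G M).toMonoidHom :=
    MonoidHom.isOpenMap_of_sigmaCompact _ (toPointwiseGroup G M).surjective hcont
  refine properSMul_iff_continuousSMul_ultrafilter_tendsto_t2.2 ⟨inferInstance, ?_⟩
  intro 𝒰 y₀ x₀ h
  have h1 : Tendsto (fun p : G × M => p.1 • p.2) 𝒰 (𝓝 y₀) := (continuous_fst.tendsto _).comp h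
  have h2 : Tendsto (fun p : G × M => p.2) 𝒰 (𝓝 x₀) := (continuous_snd.tendsto _).comp h
  -- Since the action is isometric, the moving point `p.2` may be replaced by its limit `x₀`.
  have h3 : Tendsto (fun p : G × M => p.1 • x₀) 𝒰 (𝓝 y₀) := by
    rw [tendsto_iff_edist_tendsto_0] at h1 h2 ⊢
    have h4 := h2.add h1
    rw [add_zero] at h4
    refine tendsto_of_tendsto_of_tendsto_of_le_of_le tendsto_const_nhds h4 (fun _ => zero_le)
      fun p => ?_
    calc edist (p.1 • x₀) y₀ ≤ edist (p.1 • p.2) (p.1 • x₀) + edist (p.1 • p.2) y₀ :=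
          edist_triangle_left _ _ _
      _ = edist p.2 x₀ + edist (p.1 • p.2) y₀ := by rw [edist_smul_left]
  obtain ⟨g₀, hg₀⟩ := H (𝒰.map Prod.fst) x₀ y₀ h3
  refine ⟨g₀, fun s hs => ?_⟩
  have h5 : Tendsto (toPointwiseGroup G M) (𝒰.map Prod.fst) (𝓝 (toPointwiseGroup G M g₀)) :=
    PointwiseGroup.tendsto_iff.2 hg₀
  have h6 := h5 (hopen.image_mem_nhds hs)
  refine mem_of_superset h6 ?_
  rintro p ⟨q, hq, hqp⟩
  exact (toPointwiseGroup G M).injective hqp ▸ hq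

end Isometric

/-! ### Local isometries between Riemannian metrics on open subsets of a vector space -/

section LocalIsometry

variable {E : Type*} [NormedAddCommGroup E] [NormedSpace ℝ E]

/-- A Riemannian metric on an open subset of a vector space. -/
structure IsMetricOn (g : E → E →L[ℝ] E →L[ℝ] ℝ) (U : Set E) : Prop where
  isOpen : IsOpen U
  contDiffOn : ContDiffOn ℝ ∞ g U
  symm : ∀ x ∈ U, ∀ v w, g x v w = g x w v
  pos : ∀ x ∈ U, ∀ v, v ≠ 0 → 0 < g x v v

/-- A smooth map `F` on an open set `W ⊆ U` which pulls back the metric `g'` on `U'` to `g`. -/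
structure IsIsometryOn (g g' : E → E →L[ℝ] E →L[ℝ] ℝ) (U' : Set E) (F : E → E) (W : Set E) :
    Prop where
  contDiffOn : ContDiffOn ℝ ∞ F W
  mapsTo : MapsTo F W U'
  pullback : ∀ x ∈ W, ∀ v w, g' (F x) (fderiv ℝ F x v) (fderiv ℝ F x w) = g x v w

theorem IsMetricOn.eq_of_forall {g : E → E →L[ℝ] E →L[ℝ] ℝ} {U : Set E} (hg : IsMetricOn g U)
    {x : E} (hx : x ∈ U) {v w : E} (h : ∀ z, g x v z = g x w z) : v = w := by
  by_contra hne
  have h1 := hg.pos x hx (v - w) (sub_ne_zero.2 hne)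
  have h2 : g x v = g x w := ContinuousLinearMap.ext h
  rw [map_sub (g x), h2, sub_self] at h1
  exact h1.false

variable [FiniteDimensional ℝ E]

theorem IsMetricOn.exists_equiv {g : E → E →L[ℝ] E →L[ℝ] ℝ} {U : Set E} (hg : IsMetricOn g U)
    {x : E} (hx : x ∈ U) : ∃ e : E ≃L[ℝ] (E →L[ℝ] ℝ), (e : E →L[ℝ] E →L[ℝ] ℝ) = g x := by
  have hinj : Function.Injective (g x).toLinearMap := fun v w h =>
    hg.eq_of_forall hx fun z => congrArg (fun ℓ : E →L[ℝ] ℝ => ℓ z) h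
  have hdim : Module.finrank ℝ E = Module.finrank ℝ (E →L[ℝ] ℝ) := by
    rw [← (LinearMap.toContinuousLinearMap (𝕜 := ℝ) (E := E) (F' := ℝ)).finrank_eq]
    exact (Subspace.dual_finrank_eq (K := ℝ) (V := E)).symm
  exact ⟨((g x).toLinearMap.linearEquivOfInjective hinj hdim).toContinuousLinearEquiv, rfl⟩

theorem IsMetricOn.contDiffOn_inverse {g : E → E →L[ℝ] E →L[ℝ] ℝ} {U : Set E}
    (hg : IsMetricOn g U) : ContDiffOn ℝ ∞ (fun x => (g x).inverse) U := by
  have : CompleteSpace E := FiniteDimensional.complete ℝ E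
  intro x hx
  obtain ⟨e, he⟩ := hg.exists_equiv hx
  have h1 := contDiffAt_map_inverse (n := ∞) e
  rw [he] at h1
  exact h1.comp_contDiffWithinAt x (hg.contDiffOn x hx)

variable {g g' : E → E →L[ℝ] E →L[ℝ] ℝ} {U U' W : Set E} {F : E → E}

theorem IsIsometryOn.surjective_fderiv (hg : IsMetricOn g U) (hF : IsIsometryOn g g' U' F W)
    (hWU : W ⊆ U) {x : E} (hx : x ∈ W) : Function.Surjective (fderiv ℝ F x) := by
  have hinj : Function.Injective (fderiv ℝ F x).toLinearMap := fun v w h =>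
    hg.eq_of_forall (hWU hx) fun z => by
      have h' : fderiv ℝ F x v = fderiv ℝ F x w := h
      rw [← hF.pullback x hx, h', hF.pullback x hx]
  exact LinearMap.injective_iff_surjective.1 hinj

/-- The defect of the first derivatives of two metrics under a linear map. -/
def metricDefect (g g' : E → E →L[ℝ] E →L[ℝ] ℝ) (p : E × E × (E →L[ℝ] E)) (u v w : E) : ℝ :=
  fderiv ℝ g p.1 u v w - fderiv ℝ g' p.2.1 (p.2.2 u) (p.2.2 v) (p.2.2 w)

/-- Obtained by differentiating the pullback identity in the direction `u`; the terms without second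
derivatives of `F` make up the defect. -/
theorem IsIsometryOn.metricDefect_eq (hg : IsMetricOn g U) (hg' : IsMetricOn g' U')
    (hF : IsIsometryOn g g' U' F W) (hW : IsOpen W) (hWU : W ⊆ U) {x : E} (hx : x ∈ W)
    (u v w : E) :
    metricDefect g g' (x, F x, fderiv ℝ F x) u v w =
      g' (F x) (fderiv ℝ (fderiv ℝ F) x u v) (fderiv ℝ F x w) +
        g' (F x) (fderiv ℝ (fderiv ℝ F) x u w) (fderiv ℝ F x v) := by
  have hFd : HasFDerivAt F (fderiv ℝ F x) x :=
    ((hF.contDiffOn.contDiffAt (hW.mem_nhds hx)).differentiableAt (by simp)).hasFDerivAt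
  have hFdd : HasFDerivAt (fderiv ℝ F) (fderiv ℝ (fderiv ℝ F) x) x :=
    (((hF.contDiffOn.fderiv_of_isOpen hW (m := ∞) (by simp)).contDiffAt
      (hW.mem_nhds hx)).differentiableAt (by simp)).hasFDerivAt
  have hgd : HasFDerivAt g (fderiv ℝ g x) x := ((hg.contDiffOn.contDiffAt
    (hg.isOpen.mem_nhds (hWU hx))).differentiableAt (by simp)).hasFDerivAt
  have hgd' : HasFDerivAt g' (fderiv ℝ g' (F x)) (F x) := ((hg'.contDiffOn.contDiffAt
    (hg'.isOpen.mem_nhds (hF.mapsTo hx))).differentiableAt (by simp)).hasFDerivAt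
  have h1 := ((hgd'.comp x hFd).clm_apply (hFdd.clm_apply (hasFDerivAt_const v x))).clm_apply
    (hFdd.clm_apply (hasFDerivAt_const w x))
  have h2 := (hgd.clm_apply (hasFDerivAt_const v x)).clm_apply (hasFDerivAt_const w x)
  have h3 := h2.unique (h1.congr_of_eventuallyEq (by
    filter_upwards [hW.mem_nhds hx] with y hy using (hF.pullback y hy v w).symm))
  have h4 := congrArg (fun ℓ : E →L[ℝ] ℝ => ℓ u) h3
  simp at h4
  rw [hg'.symm _ (hF.mapsTo hx) (fderiv ℝ (fderiv ℝ F) x u w)]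
  simp only [metricDefect]
  linarith

/-- The Koszul formula for local isometries. -/
theorem IsIsometryOn.koszul (hg : IsMetricOn g U) (hg' : IsMetricOn g' U')
    (hF : IsIsometryOn g g' U' F W) (hW : IsOpen W) (hWU : W ⊆ U) {x : E} (hx : x ∈ W)
    (u v w : E) :
    g' (F x) (fderiv ℝ (fderiv ℝ F) x u v) (fderiv ℝ F x w) =
      (metricDefect g g' (x, F x, fderiv ℝ F x) u v w
        + metricDefect g g' (x, F x, fderiv ℝ F x) v u w
        - metricDefect g g' (x, F x, fderiv ℝ F x) w u v) / 2 := by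
  -- By symmetry of the second derivative, four of the six terms in the alternating sum cancel in
  -- pairs and the other two agree.
  have hs : IsSymmSndFDerivAt ℝ F x :=
    (hF.contDiffOn.contDiffAt (hW.mem_nhds hx)).isSymmSndFDerivAt
      (by simpa using ENat.LEInfty.out)
  simp only [hF.metricDefect_eq hg hg' hW hWU hx]
  rw [hs.eq v u, hs.eq w u, hs.eq w v]
  ring

/-- The linear map with prescribed values on a basis. -/
theorem sum_smulRight_coord_apply {ι F : Type*} [Fintype ι] [NormedAddCommGroup F]
    [NormedSpace ℝ F] (b : Module.Basis ι ℝ E) (f : ι → F) (i : ι) :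
    (∑ j, (LinearMap.toContinuousLinearMap (b.coord j)).smulRight (f j)) (b i) = f i := by
  classical
  simp [sum_apply, Finsupp.single_apply, ite_smul]

/-- The right hand side of the second order equation for local isometries. -/
def isometryRHS (g g' : E → E →L[ℝ] E →L[ℝ] ℝ) (p : E × E × (E →L[ℝ] E)) : E →L[ℝ] E →L[ℝ] E :=
  ∑ i, (LinearMap.toContinuousLinearMap ((Module.finBasis ℝ E).coord i)).smulRight
    (∑ j, (LinearMap.toContinuousLinearMap ((Module.finBasis ℝ E).coord j)).smulRight
      (p.2.2 ((g p.1).inverse (∑ k,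
        (LinearMap.toContinuousLinearMap ((Module.finBasis ℝ E).coord k)).smulRight
    ((metricDefect g g' p (Module.finBasis ℝ E i) (Module.finBasis ℝ E j) (Module.finBasis ℝ E k)
      + metricDefect g g' p (Module.finBasis ℝ E j) (Module.finBasis ℝ E i) (Module.finBasis ℝ E k)
      - metricDefect g g' p (Module.finBasis ℝ E k) (Module.finBasis ℝ E i)
        (Module.finBasis ℝ E j)) / 2)))))

theorem contDiffOn_metricDefect (hg : IsMetricOn g U) (hg' : IsMetricOn g' U') (u v w : E) :
    ContDiffOn ℝ ∞ (fun p => metricDefect g g' p u v w) (U ×ˢ U' ×ˢ univ) := by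
  have h1 : ContDiffOn ℝ ∞ (fun p : E × E × (E →L[ℝ] E) => fderiv ℝ g p.1) (U ×ˢ U' ×ˢ univ) :=
    (hg.contDiffOn.fderiv_of_isOpen hg.isOpen (by simp)).comp contDiffOn_fst fun p hp => hp.1
  have h2 : ContDiffOn ℝ ∞ (fun p : E × E × (E →L[ℝ] E) => fderiv ℝ g' p.2.1)
      (U ×ˢ U' ×ˢ univ) :=
    (hg'.contDiffOn.fderiv_of_isOpen hg'.isOpen (by simp)).comp (by fun_prop) fun p hp => hp.2.1
  unfold metricDefect
  fun_prop

theorem contDiffOn_isometryRHS (hg : IsMetricOn g U) (hg' : IsMetricOn g' U') :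
    ContDiffOn ℝ ∞ (isometryRHS g g') (U ×ˢ U' ×ˢ univ) := by
  have h1 := fun u v w => contDiffOn_metricDefect hg hg' u v w
  have h2 : ContDiffOn ℝ ∞ (fun p : E × E × (E →L[ℝ] E) => (g p.1).inverse)
      (U ×ˢ U' ×ˢ univ) :=
    hg.contDiffOn_inverse.comp contDiffOn_fst fun p hp => hp.1
  unfold isometryRHS
  refine ContDiffOn.sum fun i _ => contDiffOn_const.smulRight (ContDiffOn.sum fun j _ =>
    contDiffOn_const.smulRight ((by fun_prop : ContDiffOn ℝ ∞ (fun p : E × E × (E →L[ℝ] E) => p.2.2)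
      _).clm_apply (h2.clm_apply (ContDiffOn.sum fun k _ => contDiffOn_const.smulRight
        ((((h1 _ _ _).add (h1 _ _ _)).sub (h1 _ _ _)).div_const 2)))))

/-- Write `D²F(u, v) = DF(z)`, possible since `DF` is onto. The Koszul formula and the pullback
identity give `g(z, ·)` in terms of the `1`-jet, and `g⁻¹` recovers `z`. Working on a basis makes
`isometryRHS` visibly smooth. -/
theorem IsIsometryOn.fderiv_fderiv (hg : IsMetricOn g U) (hg' : IsMetricOn g' U')
    (hF : IsIsometryOn g g' U' F W) (hW : IsOpen W) (hWU : W ⊆ U) {x : E} (hx : x ∈ W) :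
    fderiv ℝ (fderiv ℝ F) x = isometryRHS g g' (x, F x, fderiv ℝ F x) := by
  have key : ∀ i j, fderiv ℝ (fderiv ℝ F) x (Module.finBasis ℝ E i) (Module.finBasis ℝ E j) =
      isometryRHS g g' (x, F x, fderiv ℝ F x) (Module.finBasis ℝ E i) (Module.finBasis ℝ E j) := by
    intro i j
    obtain ⟨z, hz⟩ := hF.surjective_fderiv hg hWU hx
      (fderiv ℝ (fderiv ℝ F) x (Module.finBasis ℝ E i) (Module.finBasis ℝ E j))
    obtain ⟨e, he⟩ := hg.exists_equiv (hWU hx)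
    have h3 : (g x).inverse (g x z) = z := by
      rw [← he, ContinuousLinearMap.inverse_equiv]
      exact e.symm_apply_apply z
    rw [isometryRHS, sum_smulRight_coord_apply, sum_smulRight_coord_apply, ← hz]
    dsimp only
    nth_rw 1 [← h3]
    congr 2
    refine ContinuousLinearMap.coe_injective ((Module.finBasis ℝ E).ext fun k => ?_)
    rw [ContinuousLinearMap.coe_coe, ContinuousLinearMap.coe_coe, sum_smulRight_coord_apply,
      ← hF.pullback x hx, hz, hF.koszul hg hg' hW hWU hx]
  refine ContinuousLinearMap.coe_injective ((Module.finBasis ℝ E).ext fun i => ?_)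
  exact ContinuousLinearMap.coe_injective ((Module.finBasis ℝ E).ext fun j => key i j)

theorem _root_.ContDiffOn.clm_prod {X A B C : Type*} [NormedAddCommGroup X] [NormedSpace ℝ X]
    [NormedAddCommGroup A] [NormedSpace ℝ A] [NormedAddCommGroup B] [NormedSpace ℝ B]
    [NormedAddCommGroup C] [NormedSpace ℝ C] {f : X → A →L[ℝ] B} {h : X → A →L[ℝ] C} {s : Set X}
    {n : ℕ∞ω} (hf : ContDiffOn ℝ n f s) (hh : ContDiffOn ℝ n h s) :
    ContDiffOn ℝ n (fun x => (f x).prod (h x)) s := by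
  have h1 := (contDiffOn_const (c := ContinuousLinearMap.inl ℝ B C)).clm_comp hf |>.add
    ((contDiffOn_const (c := ContinuousLinearMap.inr ℝ B C)).clm_comp hh)
  refine h1.congr fun x _ => ?_
  ext v <;> simp

/-- The derivatives of a local isometry are universal smooth functions of its `1`-jet. -/
theorem exists_iteratedFDeriv_isometry_eq (hg : IsMetricOn g U) (hg' : IsMetricOn g' U') (k : ℕ) :
    ∃ Ψ : E × E × (E →L[ℝ] E) → E [×k]→L[ℝ] E, ContDiffOn ℝ ∞ Ψ (U ×ˢ U' ×ˢ univ) ∧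
      ∀ (F : E → E) (W : Set E), IsOpen W → W ⊆ U → IsIsometryOn g g' U' F W →
        ∀ x ∈ W, iteratedFDeriv ℝ k F x = Ψ (x, F x, fderiv ℝ F x) := by
  have hO : IsOpen (U ×ˢ U' ×ˢ (univ : Set (E →L[ℝ] E))) :=
    hg.isOpen.prod (hg'.isOpen.prod isOpen_univ)
  induction k with
  | zero =>
    exact ⟨fun p => (continuousMultilinearCurryFin0 ℝ E E).symm p.2.1,
      (LinearIsometryEquiv.contDiff _).comp_contDiffOn (by fun_prop), fun _ _ _ _ _ _ _ => rfl⟩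
  | succ k ih =>
    obtain ⟨Ψ, hΨ, h⟩ := ih
    -- Chain rule along the jet `x ↦ (x, F x, DF x)`, whose derivative is `(id, DF, D²F)`, with
    -- `D²F` replaced by `isometryRHS`.
    refine ⟨fun p => (continuousMultilinearCurryLeftEquiv ℝ (fun _ : Fin (k + 1) => E) E).symm
      ((fderiv ℝ Ψ p).comp ((ContinuousLinearMap.id ℝ E).prod
        (p.2.2.prod (isometryRHS g g' p)))), ?_, fun F W hW hWU hF x hx => ?_⟩
    · refine (LinearIsometryEquiv.contDiff _).comp_contDiffOn
        ((hΨ.fderiv_of_isOpen hO (by simp)).clm_comp ?_)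
      exact contDiffOn_const.clm_prod ((by fun_prop : ContDiffOn ℝ ∞
        (fun p : E × E × (E →L[ℝ] E) => p.2.2) _).clm_prod (contDiffOn_isometryRHS hg hg'))
    · rw [iteratedFDeriv_succ_eq_comp_left, Function.comp_apply]
      congr 1
      have hFd : HasFDerivAt F (fderiv ℝ F x) x :=
        ((hF.contDiffOn.contDiffAt (hW.mem_nhds hx)).differentiableAt (by simp)).hasFDerivAt
      have hFdd : HasFDerivAt (fderiv ℝ F) (fderiv ℝ (fderiv ℝ F) x) x :=
        (((hF.contDiffOn.fderiv_of_isOpen hW (m := ∞) (by simp)).contDiffAt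
          (hW.mem_nhds hx)).differentiableAt (by simp)).hasFDerivAt
      have hΨd : HasFDerivAt Ψ (fderiv ℝ Ψ (x, F x, fderiv ℝ F x)) (x, F x, fderiv ℝ F x) :=
        ((hΨ.contDiffAt (hO.mem_nhds ⟨hWU hx, hF.mapsTo hx, mem_univ _⟩)).differentiableAt
          (by simp)).hasFDerivAt
      have h2 := hΨd.comp x ((hasFDerivAt_id x).prodMk (hFd.prodMk hFdd))
      rw [hF.fderiv_fderiv hg hg' hW hWU hx] at h2
      refine HasFDerivAt.fderiv (h2.congr_of_eventuallyEq ?_)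
      filter_upwards [hW.mem_nhds hx] with y hy using h F W hW hWU hF y hy

end LocalIsometry

/-! ### Convergence of local isometries -/

section Convergence

/-- The `f i` need not be continuous: on a product neighbourhood their values lie in a closed set
`N`, and so do the pointwise limits. -/
theorem continuousAt_of_continuous_convergence {ι X Y : Type*} [TopologicalSpace X]
    [TopologicalSpace Y] [RegularSpace Y] {l : Filter ι} [l.NeBot] {f : ι → X → Y} {g : X → Y}
    {W : Set X} (hW : IsOpen W)
    (h : ∀ y ∈ W, Tendsto (fun p : ι × X => f p.1 p.2) (l ×ˢ 𝓝 y) (𝓝 (g y))) {y : X}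
    (hy : y ∈ W) : ContinuousAt g y := by
  refine (closed_nhds_basis (g y)).tendsto_right_iff.2 fun N hN => ?_
  obtain ⟨pa, hpa, pb, hpb, hp⟩ := eventually_prod_iff.1 ((h y hy).eventually hN.1)
  filter_upwards [hpb, hW.mem_nhds hy] with z hz hzW
  have h1 : Tendsto (fun i => f i z) l (𝓝 (g z)) :=
    (h z hzW).comp (tendsto_id.prodMk (tendsto_const_nhds (x := z)))
  exact hN.2.mem_of_tendsto h1 (hpa.mono fun i hi => hp hi hz)

theorem tendstoUniformlyOnFilter_of_continuous_convergence {ι X Y : Type*} [TopologicalSpace X]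
    [UniformSpace Y] {l : Filter ι} [l.NeBot] {f : ι → X → Y} {g : X → Y}
    {W : Set X} (hW : IsOpen W)
    (h : ∀ y ∈ W, Tendsto (fun p : ι × X => f p.1 p.2) (l ×ˢ 𝓝 y) (𝓝 (g y))) {y : X}
    (hy : y ∈ W) : TendstoUniformlyOnFilter f g l (𝓝 y) := by
  have h1 : Tendsto (fun p : ι × X => (g p.2, f p.1 p.2)) (l ×ˢ 𝓝 y) (𝓝 (g y, g y)) :=
    ((continuousAt_of_continuous_convergence hW h hy).tendsto.comp tendsto_snd).prodMk_nhds
      (h y hy)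
  exact fun u hu => h1 (nhds_le_uniformity _ hu)

theorem tendsto_clm_apply {α A B : Type*} [NormedAddCommGroup A] [NormedSpace ℝ A]
    [NormedAddCommGroup B] [NormedSpace ℝ B] {l : Filter α} {f : α → A →L[ℝ] B} {f₀ : A →L[ℝ] B}
    {v : α → A} {v₀ : A} (hf : Tendsto f l (𝓝 f₀)) (hv : Tendsto v l (𝓝 v₀)) :
    Tendsto (fun a => f a (v a)) l (𝓝 (f₀ v₀)) :=
  (isBoundedBilinearMap_apply.continuous.tendsto (f₀, v₀)).comp (hf.prodMk_nhds hv)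

variable {E : Type*} [NormedAddCommGroup E] [NormedSpace ℝ E] [FiniteDimensional ℝ E]
  {g g' : E → E →L[ℝ] E →L[ℝ] ℝ} {U U' : Set E}

theorem IsMetricOn.exists_lower_bound (hg : IsMetricOn g U) {x : E} (hx : x ∈ U) :
    ∃ c > 0, ∀ᶠ y in 𝓝 x, ∀ v, c * ‖v‖ ^ 2 ≤ g y v v := by
  have hP : ProperSpace E := FiniteDimensional.proper ℝ E
  obtain ⟨m, hm, hmv⟩ : ∃ m > 0, ∀ v ∈ Metric.sphere (0 : E) 1, m ≤ g x v v := by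
    rcases (Metric.sphere (0 : E) 1).eq_empty_or_nonempty with h | h
    · exact ⟨1, one_pos, fun v hv => by simp [h] at hv⟩
    · obtain ⟨u, hu, hmin⟩ := (isCompact_sphere (0 : E) 1).exists_isMinOn h
        (f := fun v => g x v v) (by fun_prop)
      refine ⟨g x u u, hg.pos x hx u fun h0 => ?_, fun v hv => hmin hv⟩
      simp [h0] at hu
  have hscale : ∀ v, m * ‖v‖ ^ 2 ≤ g x v v := fun v => by
    rcases eq_or_ne v 0 with rfl | hv
    · simp
    · have h1 := hmv (‖v‖⁻¹ • v) (by simp [norm_smul, hv])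
      have hv' : 0 < ‖v‖ := norm_pos_iff.2 hv
      simp only [map_smul, FunLike.coe_smul, Pi.smul_apply, smul_eq_mul] at h1
      calc m * ‖v‖ ^ 2 ≤ (‖v‖⁻¹ * (‖v‖⁻¹ * g x v v)) * ‖v‖ ^ 2 := by gcongr
        _ = g x v v := by field_simp
  have hcont : ContinuousAt g x := (hg.contDiffOn.contDiffAt (hg.isOpen.mem_nhds hx)).continuousAt
  refine ⟨m / 2, half_pos hm, ?_⟩
  filter_upwards [hcont.eventually_mem (Metric.ball_mem_nhds _ (half_pos hm))] with y hy v
  have h1 : ‖(g y - g x) v v‖ ≤ m / 2 * ‖v‖ * ‖v‖ :=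
    ((g y - g x).le_opNorm₂ v v).trans (by
      have := (mem_ball_iff_norm.1 hy).le
      gcongr)
  have h2 : (g y - g x) v v = g y v v - g x v v := rfl
  have h3 := (abs_le.1 (Real.norm_eq_abs _ ▸ h1)).1
  rw [h2] at h3
  nlinarith [hscale v]

variable {ι : Type*} {𝒰 : Ultrafilter ι} {F : ι → E → E} {H : E → E} {W : Set E}

/-- From `c‖DF v‖² ≤ g'(DF v, DF v) = g(v, v) ≤ (‖g y‖ + 1)‖v‖²`, with bounds uniform near `y` and
near `H y`. -/
theorem exists_bound_fderiv_isometry {𝒰 : Filter ι} (hg : IsMetricOn g U) (hg' : IsMetricOn g' U')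
    (hW : IsOpen W) (hWU : W ⊆ U) (hF : ∀ᶠ i in 𝒰, IsIsometryOn g g' U' (F i) W)
    (hH : ∀ y ∈ W, Tendsto (fun p : ι × E => F p.1 p.2) (𝒰 ×ˢ 𝓝 y) (𝓝 (H y)))
    (hHU : MapsTo H W U') {y : E} (hy : y ∈ W) :
    ∃ C, ∀ᶠ p in 𝒰 ×ˢ 𝓝 y, ‖fderiv ℝ (F p.1) p.2‖ ≤ C := by
  obtain ⟨c, hc, hcg⟩ := hg'.exists_lower_bound (hHU hy)
  have hcont : ContinuousAt g y :=
    (hg.contDiffOn.contDiffAt (hg.isOpen.mem_nhds (hWU hy))).continuousAt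
  have h1 : ∀ᶠ z in 𝓝 y, ‖g z‖ < ‖g y‖ + 1 := hcont.norm.eventually_lt_const (lt_add_one _)
  refine ⟨√((‖g y‖ + 1) / c), ?_⟩
  filter_upwards [(hH y hy).eventually hcg, tendsto_snd.eventually h1,
    tendsto_snd.eventually (hW.mem_nhds hy), tendsto_fst.eventually hF] with p hp1 hp2 hp3 hp4
  refine ContinuousLinearMap.opNorm_le_bound _ (Real.sqrt_nonneg _) fun v => ?_
  have h2 := hp1 (fderiv ℝ (F p.1) p.2 v)
  rw [hp4.pullback _ hp3] at h2
  have h3 : g p.2 v v ≤ (‖g y‖ + 1) * ‖v‖ * ‖v‖ :=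
    (le_abs_self _).trans (((g p.2).le_opNorm₂ v v).trans (by gcongr))
  have h4 : ‖fderiv ℝ (F p.1) p.2 v‖ ^ 2 ≤ (√((‖g y‖ + 1) / c) * ‖v‖) ^ 2 := by
    rw [mul_pow, Real.sq_sqrt (by positivity), div_mul_eq_mul_div, le_div_iff₀ hc]
    nlinarith
  exact (pow_le_pow_iff_left₀ (norm_nonneg _) (by positivity) two_ne_zero).1 h4

/-- The `1`-jets remain in a compact set, where the continuous map `isometryRHS` bounds the second
derivatives. -/
theorem exists_lipschitz_fderiv_isometry {𝒰 : Filter ι} (hg : IsMetricOn g U)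
    (hg' : IsMetricOn g' U')
    (hW : IsOpen W) (hWU : W ⊆ U) (hF : ∀ᶠ i in 𝒰, IsIsometryOn g g' U' (F i) W)
    (hH : ∀ y ∈ W, Tendsto (fun p : ι × E => F p.1 p.2) (𝒰 ×ˢ 𝓝 y) (𝓝 (H y)))
    (hHU : MapsTo H W U') {y : E} (hy : y ∈ W) :
    ∃ C, ∀ᶠ p in 𝒰 ×ˢ 𝓝 y, ‖fderiv ℝ (F p.1) p.2 - fderiv ℝ (F p.1) y‖ ≤ C * ‖p.2 - y‖ := by
  have hP : ProperSpace E := FiniteDimensional.proper ℝ E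
  have hP' : ProperSpace (E →L[ℝ] E) := FiniteDimensional.proper ℝ _
  obtain ⟨C, hC⟩ := exists_bound_fderiv_isometry hg hg' hW hWU hF hH hHU hy
  obtain ⟨K₁, hK₁, hyK₁, hK₁W⟩ := exists_compact_subset hW hy
  obtain ⟨K₂, hK₂, hyK₂, hK₂U⟩ := exists_compact_subset hg'.isOpen (hHU hy)
  obtain ⟨D, hD⟩ := (hK₁.prod (hK₂.prod (isCompact_closedBall (0 : E →L[ℝ] E) C))
    ).exists_bound_of_continuousOn ((contDiffOn_isometryRHS hg hg').continuousOn.mono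
      (prod_mono (hK₁W.trans hWU) (prod_mono hK₂U (subset_univ _))))
  have h1 : ∀ᶠ p in 𝒰 ×ˢ 𝓝 y, IsIsometryOn g g' U' (F p.1) W ∧ p.2 ∈ W ∧
      ‖fderiv ℝ (fderiv ℝ (F p.1)) p.2‖ ≤ D := by
    filter_upwards [hC, (hH y hy).eventually (mem_interior_iff_mem_nhds.1 hyK₂),
      tendsto_snd.eventually (mem_interior_iff_mem_nhds.1 hyK₁), tendsto_fst.eventually hF]
      with p hp1 hp2 hp3 hp4
    refine ⟨hp4, hK₁W hp3, ?_⟩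
    rw [hp4.fderiv_fderiv hg hg' hW hWU (hK₁W hp3)]
    exact hD _ ⟨hp3, hp2, by simpa using hp1⟩
  obtain ⟨pa, hpa, pb, hpb, hp⟩ := eventually_prod_iff.1 h1
  obtain ⟨r, hr, hrb⟩ := Metric.eventually_nhds_iff_ball.1 hpb
  refine ⟨D, ?_⟩
  filter_upwards [tendsto_fst.eventually hpa, tendsto_snd.eventually (Metric.ball_mem_nhds y hr)]
    with p hp1 hp2
  refine Convex.norm_image_sub_le_of_norm_fderiv_le (𝕜 := ℝ) (f := fderiv ℝ (F p.1))
    (fun z hz => ?_) (fun z hz => (hp hp1 (hrb z hz)).2.2) (convex_ball y r)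
    (Metric.mem_ball_self hr) hp2
  obtain ⟨h2, h3, -⟩ := hp hp1 (hrb z hz)
  exact ((h2.contDiffOn.fderiv_of_isOpen hW (m := ∞) (by simp)).contDiffAt
    (hW.mem_nhds h3)).differentiableAt (by simp)

/-- At `y` itself the bounded derivatives converge along the ultrafilter; the uniform Lipschitz
estimate extends this to points tending to `y`. -/
theorem exists_tendsto_fderiv_isometry (hg : IsMetricOn g U) (hg' : IsMetricOn g' U')
    (hW : IsOpen W) (hWU : W ⊆ U) (hF : ∀ᶠ i in (𝒰 : Filter ι), IsIsometryOn g g' U' (F i) W)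
    (hH : ∀ y ∈ W, Tendsto (fun p : ι × E => F p.1 p.2) (𝒰 ×ˢ 𝓝 y) (𝓝 (H y)))
    (hHU : MapsTo H W U') {y : E} (hy : y ∈ W) :
    ∃ L, Tendsto (fun p : ι × E => fderiv ℝ (F p.1) p.2) (𝒰 ×ˢ 𝓝 y) (𝓝 L) := by
  have hP' : ProperSpace (E →L[ℝ] E) := FiniteDimensional.proper ℝ _
  obtain ⟨C, hC⟩ := exists_bound_fderiv_isometry hg hg' hW hWU hF hH hHU hy
  obtain ⟨D, hD⟩ := exists_lipschitz_fderiv_isometry hg hg' hW hWU hF hH hHU hy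
  have h1 : ∀ᶠ i in (𝒰 : Filter ι), fderiv ℝ (F i) y ∈ Metric.closedBall (0 : E →L[ℝ] E) C :=
    ((tendsto_id.prodMk (tendsto_const_nhds (x := y))).eventually hC).mono fun i hi => by
      simpa using hi
  obtain ⟨L, -, hL⟩ := (isCompact_closedBall (0 : E →L[ℝ] E) C).ultrafilter_le_nhds
    (𝒰.map fun i => fderiv ℝ (F i) y) (le_principal_iff.2 h1)
  have hL' : Tendsto (fun i => fderiv ℝ (F i) y) 𝒰 (𝓝 L) := hL
  refine ⟨L, ?_⟩
  have h2 : Tendsto (fun p : ι × E => fderiv ℝ (F p.1) p.2 - fderiv ℝ (F p.1) y) (𝒰 ×ˢ 𝓝 y)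
      (𝓝 0) := by
    refine squeeze_zero_norm' hD ?_
    have h3 : Tendsto (fun z : E => D * ‖z - y‖) (𝓝 y) (𝓝 (D * ‖y - y‖)) :=
      (by fun_prop : Continuous fun z : E => D * ‖z - y‖).tendsto y
    rw [sub_self, norm_zero, mul_zero] at h3
    exact h3.comp tendsto_snd
  have h4 := h2.add (hL'.comp (tendsto_fst (f := (𝒰 : Filter ι)) (g := 𝓝 y)))
  rw [zero_add] at h4
  exact h4.congr fun p => sub_add_cancel _ _

/-- A limit of local isometries is a local isometry, and all derivatives converge. -/
theorem isIsometryOn_of_tendsto (hg : IsMetricOn g U) (hg' : IsMetricOn g' U')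
    (hW : IsOpen W) (hWU : W ⊆ U) (hF : ∀ᶠ i in (𝒰 : Filter ι), IsIsometryOn g g' U' (F i) W)
    (hH : ∀ y ∈ W, Tendsto (fun p : ι × E => F p.1 p.2) (𝒰 ×ˢ 𝓝 y) (𝓝 (H y)))
    (hHU : MapsTo H W U') :
    IsIsometryOn g g' U' H W ∧ ∀ y ∈ W, ∀ k : ℕ,
      Tendsto (fun p : ι × E => iteratedFDeriv ℝ k (F p.1) p.2) (𝒰 ×ˢ 𝓝 y)
        (𝓝 (iteratedFDeriv ℝ k H y)) := by
  have hO : IsOpen (U ×ˢ U' ×ˢ (univ : Set (E →L[ℝ] E))) :=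
    hg.isOpen.prod (hg'.isOpen.prod isOpen_univ)
  choose! L hL using fun y (hy : y ∈ W) =>
    exists_tendsto_fderiv_isometry hg hg' hW hWU hF hH hHU hy
  have hJ : ∀ y ∈ W, Tendsto (fun p : ι × E => (p.2, F p.1 p.2, fderiv ℝ (F p.1) p.2))
      (𝒰 ×ˢ 𝓝 y) (𝓝 (y, H y, L y)) := fun y hy =>
    tendsto_snd.prodMk_nhds ((hH y hy).prodMk_nhds (hL y hy))
  have hev : ∀ y ∈ W, ∀ᶠ p in (𝒰 : Filter ι) ×ˢ 𝓝 y,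
      IsIsometryOn g g' U' (F p.1) W ∧ p.2 ∈ W := fun y hy =>
    (tendsto_fst.eventually hF).and (tendsto_snd.eventually (hW.mem_nhds hy))
  have hJ' : ∀ {Y : Type _} [NormedAddCommGroup Y] [NormedSpace ℝ Y]
      {Ψ : E × E × (E →L[ℝ] E) → Y}, ContDiffOn ℝ ∞ Ψ (U ×ˢ U' ×ˢ univ) → ∀ y ∈ W,
      Tendsto (fun p : ι × E => Ψ (p.2, F p.1 p.2, fderiv ℝ (F p.1) p.2))
      (𝒰 ×ˢ 𝓝 y) (𝓝 (Ψ (y, H y, L y))) := fun {_} _ _ _ hΨ y hy =>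
    (hΨ.contDiffAt (hO.mem_nhds ⟨hWU hy, hHU hy, mem_univ _⟩)).continuousAt.tendsto.comp (hJ y hy)
  -- Locally uniform convergence of derivatives allows the limit to be differentiated; the same
  -- argument one order higher treats `L`.
  have hdH : ∀ y ∈ W, HasFDerivAt H (L y) y := fun y hy => by
    refine hasFDerivAt_of_tendstoUniformlyOnFilter (l := (𝒰 : Filter ι)) (f := F)
      (f' := fun i => fderiv ℝ (F i)) (tendstoUniformlyOnFilter_of_continuous_convergence hW hL hy) ?_ ?_
    · filter_upwards [hev y hy] with p hp
      exact ((hp.1.contDiffOn.contDiffAt (hW.mem_nhds hp.2)).differentiableAt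
        (by simp)).hasFDerivAt
    · filter_upwards [hW.mem_nhds hy] with z hz
      exact (hH z hz).comp (tendsto_id.prodMk (tendsto_const_nhds (x := z)))
  have hdL : ∀ y ∈ W, HasFDerivAt L (isometryRHS g g' (y, H y, L y)) y := fun y hy => by
    have hD2 : ∀ y ∈ W, Tendsto (fun p : ι × E => fderiv ℝ (fderiv ℝ (F p.1)) p.2)
        (𝒰 ×ˢ 𝓝 y) (𝓝 (isometryRHS g g' (y, H y, L y))) := fun y hy => by
      refine (hJ' (contDiffOn_isometryRHS hg hg') y hy).congr' ?_
      filter_upwards [hev y hy] with p hp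
      exact (hp.1.fderiv_fderiv hg hg' hW hWU hp.2).symm
    refine hasFDerivAt_of_tendstoUniformlyOnFilter (l := (𝒰 : Filter ι))
      (f := fun i => fderiv ℝ (F i)) (f' := fun i => fderiv ℝ (fderiv ℝ (F i)))
      (tendstoUniformlyOnFilter_of_continuous_convergence hW hD2 hy) ?_ ?_
    · filter_upwards [hev y hy] with p hp
      exact (((hp.1.contDiffOn.fderiv_of_isOpen hW (m := ∞) (by simp)).contDiffAt
        (hW.mem_nhds hp.2)).differentiableAt (by simp)).hasFDerivAt
    · filter_upwards [hW.mem_nhds hy] with z hz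
      exact (hL z hz).comp (tendsto_id.prodMk (tendsto_const_nhds (x := z)))
  -- Bootstrapping: `DH = L` and `DL` is a smooth function of `(y, H, L)`, so each order of
  -- smoothness yields the next.
  have hsm : ∀ n : ℕ, ContDiffOn ℝ n H W ∧ ContDiffOn ℝ n L W := by
    intro n
    induction n with
    | zero =>
      exact ⟨contDiffOn_zero.2 fun y hy => (hdH y hy).continuousAt.continuousWithinAt,
        contDiffOn_zero.2 fun y hy => (hdL y hy).continuousAt.continuousWithinAt⟩
    | succ n ih =>
      rw [Nat.cast_add, Nat.cast_one,
        contDiffOn_succ_iff_hasFDerivWithinAt_of_uniqueDiffOn hW.uniqueDiffOn,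
        contDiffOn_succ_iff_hasFDerivWithinAt_of_uniqueDiffOn hW.uniqueDiffOn]
      refine ⟨⟨by simp, L, ih.2, fun y hy => (hdH y hy).hasFDerivWithinAt⟩, by simp,
        fun y => isometryRHS g g' (y, H y, L y), ?_, fun y hy => (hdL y hy).hasFDerivWithinAt⟩
      exact ((contDiffOn_isometryRHS hg hg').of_le (mod_cast le_top)).comp
        (contDiffOn_id.prodMk (ih.1.prodMk ih.2)) fun y hy => ⟨hWU hy, hHU hy, mem_univ _⟩
  have hiso : IsIsometryOn g g' U' H W := by
    refine ⟨contDiffOn_infty.2 fun n => (hsm n).1, hHU, fun y hy v w => ?_⟩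
    rw [(hdH y hy).fderiv]
    have h1 : Tendsto (fun i => g' (F i y) (fderiv ℝ (F i) y v) (fderiv ℝ (F i) y w)) 𝒰
        (𝓝 (g' (H y) (L y v) (L y w))) := by
      have h2 : Tendsto (fun i => F i y) 𝒰 (𝓝 (H y)) :=
        (hH y hy).comp (tendsto_id.prodMk (tendsto_const_nhds (x := y)))
      have h3 : Tendsto (fun i => fderiv ℝ (F i) y) 𝒰 (𝓝 (L y)) :=
        (hL y hy).comp (tendsto_id.prodMk (tendsto_const_nhds (x := y)))
      have h4 : Tendsto (fun i => g' (F i y)) 𝒰 (𝓝 (g' (H y))) :=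
        (hg'.contDiffOn.contDiffAt (hg'.isOpen.mem_nhds (hHU hy))).continuousAt.tendsto.comp h2
      exact tendsto_clm_apply (tendsto_clm_apply h4 (tendsto_clm_apply h3 tendsto_const_nhds))
        (tendsto_clm_apply h3 tendsto_const_nhds)
    refine tendsto_nhds_unique (h1.congr' ?_) tendsto_const_nhds
    filter_upwards [hF] with i hi using hi.pullback y hy v w
  refine ⟨hiso, fun y hy k => ?_⟩
  obtain ⟨Ψ, hΨ, h⟩ := exists_iteratedFDeriv_isometry_eq hg hg' k
  rw [h H W hW hWU hiso y hy, (hdH y hy).fderiv]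
  refine (hJ' hΨ y hy).congr' ?_
  filter_upwards [hev y hy] with p hp
  exact (h _ W hW hWU hp.1 _ hp.2).symm

end Convergence

/-! ### Smooth metrics on manifolds -/

section SmoothMetric

variable {E : Type*} [NormedAddCommGroup E] [NormedSpace ℝ E]
  {M : Type*} [TopologicalSpace M] [ChartedSpace E M]

/-- The coordinate expression of a field of bilinear forms in a chart. -/
def chartMetric (B : M → E →L[ℝ] E →L[ℝ] ℝ) (e : OpenPartialHomeomorph M E) (y : E) :
    E →L[ℝ] E →L[ℝ] ℝ :=
  (B (e.symm y)).bilinearComp (mfderiv 𝓘(ℝ, E) 𝓘(ℝ, E) e.symm y : E →L[ℝ] E)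
    (mfderiv 𝓘(ℝ, E) 𝓘(ℝ, E) e.symm y : E →L[ℝ] E)

/-- A smooth Riemannian metric on `M`, described in charts. -/
def IsSmoothMetric (B : M → E →L[ℝ] E →L[ℝ] ℝ) : Prop :=
  ∀ e ∈ IsManifold.maximalAtlas 𝓘(ℝ, E) ∞ M, IsMetricOn (chartMetric B e) e.target

theorem mdifferentiable_of_mem_maximalAtlas {e : OpenPartialHomeomorph M E}
    (he : e ∈ IsManifold.maximalAtlas 𝓘(ℝ, E) ∞ M) : e.MDifferentiable 𝓘(ℝ, E) 𝓘(ℝ, E) :=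
  ⟨(contMDiffOn_of_mem_maximalAtlas he).mdifferentiableOn (by simp),
    (contMDiffOn_symm_of_mem_maximalAtlas he).mdifferentiableOn (by simp)⟩

theorem mfderiv_symm_mfderiv {e : OpenPartialHomeomorph M E}
    (he : e ∈ IsManifold.maximalAtlas 𝓘(ℝ, E) ∞ M) {x : M} (hx : x ∈ e.source) (v : E) :
    mfderiv 𝓘(ℝ, E) 𝓘(ℝ, E) e.symm (e x) (mfderiv 𝓘(ℝ, E) 𝓘(ℝ, E) e x v : E) = v :=
  DFunLike.congr_fun ((mdifferentiable_of_mem_maximalAtlas he).symm_comp_deriv hx) v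

theorem mfderiv_mfderiv_symm {e : OpenPartialHomeomorph M E}
    (he : e ∈ IsManifold.maximalAtlas 𝓘(ℝ, E) ∞ M) {y : E} (hy : y ∈ e.target) (v : E) :
    mfderiv 𝓘(ℝ, E) 𝓘(ℝ, E) e (e.symm y) (mfderiv 𝓘(ℝ, E) 𝓘(ℝ, E) e.symm y v : E) = v :=
  DFunLike.congr_fun ((mdifferentiable_of_mem_maximalAtlas he).comp_symm_deriv hy) v

theorem chartMetric_apply_mfderiv (B : M → E →L[ℝ] E →L[ℝ] ℝ) {e : OpenPartialHomeomorph M E}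
    (he : e ∈ IsManifold.maximalAtlas 𝓘(ℝ, E) ∞ M) {x : M} (hx : x ∈ e.source) (v w : E) :
    chartMetric B e (e x) (mfderiv 𝓘(ℝ, E) 𝓘(ℝ, E) e x v)
      (mfderiv 𝓘(ℝ, E) 𝓘(ℝ, E) e x w) = B x v w := by
  change B (e.symm (e x)) (mfderiv 𝓘(ℝ, E) 𝓘(ℝ, E) e.symm (e x)
    (mfderiv 𝓘(ℝ, E) 𝓘(ℝ, E) e x v : E)) (mfderiv 𝓘(ℝ, E) 𝓘(ℝ, E) e.symm (e x)
    (mfderiv 𝓘(ℝ, E) 𝓘(ℝ, E) e x w : E)) = B x v w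
  have h1 := mfderiv_symm_mfderiv he hx v
  have h2 := mfderiv_symm_mfderiv he hx w
  calc _ = B (e.symm (e x)) v w := congrArg₂ (fun a b : E => B (e.symm (e x)) a b) h1 h2
    _ = _ := by rw [e.left_inv hx]

theorem fderiv_chart_comp {f : M → M} {φ ψ : OpenPartialHomeomorph M E}
    (hφ : φ ∈ IsManifold.maximalAtlas 𝓘(ℝ, E) ∞ M) (hψ : ψ ∈ IsManifold.maximalAtlas 𝓘(ℝ, E) ∞ M)
    {y : E} (hy : y ∈ φ.target) (hfy : f (φ.symm y) ∈ ψ.source)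
    (hf : MDifferentiableAt 𝓘(ℝ, E) 𝓘(ℝ, E) f (φ.symm y)) :
    fderiv ℝ (fun y => ψ (f (φ.symm y))) y =
      ((mfderiv 𝓘(ℝ, E) 𝓘(ℝ, E) ψ (f (φ.symm y))).comp
        ((mfderiv 𝓘(ℝ, E) 𝓘(ℝ, E) f (φ.symm y)).comp
          (mfderiv 𝓘(ℝ, E) 𝓘(ℝ, E) φ.symm y)) : E →L[ℝ] E) := by
  have h1 := (mdifferentiable_of_mem_maximalAtlas hφ).mdifferentiableAt_symm hy
  have h3 := (mdifferentiable_of_mem_maximalAtlas hψ).mdifferentiableAt hfy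
  rw [← mfderiv_eq_fderiv]
  exact (mfderiv_comp (I' := 𝓘(ℝ, E)) y h3 (hf.comp y h1)).trans
    (congrArg _ (mfderiv_comp y hf h1))

theorem isIsometryOn_of_pullback {B : M → E →L[ℝ] E →L[ℝ] ℝ} {f : M → M}
    (hf : ContMDiff 𝓘(ℝ, E) 𝓘(ℝ, E) ∞ f)
    (hinv : ∀ (x : M) (v w : E), B (f x) (mfderiv 𝓘(ℝ, E) 𝓘(ℝ, E) f x v)
      (mfderiv 𝓘(ℝ, E) 𝓘(ℝ, E) f x w) = B x v w)
    {φ ψ : OpenPartialHomeomorph M E} (hφ : φ ∈ IsManifold.maximalAtlas 𝓘(ℝ, E) ∞ M)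
    (hψ : ψ ∈ IsManifold.maximalAtlas 𝓘(ℝ, E) ∞ M) {W : Set E}
    (hWφ : W ⊆ φ.target) (hWψ : ∀ y ∈ W, f (φ.symm y) ∈ ψ.source) :
    IsIsometryOn (chartMetric B φ) (chartMetric B ψ) ψ.target (fun y => ψ (f (φ.symm y))) W where
  contDiffOn := by
    rw [← contMDiffOn_iff_contDiffOn]
    exact (contMDiffOn_of_mem_maximalAtlas hψ).comp (hf.comp_contMDiffOn
      ((contMDiffOn_symm_of_mem_maximalAtlas hφ).mono hWφ)) hWψ
  mapsTo y hy := ψ.map_source (hWψ y hy)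
  pullback y hy v w := by
    rw [fderiv_chart_comp hφ hψ (hWφ hy) (hWψ y hy) (hf.mdifferentiableAt (by simp))]
    exact (chartMetric_apply_mfderiv B hψ (hWψ y hy) _ _).trans (hinv _ _ _)

variable [FiniteDimensional ℝ E]

theorem isSmoothMetric_of_apply {B : M → E →L[ℝ] E →L[ℝ] ℝ} (hsymm : ∀ x v w, B x v w = B x w v)
    (hpos : ∀ x v, v ≠ 0 → 0 < B x v v)
    (hsm : ∀ e ∈ IsManifold.maximalAtlas 𝓘(ℝ, E) ∞ M, ∀ v w,
      ContDiffOn ℝ ∞ (fun y => chartMetric B e y v w) e.target) : IsSmoothMetric B := by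
  refine fun e he => ⟨e.open_target, ?_, fun y _ v w => hsymm _ _ _, fun y hy v hv => ?_⟩
  · exact contDiffOn_clm_apply.2 fun v => contDiffOn_clm_apply.2 fun w => hsm e he v w
  · refine hpos _ _ fun h0 => hv ?_
    rw [← mfderiv_mfderiv_symm he hy v]
    exact (congrArg (mfderiv 𝓘(ℝ, E) 𝓘(ℝ, E) e (e.symm y)) h0).trans (map_zero _)

variable [IsManifold 𝓘(ℝ, E) ∞ M]

theorem IsSmoothMetric.exists_lower_bound {B : M → E →L[ℝ] E →L[ℝ] ℝ} (hB : IsSmoothMetric B)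
    (x : M) : ∃ c > 0, ∀ v, c * ‖v‖ ^ 2 ≤ B x v v := by
  have he := IsManifold.chart_mem_maximalAtlas (I := 𝓘(ℝ, E)) (n := ∞) x
  have hx := mem_chart_source E x
  obtain ⟨c, hc, h⟩ := (hB _ he).exists_lower_bound ((chartAt E x).map_source hx)
  let T : E →L[ℝ] E := mfderiv 𝓘(ℝ, E) 𝓘(ℝ, E) (chartAt E x).symm (chartAt E x x)
  let S : E →L[ℝ] E := mfderiv 𝓘(ℝ, E) 𝓘(ℝ, E) (chartAt E x) x
  have hv : ∀ v : E, ‖v‖ ≤ (‖T‖ + 1) * ‖S v‖ := fun v => by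
    calc ‖v‖ = ‖T (S v)‖ := congrArg (fun u : E => ‖u‖) (mfderiv_symm_mfderiv he hx v).symm
      _ ≤ ‖T‖ * ‖S v‖ := T.le_opNorm _
      _ ≤ _ := by gcongr; linarith
  have hT : 0 < ‖T‖ + 1 := by positivity
  refine ⟨c / (‖T‖ + 1) ^ 2, by positivity, fun v => ?_⟩
  calc c / (‖T‖ + 1) ^ 2 * ‖v‖ ^ 2 ≤ c / (‖T‖ + 1) ^ 2 * ((‖T‖ + 1) * ‖S v‖) ^ 2 := by
        gcongr; exact hv v
    _ = c * ‖S v‖ ^ 2 := by field_simp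
    _ ≤ _ := h.self_of_nhds (S v)
    _ = B x v v := chartMetric_apply_mfderiv B he hx v v

/-- The continuous Riemannian metric defined by a smooth metric. -/
def IsSmoothMetric.toContinuousRiemannianMetric {B : M → E →L[ℝ] E →L[ℝ] ℝ}
    (hB : IsSmoothMetric B) :
    ContinuousRiemannianMetric E (fun x : M => TangentSpace 𝓘(ℝ, E) x) where
  inner := B
  symm x v w := by
    have he := IsManifold.chart_mem_maximalAtlas (I := 𝓘(ℝ, E)) (n := ∞) x
    have hx := mem_chart_source E x
    have h1 := chartMetric_apply_mfderiv B he hx v w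
    have h2 := chartMetric_apply_mfderiv B he hx w v
    exact h1.symm.trans (((hB _ he).symm _ ((chartAt E x).map_source hx) _ _).trans h2)
  pos x v hv := by
    obtain ⟨c, hc, h⟩ := hB.exists_lower_bound x
    exact lt_of_lt_of_le (mul_pos hc (pow_pos (norm_pos_iff.2 (show (v : E) ≠ 0 from hv)) 2)) (h v)
  isVonNBounded x := by
    obtain ⟨c, hc, h⟩ := hB.exists_lower_bound x
    refine (NormedSpace.isVonNBounded_iff' ℝ (E := E)).2 ⟨√(1 / c), fun v hv => ?_⟩
    refine Real.le_sqrt_of_sq_le ?_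
    rw [le_div_iff₀ hc, mul_comm]
    exact (h v).trans (le_of_lt hv)
  continuous := by
    refine continuous_iff_continuousAt.2 fun x₀ => ?_
    rw [FiberBundle.continuousAt_totalSpace]
    refine ⟨continuousAt_id, ?_⟩
    have he := IsManifold.chart_mem_maximalAtlas (I := 𝓘(ℝ, E)) (n := ∞) x₀
    have hx := mem_chart_source E x₀
    have hc : ContinuousAt (fun x => chartMetric B (chartAt E x₀) (chartAt E x₀ x)) x₀ := by
      refine ContinuousAt.comp (f := chartAt E x₀) (g := chartMetric B (chartAt E x₀)) ?_
        ((chartAt E x₀).continuousAt hx)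
      exact ((hB _ he).contDiffOn.contDiffAt ((chartAt E x₀).open_target.mem_nhds
        ((chartAt E x₀).map_source hx))).continuousAt
    refine hc.congr ?_
    filter_upwards [(chartAt E x₀).open_source.mem_nhds hx] with x hxs
    refine ContinuousLinearMap.ext fun v => ContinuousLinearMap.ext fun w => ?_
    rw [hom_trivializationAt_apply]
    -- The trivialization at `x₀` identifies vectors through the derivative of the inverse chart, so
    -- in it the metric reads as `chartMetric`.
    have hs := TangentBundle.symmL_trivializationAt (I := 𝓘(ℝ, E)) (x₀ := x₀) (x := x) hxs
    rw [inCoordinates_apply_eq₂ (by simpa using hxs) (by simpa using hxs) (by simp)]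
    have hs' : ∀ u : E, (trivializationAt E (TangentSpace 𝓘(ℝ, E)) x₀).symm x u =
        mfderiv 𝓘(ℝ, E) 𝓘(ℝ, E) (chartAt E x₀).symm (chartAt E x₀ x) u := fun u => by
      have h2 := DFunLike.congr_fun hs u
      rw [Trivialization.symmL_apply _ (by simpa using hxs)] at h2
      refine h2.trans ?_
      simp only [extChartAt, mfld_simps]
      rfl
    rw [hs' v, hs' w]
    have ht : ∀ r : ℝ,
        (trivializationAt ℝ (fun _ : M => ℝ) x₀).linearMapAt ℝ x r = r := fun r => by simp
    refine Eq.trans ?_ (ht _).symm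
    change B ((chartAt E x₀).symm (chartAt E x₀ x)) _ _ = B x _ _
    rw [(chartAt E x₀).left_inv hxs]
    rfl

/-- The Riemannian distance serves: lengths of `C¹` paths are preserved, which gives one inequality
for every `α`, and the inverse of `α` gives the other. -/
theorem IsSmoothMetric.exists_pseudoEMetricSpace [T2Space M] {B : M → E →L[ℝ] E →L[ℝ] ℝ}
    (hB : IsSmoothMetric B) {G : Type*} [Group G] [MulAction G M]
    (hsm : ∀ α : G, ContMDiff 𝓘(ℝ, E) 𝓘(ℝ, E) ∞ fun x : M => α • x)
    (hinv : ∀ (α : G) (x : M) (v w : E), B (α • x)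
      (mfderiv 𝓘(ℝ, E) 𝓘(ℝ, E) (fun y : M => α • y) x v)
      (mfderiv 𝓘(ℝ, E) 𝓘(ℝ, E) (fun y : M => α • y) x w) = B x v w) :
    ∃ d : PseudoEMetricSpace M, d.toUniformSpace.toTopologicalSpace = ‹TopologicalSpace M› ∧
      ∀ (α : G) (x y : M), edist (α • x) (α • y) = edist x y := by
  have : LocallyCompactSpace M := Manifold.locallyCompact_of_finiteDimensional 𝓘(ℝ, E)
  let _ : RiemannianBundle (fun x : M => TangentSpace 𝓘(ℝ, E) x) :=
    ⟨hB.toContinuousRiemannianMetric.toRiemannianMetric⟩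
  have hle : ∀ (α : G) (x y : M), riemannianEDist 𝓘(ℝ, E) (α • x) (α • y) ≤
      riemannianEDist 𝓘(ℝ, E) x y := by
    intro α x y
    refine le_of_forall_gt fun r hr => ?_
    obtain ⟨γ, h0, h1, hγ, hlen, -, -⟩ :=
      exists_lt_locally_constant_of_riemannianEDist_lt hr (zero_lt_one' ℝ)
    have hα : ContMDiff 𝓘(ℝ, E) 𝓘(ℝ, E) 1 fun x : M => α • x := (hsm α).of_le (by simp)
    refine (riemannianEDist_le_pathELength (γ := fun t => α • γ t) (a := 0) (b := 1)
      (hα.comp hγ).contMDiffOn (by simp [h0]) (by simp [h1]) zero_le_one).trans_lt ?_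
    refine lt_of_eq_of_lt ?_ hlen
    rw [pathELength_eq_lintegral_mfderiv_Icc, pathELength_eq_lintegral_mfderiv_Icc]
    refine MeasureTheory.lintegral_congr fun t => ?_
    have hd : mfderiv 𝓘(ℝ, ℝ) 𝓘(ℝ, E) (fun t => α • γ t) t =
        (mfderiv 𝓘(ℝ, E) 𝓘(ℝ, E) (fun x : M => α • x) (γ t)).comp
          (mfderiv 𝓘(ℝ, ℝ) 𝓘(ℝ, E) γ t) :=
      mfderiv_comp t (hα.mdifferentiableAt one_ne_zero) (hγ.mdifferentiableAt one_ne_zero)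
    rw [hd]
    have hn : ∀ (x : M) (v : TangentSpace 𝓘(ℝ, E) x), ‖v‖ = √(B x v v) := fun x v =>
      norm_eq_sqrt_real_inner v
    rw [← ofReal_norm, ← ofReal_norm, hn, hn]
    congr 2
    exact hinv α (γ t) _ _
  refine ⟨PseudoEMetricSpace.ofRiemannianMetric 𝓘(ℝ, E) M, rfl, fun α x y => ?_⟩
  refine le_antisymm (hle α x y) ?_
  have := hle α⁻¹ (α • x) (α • y)
  rwa [inv_smul_smul, inv_smul_smul] at this

end SmoothMetric

/-! ### Closed groups of isometries act properly -/

section ClosedIsometries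

variable {E : Type*} [NormedAddCommGroup E] [NormedSpace ℝ E] [FiniteDimensional ℝ E]

section Limit

variable {M : Type*} [PseudoEMetricSpace M] [ChartedSpace E M]
  {G : Type*} [Group G] [MulAction G M] [IsIsometricSMul G M]
  {B : M → E →L[ℝ] E →L[ℝ] ℝ} {𝒰 : Ultrafilter G} {h : M → M}

/-- Pointwise limits of isometries are smooth local isometries, with convergence of all
derivatives. -/
theorem exists_isIsometryOn_limit (hB : IsSmoothMetric B)
    (hsm : ∀ α : G, ContMDiff 𝓘(ℝ, E) 𝓘(ℝ, E) ∞ fun x : M => α • x)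
    (hinv : ∀ (α : G) (x : M) (v w : E), B (α • x)
      (mfderiv 𝓘(ℝ, E) 𝓘(ℝ, E) (fun y : M => α • y) x v)
      (mfderiv 𝓘(ℝ, E) 𝓘(ℝ, E) (fun y : M => α • y) x w) = B x v w)
    (hh : ∀ x : M, Tendsto (fun g : G => g • x) 𝒰 (𝓝 (h x)))
    {φ ψ : OpenPartialHomeomorph M E} (hφ : φ ∈ IsManifold.maximalAtlas 𝓘(ℝ, E) ∞ M)
    (hψ : ψ ∈ IsManifold.maximalAtlas 𝓘(ℝ, E) ∞ M) {x : M} (hx : x ∈ φ.source)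
    (hhx : h x ∈ ψ.source) :
    ContDiffAt ℝ ∞ (fun y => ψ (h (φ.symm y))) (φ x) ∧ ∀ k : ℕ,
      Tendsto (fun p : G × E => iteratedFDeriv ℝ k (fun y => ψ (p.1 • φ.symm y)) p.2)
        (𝒰 ×ˢ 𝓝 (φ x)) (𝓝 (iteratedFDeriv ℝ k (fun y => ψ (h (φ.symm y))) (φ x))) := by
  have hc : ∀ x : M, Tendsto (fun p : G × M => p.1 • p.2) (𝒰 ×ˢ 𝓝 x) (𝓝 (h x)) := fun x =>
    tendsto_smul_prod_nhds (hh x)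
  have hcont : ∀ x, ContinuousAt h x := fun x =>
    continuousAt_of_continuous_convergence (l := (𝒰 : Filter G)) isOpen_univ (fun y _ => hc y)
      (mem_univ x)
  obtain ⟨pa, hpa, pb, hpb, hp⟩ := eventually_prod_iff.1
    ((hc x).eventually (ψ.open_source.mem_nhds hhx))
  -- Equicontinuity gives one neighbourhood of `x` that eventually all group elements, and also `h`,
  -- map into the chart `ψ`.
  have hN : ∀ᶠ y in 𝓝 (φ x), y ∈ φ.target ∧ pb (φ.symm y) ∧ h (φ.symm y) ∈ ψ.source := by
    have hs : Tendsto φ.symm (𝓝 (φ x)) (𝓝 x) := φ.tendsto_symm hx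
    exact Eventually.and (φ.open_target.mem_nhds (φ.map_source hx)) ((hs.eventually hpb).and
      (((hcont x).tendsto.comp hs).eventually (ψ.open_source.mem_nhds hhx)))
  obtain ⟨W, hWs, hWo, hxW⟩ := mem_nhds_iff.1 hN
  obtain ⟨h1, h2⟩ := isIsometryOn_of_tendsto (𝒰 := 𝒰) (hB φ hφ) (hB ψ hψ) hWo
    (fun y hy => (hWs hy).1) (F := fun g y => ψ (g • φ.symm y)) (H := fun y => ψ (h (φ.symm y)))
    (by
      filter_upwards [hpa] with g hg
      exact isIsometryOn_of_pullback (hsm g) (hinv g) hφ hψ (fun y hy => (hWs hy).1)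
        fun y hy => hp hg (hWs hy).2.1)
    (fun y hy => by
      have h3 : Tendsto (fun p : G × E => (p.1, φ.symm p.2)) (𝒰 ×ˢ 𝓝 y) (𝒰 ×ˢ 𝓝 (φ.symm y)) :=
        tendsto_fst.prodMk ((φ.symm.continuousAt (hWs hy).1).tendsto.comp tendsto_snd)
      exact (ψ.continuousAt (hWs hy).2.2).tendsto.comp ((hc _).comp h3))
    (fun y hy => ψ.map_source (hWs hy).2.2)
  exact ⟨h1.contDiffOn.contDiffAt (hWo.mem_nhds hxW), h2 _ hxW⟩

theorem contMDiff_of_tendsto_smul [IsManifold 𝓘(ℝ, E) ∞ M] (hB : IsSmoothMetric B)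
    (hsm : ∀ α : G, ContMDiff 𝓘(ℝ, E) 𝓘(ℝ, E) ∞ fun x : M => α • x)
    (hinv : ∀ (α : G) (x : M) (v w : E), B (α • x)
      (mfderiv 𝓘(ℝ, E) 𝓘(ℝ, E) (fun y : M => α • y) x v)
      (mfderiv 𝓘(ℝ, E) 𝓘(ℝ, E) (fun y : M => α • y) x w) = B x v w)
    (hh : ∀ x : M, Tendsto (fun g : G => g • x) 𝒰 (𝓝 (h x))) :
    ContMDiff 𝓘(ℝ, E) 𝓘(ℝ, E) ∞ h := by
  intro x
  have hφ := IsManifold.chart_mem_maximalAtlas (I := 𝓘(ℝ, E)) (n := ∞) x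
  have hψ := IsManifold.chart_mem_maximalAtlas (I := 𝓘(ℝ, E)) (n := ∞) (h x)
  have hx := mem_chart_source E x
  have hhx := mem_chart_source E (h x)
  obtain ⟨h1, -⟩ := exists_isIsometryOn_limit hB hsm hinv hh hφ hψ hx hhx
  have hcont : ContinuousAt h x :=
    continuousAt_of_continuous_convergence (l := (𝒰 : Filter G)) isOpen_univ
      (fun y _ => tendsto_smul_prod_nhds (hh y)) (mem_univ x)
  have h2 : ContMDiffAt 𝓘(ℝ, E) 𝓘(ℝ, E) ∞ (chartAt E x) x := contMDiffAt_of_mem_maximalAtlas hφ hx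
  have h3 : ContMDiffAt 𝓘(ℝ, E) 𝓘(ℝ, E) ∞ (chartAt E (h x)).symm (chartAt E (h x) (h x)) :=
    contMDiffAt_symm_of_mem_maximalAtlas hψ ((chartAt E (h x)).map_source hhx)
  have h4 := ContMDiffAt.comp x h1.contMDiffAt h2
  have h5 := ContMDiffAt.comp_of_eq (x := x) h3 h4
    (by simp only [Function.comp_apply, (chartAt E x).left_inv hx])
  refine h5.congr_of_eventuallyEq ?_
  filter_upwards [(chartAt E x).open_source.mem_nhds hx,
    hcont.eventually ((chartAt E (h x)).open_source.mem_nhds hhx)] with z hz hz'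
  simp only [Function.comp_apply, (chartAt E x).left_inv hz, (chartAt E (h x)).left_inv hz']

end Limit

variable {M : Type*} [TopologicalSpace M] [T2Space M] [ConnectedSpace M] [ChartedSpace E M]
  [IsManifold 𝓘(ℝ, E) ∞ M]
  {EG : Type*} [NormedAddCommGroup EG] [NormedSpace ℝ EG] [FiniteDimensional ℝ EG]
  {G : Type*} [Group G] [TopologicalSpace G] [SecondCountableTopology G]
  [ChartedSpace EG G] [LieGroup 𝓘(ℝ, EG) ∞ G]
  [MulAction G M] [FaithfulSMul G M] [ContMDiffSMul 𝓘(ℝ, EG) 𝓘(ℝ, E) ∞ G M]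
  {B : M → E →L[ℝ] E →L[ℝ] ℝ}

/-- A closed group of isometries of a Riemannian manifold acts properly. -/
theorem properSMul_of_isClosedInDiff (hclosed : IsClosedInDiff E M EG G)
    (hB : IsSmoothMetric B)
    (hinv : ∀ (α : G) (x : M) (v w : E), B (α • x)
      (mfderiv 𝓘(ℝ, E) 𝓘(ℝ, E) (fun y : M => α • y) x v)
      (mfderiv 𝓘(ℝ, E) 𝓘(ℝ, E) (fun y : M => α • y) x w) = B x v w) : ProperSMul G M := by
  have hsm : ∀ α : G, ContMDiff 𝓘(ℝ, E) 𝓘(ℝ, E) ∞ fun x : M => α • x :=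
    fun α => (Diffeomorph.smul 𝓘(ℝ, EG) 𝓘(ℝ, E) ∞ α : M ≃ₘ⟮𝓘(ℝ, E), 𝓘(ℝ, E)⟯ M).contMDiff
  obtain ⟨d, hd, hiso⟩ := hB.exists_pseudoEMetricSpace hsm hinv
  -- From here on the topology of `M` is definitionally that of the invariant distance.
  subst hd
  have : IsIsometricSMul G M := ⟨fun α x y => hiso α x y⟩
  have : LocallyCompactSpace M := Manifold.locallyCompact_of_finiteDimensional 𝓘(ℝ, E)
  have : LocallyCompactSpace G := Manifold.locallyCompact_of_finiteDimensional 𝓘(ℝ, EG)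
  have : IsTopologicalGroup G := topologicalGroup_of_lieGroup 𝓘(ℝ, EG) ∞
  have : ContinuousSMul G M :=
    ⟨(contMDiff_smul (I := 𝓘(ℝ, EG)) (I' := 𝓘(ℝ, E)) (n := ∞) (G := G) (M := M)).continuous⟩
  refine properSMul_of_exists_pointwise_limit fun 𝒰 x₀ y₀ h0 => ?_
  choose h hh using fun x => exists_tendsto_smul_of_tendsto_smul 𝒰 h0 x
  -- The inverses form an ultrafilter converging at `y₀`, so they too converge everywhere, to the
  -- inverse of the limit map.
  have h0' : Tendsto (fun g : G => g • y₀) (𝒰.map fun g => g⁻¹ : Ultrafilter G) (𝓝 x₀) := by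
    rw [Ultrafilter.coe_map, tendsto_map'_iff]
    exact tendsto_inv_smul h0
  choose h' hh' using fun x => exists_tendsto_smul_of_tendsto_smul _ h0' x
  have hh'' : ∀ x, Tendsto (fun g : G => g⁻¹ • x) 𝒰 (𝓝 (h' x)) := fun x => by
    have := hh' x
    rwa [Ultrafilter.coe_map, tendsto_map'_iff] at this
  let H : M ≃ₘ⟮𝓘(ℝ, E), 𝓘(ℝ, E)⟯ M :=
    { toFun := h
      invFun := h'
      left_inv := leftInverse_of_tendsto_smul hh hh''
      right_inv := rightInverse_of_tendsto_smul hh hh''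
      contMDiff_toFun := contMDiff_of_tendsto_smul hB hsm hinv hh
      contMDiff_invFun := contMDiff_of_tendsto_smul hB hsm hinv hh' }
  let _ := diffTopology E M
  have hT : Tendsto (fun g : G => (Diffeomorph.smul 𝓘(ℝ, EG) 𝓘(ℝ, E) ∞ g :
      M ≃ₘ⟮𝓘(ℝ, E), 𝓘(ℝ, E)⟯ M)) 𝒰 (𝓝 H) := by
    refine TopologicalSpace.tendsto_nhds_generateFrom_iff.2 ?_
    rintro _ ⟨f, φ, hφ, ψ, hψ, K, hK, hKφ, hfK, k, ε, hε, rfl⟩ ⟨hHK, hHε⟩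
    -- Convergence of derivatives is joint with the point, so each condition holds eventually near
    -- each point of `K`, and compactness makes it hold on all of `K`.
    have hev : ∀ᶠ g : G in (𝒰 : Filter G), ∀ x ∈ K, g • x ∈ ψ.source ∧ ∀ j ≤ k,
        ‖iteratedFDeriv ℝ j (fun y => ψ (g • φ.symm y)) (φ x)
          - iteratedFDeriv ℝ j (fun y => ψ (f (φ.symm y))) (φ x)‖ < ε := by
      refine hK.eventually_forall_of_prod fun x hx => ?_
      refine ((tendsto_smul_prod_nhds (hh x)).eventually
        (ψ.open_source.mem_nhds (hHK hx))).and ?_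
      refine (eventually_all_finite (finite_le_nat k)).2 fun j hj => ?_
      obtain ⟨-, h2⟩ := exists_isIsometryOn_limit hB hsm hinv hh hφ hψ (hKφ hx) (hHK hx)
      have hφx : ContinuousAt φ x := φ.continuousAt (hKφ hx)
      have h3 := (h2 j).comp ((tendsto_fst (f := (𝒰 : Filter G)) (g := 𝓝 x)).prodMk
        (hφx.tendsto.comp tendsto_snd))
      have h4 : ContDiffAt ℝ ∞ (fun y => ψ (f (φ.symm y))) (φ x) := by
        rw [← contMDiffAt_iff_contDiffAt]
        refine (contMDiffAt_of_mem_maximalAtlas hψ (x := f (φ.symm (φ x))) ?_).comp (φ x)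
          (f.contMDiff.contMDiffAt.comp (φ x)
            (contMDiffAt_symm_of_mem_maximalAtlas hφ (φ.map_source (hKφ hx))))
        rw [φ.left_inv (hKφ hx)]
        exact hfK hx
      have h5 := (h4.continuousAt_iteratedFDeriv (k := j) (mod_cast le_top)).tendsto.comp (hφx.tendsto.comp
        (tendsto_snd (f := (𝒰 : Filter G)) (g := 𝓝 x)))
      exact (h3.sub h5).norm.eventually_lt_const (hHε j hj x hx)
    filter_upwards [hev] with g hg
    exact ⟨fun x hx => (hg x hx).1, fun j hj x hx => (hg x hx).2 j hj⟩
  -- Closedness in `Diff(M)` places the limit diffeomorphism in the image of the group.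
  obtain ⟨g₀, hg₀⟩ := hclosed.mem_of_tendsto hT (Eventually.of_forall fun g => mem_range_self g)
  refine ⟨g₀, fun x => ?_⟩
  have : g₀ • x = h x := DFunLike.congr_fun hg₀ x
  rw [this]
  exact hh x

end ClosedIsometries

/-! ### Trivializing multiplicative cocycles -/

section Potential

variable {E : Type*} [NormedAddCommGroup E] [NormedSpace ℝ E] [FiniteDimensional ℝ E]
  {M : Type*} [TopologicalSpace M] [ChartedSpace E M] [IsManifold 𝓘(ℝ, E) ∞ M]
  {EG : Type*} [NormedAddCommGroup EG] [NormedSpace ℝ EG] [FiniteDimensional ℝ EG]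
  {G : Type*} [Group G] [TopologicalSpace G] [ChartedSpace EG G] [LieGroup 𝓘(ℝ, EG) ∞ G]
  [MulAction G M] [ContMDiffSMul 𝓘(ℝ, EG) 𝓘(ℝ, E) ∞ G M]

/-- If `H¹(G, C^∞(M))` vanishes, then every smooth multiplicative cocycle is, up to sign, the
coboundary of a smooth positive function. -/
theorem exists_abs_eq_exp_sub
    (hH : Subsingleton (DiffCohomology EG
      (smoothFunAction EG (EM := E) (M := M) (1 : G →* (ℝ →L[ℝ] ℝ))) 1))
    {u : G → M → ℝ} (hu : ContMDiff (𝓘(ℝ, EG).prod 𝓘(ℝ, E)) 𝓘(ℝ, ℝ) ∞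
      fun p : G × M => u p.1 p.2) (h0 : ∀ α x, u α x ≠ 0)
    (hmul : ∀ α β x, u (α * β) x = u α (β • x) * u β x) :
    ∃ f : M → ℝ, ContMDiff 𝓘(ℝ, E) 𝓘(ℝ, ℝ) ∞ f ∧
      ∀ α x, |u α x| = Real.exp (f (α • x) - f x) := by
  -- `Real.log` is `log |·|`, so the sign of `u` is discarded. The inverse of the group element
  -- matches the action on functions.
  have hlog : ∀ ℓ : ℝ →L[ℝ] ℝ, ContMDiff (𝓘(ℝ, Fin 1 → EG).prod 𝓘(ℝ, E)) 𝓘(ℝ, ℝ) ∞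
      fun p : (Fin 1 → G) × M => ℓ (Real.log (u (p.1 0)⁻¹ p.2)) := fun ℓ => by
    have h1 : ContMDiff (𝓘(ℝ, Fin 1 → EG).prod 𝓘(ℝ, E)) 𝓘(ℝ, ℝ) ∞
        fun p : (Fin 1 → G) × M => u (p.1 0)⁻¹ p.2 :=
      hu.comp (ContMDiff.prodMk ((contMDiff_pow_apply 0).comp contMDiff_fst).inv contMDiff_snd)
    refine ℓ.contMDiff.comp fun p => ?_
    exact ContMDiffAt.comp p (Real.contDiffAt_log.2 (h0 (p.1 0)⁻¹ p.2)).contMDiffAt (h1 p)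
  let c : (Fin 1 → G) → SmoothFun E M ℝ := fun a =>
    SmoothFun.mk (fun x => Real.log (u (a 0)⁻¹ x)) <| isSmoothMap_of_contMDiff fun ℓ =>
      (hlog ℓ).comp (contMDiff_const (c := a).prodMk contMDiff_id)
  have hc : IsSmoothMap (Fin 1 → EG) c := isSmoothMap_of_contMDiff_uncurry hlog
  have hc0 : coboundary (smoothFunAction EG (EM := E) (M := M) (1 : G →* (ℝ →L[ℝ] ℝ))) 1 c = 0 := by
    funext a
    refine Subtype.ext (funext fun x => ?_)
    have h1 : coboundary (smoothFunAction EG (EM := E) (M := M) (1 : G →* (ℝ →L[ℝ] ℝ))) 1 c a =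
        smoothFunAction EG (1 : G →* (ℝ →L[ℝ] ℝ)) (a 0) (c (Fin.tail a))
        + ∑ i : Fin 1, (-1 : ℝ) ^ ((i : ℕ) + 1) • c (Fin.contractNth i.castSucc (· * ·) a)
        + (-1 : ℝ) ^ (1 + 1) • c (Fin.init a) := rfl
    rw [h1, Fin.sum_univ_one]
    change Real.log (u (a 1)⁻¹ ((a 0)⁻¹ • x))
      + (-1) ^ ((0 : ℕ) + 1) * Real.log (u (Fin.contractNth 0 (· * ·) a 0)⁻¹ x)
      + (-1) ^ (1 + 1) * Real.log (u (a 0)⁻¹ x) = 0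
    have h2 : Fin.contractNth 0 (· * ·) a 0 = a 0 * a 1 :=
      Fin.contractNth_apply_of_eq _ _ _ _ rfl
    rw [h2, mul_inv_rev, hmul, Real.log_mul (h0 _ _) (h0 _ _)]
    ring
  have h1 : (⟨c, hc, hc0⟩ : cocycles EG
      (smoothFunAction EG (EM := E) (M := M) (1 : G →* (ℝ →L[ℝ] ℝ))) 1) ∈
      (coboundaries EG (smoothFunAction EG (EM := E) (M := M)
        (1 : G →* (ℝ →L[ℝ] ℝ))) 1).submoduleOf _ := by
    rw [Submodule.Quotient.subsingleton_iff.1 hH]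
    trivial
  obtain ⟨b, -, hbc⟩ := h1
  refine ⟨(b Fin.elim0).1, (b Fin.elim0).contMDiff (ContinuousLinearMap.id ℝ ℝ), fun α x => ?_⟩
  -- At `α⁻¹` the coboundary of the `0`-cochain `b` takes the value `b(α x) - b(x)` at `x`.
  have h2 := congrArg (fun s : SmoothFun E M ℝ => s.1 x) (congrFun hbc fun _ => α⁻¹)
  have h3 : (b Fin.elim0).1 (α⁻¹⁻¹ • x) + (-1) ^ (0 + 1) * (b Fin.elim0).1 x =
      Real.log (u α⁻¹⁻¹ x) := by
    refine Eq.trans ?_ h2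
    have ht : ∀ t : Fin 0 → G, b t = b Fin.elim0 := fun t => congrArg b (Subsingleton.elim _ _)
    have h4 : coboundary (smoothFunAction EG (EM := E) (M := M) (1 : G →* (ℝ →L[ℝ] ℝ))) 0 b
        (fun _ => α⁻¹) =
        smoothFunAction EG (1 : G →* (ℝ →L[ℝ] ℝ)) α⁻¹ (b (Fin.tail fun _ : Fin 1 => α⁻¹))
        + ∑ i : Fin 0, (-1 : ℝ) ^ ((i : ℕ) + 1) • b (Fin.contractNth i.castSucc (· * ·) fun _ => α⁻¹)
        + (-1 : ℝ) ^ (0 + 1) • b (Fin.init fun _ : Fin 1 => α⁻¹) := rfl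
    rw [ht, ht (Fin.init fun _ : Fin 1 => α⁻¹)] at h4
    change _ = (coboundary (smoothFunAction EG (EM := E) (M := M) (1 : G →* (ℝ →L[ℝ] ℝ))) 0 b
        (fun _ => α⁻¹)).1 x
    rw [h4, Finset.univ_eq_empty, Finset.sum_empty, add_zero]
    rfl
  rw [inv_inv] at h3
  rw [← Real.exp_log (abs_pos.2 (h0 α x)), Real.log_abs, ← h3]
  ring_nf

end Potential

/-! ### Smooth dependence of chart expressions on group element and point. -/

section LocalExpressions

variable {E : Type*} [NormedAddCommGroup E] [NormedSpace ℝ E] 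
  {M : Type*} [TopologicalSpace M] [ChartedSpace E M]
  {EG : Type*} [NormedAddCommGroup EG] [NormedSpace ℝ EG]
  {G : Type*} [Group G] [TopologicalSpace G] [ChartedSpace EG G]
  [MulAction G M] [ContMDiffSMul 𝓘(ℝ, EG) 𝓘(ℝ, E) ∞ G M]

theorem contMDiffAt_chart_smul {ψ : OpenPartialHomeomorph M E}
    (hψ : ψ ∈ IsManifold.maximalAtlas 𝓘(ℝ, E) ∞ M) {p : G × M} (hp : p.1 • p.2 ∈ ψ.source) :
    ContMDiffAt (𝓘(ℝ, EG).prod 𝓘(ℝ, E)) 𝓘(ℝ, E) ∞ (fun p : G × M => ψ (p.1 • p.2)) p :=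
  ContMDiffAt.comp p (contMDiffAt_of_mem_maximalAtlas hψ hp)
    (ContMDiff.smul (I := 𝓘(ℝ, EG)) (I' := 𝓘(ℝ, E)) contMDiff_fst contMDiff_snd p)

variable [IsManifold 𝓘(ℝ, EG) ∞ G] [IsManifold 𝓘(ℝ, E) ∞ M]

/-- Joint smoothness in group element and point is needed because the factor cocycles must be smooth
cochains. -/
theorem contMDiffAt_fderiv_smul {φ ψ : OpenPartialHomeomorph M E}
    (hφ : φ ∈ IsManifold.maximalAtlas 𝓘(ℝ, E) ∞ M) (hψ : ψ ∈ IsManifold.maximalAtlas 𝓘(ℝ, E) ∞ M)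
    {p : G × M} (hx : p.2 ∈ φ.source) (hp : p.1 • p.2 ∈ ψ.source) :
    ContMDiffAt (𝓘(ℝ, EG).prod 𝓘(ℝ, E)) 𝓘(ℝ, E →L[ℝ] E) ∞
      (fun p : G × M => fderiv ℝ (fun y => ψ (p.1 • φ.symm y)) (φ p.2)) p := by
  have h1 : ContMDiffAt ((𝓘(ℝ, EG).prod 𝓘(ℝ, E)).prod 𝓘(ℝ, E)) 𝓘(ℝ, E) ∞
      (Function.uncurry fun (q : G × M) (y : E) => ψ (q.1 • φ.symm y)) (p, φ p.2) := by
    have h2 : ContMDiffAt 𝓘(ℝ, E) 𝓘(ℝ, E) ∞ φ.symm (φ p.2) :=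
      contMDiffAt_symm_of_mem_maximalAtlas hφ (φ.map_source hx)
    have h3 : ContMDiffAt ((𝓘(ℝ, EG).prod 𝓘(ℝ, E)).prod 𝓘(ℝ, E)) (𝓘(ℝ, EG).prod 𝓘(ℝ, E)) ∞
        (fun z : (G × M) × E => (z.1.1, φ.symm z.2)) (p, φ p.2) :=
      (contMDiffAt_fst.comp _ contMDiffAt_fst).prodMk
        (ContMDiffAt.comp (x := (p, φ p.2)) (f := Prod.snd) (g := φ.symm) h2 contMDiffAt_snd)
    refine ContMDiffAt.comp_of_eq (g := fun p : G × M => ψ (p.1 • p.2))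
      (contMDiffAt_chart_smul (EG := EG) hψ (p := p) hp) h3 ?_
    simp [φ.left_inv hx]
  have h2 := ContMDiffAt.mfderiv (fun (q : G × M) (y : E) => ψ (q.1 • φ.symm y))
    (fun q => φ q.2) h1 (ContMDiffAt.comp p (contMDiffAt_of_mem_maximalAtlas hφ hx)
      contMDiffAt_snd) (m := ∞) (by simp)
  simpa only [inTangentCoordinates_model_space, mfderiv_eq_fderiv] using h2

theorem contMDiffOn_mfderiv_symm_apply {e : OpenPartialHomeomorph M E}
    (he : e ∈ IsManifold.maximalAtlas 𝓘(ℝ, E) ∞ M) {V : E → E} (hV : ContDiffOn ℝ ∞ V e.target) :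
    ContMDiffOn 𝓘(ℝ, E) 𝓘(ℝ, E).tangent ∞
      (fun y => (⟨e.symm y, mfderiv 𝓘(ℝ, E) 𝓘(ℝ, E) e.symm y (V y)⟩ : TangentBundle 𝓘(ℝ, E) M))
      e.target := by
  have h1 := (contMDiffOn_symm_of_mem_maximalAtlas he).contMDiffOn_tangentMapWithin (m := ∞)
    (by simp) e.open_target.uniqueMDiffOn
  have h2 : ContMDiffOn 𝓘(ℝ, E) 𝓘(ℝ, E).tangent ∞
      (fun y => (⟨y, V y⟩ : TangentBundle 𝓘(ℝ, E) E)) e.target :=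
    contMDiffOn_vectorSpace_iff_contDiffOn.2 hV
  refine (h1.comp h2 fun y hy => hy).congr fun y hy => ?_
  simp only [Function.comp_apply, tangentMapWithin]
  rw [mfderivWithin_of_isOpen e.open_target hy]

end LocalExpressions

/-! ### Conformal structures -/

section Conformal

variable {E : Type*} [NormedAddCommGroup E] [NormedSpace ℝ E]
  {M : Type*} [TopologicalSpace M] [ChartedSpace E M]

theorem IsSmoothMetric.smul {B : M → E →L[ℝ] E →L[ℝ] ℝ} (hB : IsSmoothMetric B) {h : M → ℝ}
    (hh : ContMDiff 𝓘(ℝ, E) 𝓘(ℝ, ℝ) ∞ h) (hpos : ∀ x, 0 < h x) :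
    IsSmoothMetric fun x => h x • B x := fun e he =>
  { isOpen := e.open_target
    contDiffOn := (contMDiffOn_iff_contDiffOn.1 (hh.comp_contMDiffOn
      (contMDiffOn_symm_of_mem_maximalAtlas he))).smul (hB e he).contDiffOn
    symm := fun y hy v w => congrArg (h (e.symm y) * ·) ((hB e he).symm y hy v w)
    pos := fun y hy v hv => mul_pos (hpos _) ((hB e he).pos y hy v hv) }

theorem chartMetric_pullback {B : M → E →L[ℝ] E →L[ℝ] ℝ} {f : M → M} {c : ℝ}
    {φ ψ : OpenPartialHomeomorph M E} (hφ : φ ∈ IsManifold.maximalAtlas 𝓘(ℝ, E) ∞ M)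
    (hψ : ψ ∈ IsManifold.maximalAtlas 𝓘(ℝ, E) ∞ M) {y : E} (hy : y ∈ φ.target)
    (hfy : f (φ.symm y) ∈ ψ.source) (hf : MDifferentiableAt 𝓘(ℝ, E) 𝓘(ℝ, E) f (φ.symm y))
    (h : ∀ v w : E, B (f (φ.symm y)) (mfderiv 𝓘(ℝ, E) 𝓘(ℝ, E) f (φ.symm y) v)
      (mfderiv 𝓘(ℝ, E) 𝓘(ℝ, E) f (φ.symm y) w) = c * B (φ.symm y) v w) (v w : E) :
    chartMetric B ψ (ψ (f (φ.symm y))) (fderiv ℝ (fun y => ψ (f (φ.symm y))) y v)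
      (fderiv ℝ (fun y => ψ (f (φ.symm y))) y w) = c * chartMetric B φ y v w := by
  rw [fderiv_chart_comp hφ hψ hy hfy hf]
  exact (chartMetric_apply_mfderiv B hψ hfy _ _).trans (h _ _)

/-- The chain rule for the action. The function `P` carries base point and derivative together,
since `(α * β) • x` and `α • β • x` are equal only up to a rewrite and so are their tangent spaces.
-/
theorem comp_smul_mfderiv {G : Type*} [Group G] [MulAction G M]
    (hsm : ∀ α : G, ContMDiff 𝓘(ℝ, E) 𝓘(ℝ, E) ∞ fun x : M => α • x) {X : Type*} (P : M → (E →L[ℝ] E) → X) (α β : G) (x : M) :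
    P ((α * β) • x) (mfderiv 𝓘(ℝ, E) 𝓘(ℝ, E) (fun y : M => (α * β) • y) x) =
      P (α • β • x) ((mfderiv 𝓘(ℝ, E) 𝓘(ℝ, E) (fun y : M => α • y) (β • x)).comp
        (mfderiv 𝓘(ℝ, E) 𝓘(ℝ, E) (fun y : M => β • y) x)) := by
  have h1 : (fun y : M => (α * β) • y) = (fun y => α • y) ∘ fun y => β • y :=
    funext fun y => mul_smul α β y
  have h2 := fun α : G => (hsm α).mdifferentiable (by simp)
  have h3 := congrArg (fun f : M → M => P (f x) (mfderiv 𝓘(ℝ, E) 𝓘(ℝ, E) f x)) h1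
  exact h3.trans (congrArg (P (α • β • x)) (mfderiv_comp x (h2 α _) (h2 β x)))

variable [FiniteDimensional ℝ E] [IsManifold 𝓘(ℝ, E) ∞ M]

theorem isSmoothMetric_inner
    (g : ContMDiffRiemannianMetric 𝓘(ℝ, E) ∞ E (fun x : M => TangentSpace 𝓘(ℝ, E) x)) :
    IsSmoothMetric (M := M) (E := E) fun x => g.inner x := by
  refine isSmoothMetric_of_apply g.symm g.pos fun e he v w => ?_
  have h1 := ContMDiffOn.clm_bundle_apply₂ (s := e.target) (F₃ := ℝ) (E₃ := fun _ : M => ℝ)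
    (g.contMDiff.comp_contMDiffOn (contMDiffOn_symm_of_mem_maximalAtlas he))
    (contMDiffOn_mfderiv_symm_apply he (contDiffOn_const (c := v)))
    (contMDiffOn_mfderiv_symm_apply he (contDiffOn_const (c := w)))
  intro y hy
  have h2 := contMDiffWithinAt_totalSpace.1 (h1 y hy)
  exact contMDiffWithinAt_iff_contDiffWithinAt.1 h2.2

variable {EG : Type*} [NormedAddCommGroup EG] [NormedSpace ℝ EG] [FiniteDimensional ℝ EG]
  {G : Type*} [Group G] [TopologicalSpace G] [ChartedSpace EG G] [LieGroup 𝓘(ℝ, EG) ∞ G]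
  [MulAction G M] [ContMDiffSMul 𝓘(ℝ, EG) 𝓘(ℝ, E) ∞ G M]

/-- Locally `u` is the quotient of two chart expressions evaluated on one fixed nonzero coordinate
vector `v`. -/
theorem contMDiff_conformal_factor {B : M → E →L[ℝ] E →L[ℝ] ℝ} (hB : IsSmoothMetric B)
    {u : G → M → ℝ} (hu : ∀ (α : G) (x : M) (v w : E), B (α • x)
      (mfderiv 𝓘(ℝ, E) 𝓘(ℝ, E) (fun y : M => α • y) x v)
      (mfderiv 𝓘(ℝ, E) 𝓘(ℝ, E) (fun y : M => α • y) x w) = u α x * B x v w) [Nontrivial E] :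
    ContMDiff (𝓘(ℝ, EG).prod 𝓘(ℝ, E)) 𝓘(ℝ, ℝ) ∞ fun p : G × M => u p.1 p.2 := by
  intro p₀
  obtain ⟨v, hv⟩ := exists_ne (0 : E)
  have hφ := IsManifold.chart_mem_maximalAtlas (I := 𝓘(ℝ, E)) (n := ∞) p₀.2
  have hψ := IsManifold.chart_mem_maximalAtlas (I := 𝓘(ℝ, E)) (n := ∞) (p₀.1 • p₀.2)
  have hx := mem_chart_source E p₀.2
  have hp := mem_chart_source E (p₀.1 • p₀.2)
  set φ := chartAt E p₀.2
  set ψ := chartAt E (p₀.1 • p₀.2)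
  have h1 := contMDiffAt_chart_smul (EG := EG) hψ hp
  have h2 : ContMDiffAt (𝓘(ℝ, EG).prod 𝓘(ℝ, E)) 𝓘(ℝ, E) ∞
      (fun p : G × M => fderiv ℝ (fun y => ψ (p.1 • φ.symm y)) (φ p.2) v) p₀ :=
    (contMDiffAt_fderiv_smul (EG := EG) hφ hψ hx hp).clm_apply contMDiffAt_const
  have h3 : ContMDiffAt (𝓘(ℝ, EG).prod 𝓘(ℝ, E)) 𝓘(ℝ, E →L[ℝ] E →L[ℝ] ℝ) ∞
      (fun p : G × M => chartMetric B ψ (ψ (p.1 • p.2))) p₀ :=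
    ContMDiffAt.comp (g := chartMetric B ψ) p₀ (((hB ψ hψ).contDiffOn.contDiffAt
      (ψ.open_target.mem_nhds (ψ.map_source hp))).contMDiffAt) h1
  have h4 : ContMDiffAt (𝓘(ℝ, EG).prod 𝓘(ℝ, E)) 𝓘(ℝ, E →L[ℝ] E →L[ℝ] ℝ) ∞
      (fun p : G × M => chartMetric B φ (φ p.2)) p₀ :=
    ContMDiffAt.comp (g := fun x => chartMetric B φ (φ x)) p₀
      (ContMDiffAt.comp (g := chartMetric B φ) p₀.2 (((hB φ hφ).contDiffOn.contDiffAt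
        (φ.open_target.mem_nhds (φ.map_source hx))).contMDiffAt)
        (contMDiffAt_of_mem_maximalAtlas hφ hx)) contMDiffAt_snd
  have h5 := ((h3.clm_apply h2).clm_apply h2).div₀
    ((h4.clm_apply contMDiffAt_const).clm_apply contMDiffAt_const)
    ((hB φ hφ).pos _ (φ.map_source hx) v hv).ne'
  refine h5.congr_of_eventuallyEq ?_
  filter_upwards [(continuous_snd.tendsto p₀).eventually (φ.open_source.mem_nhds hx),
    (ContMDiff.smul (I := 𝓘(ℝ, EG)) (I' := 𝓘(ℝ, E)) (n := ∞) (M := M) contMDiff_fst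
      contMDiff_snd).continuous.tendsto p₀ |>.eventually (ψ.open_source.mem_nhds hp)] with p hp1 hp2
  have hp3 : p.1 • φ.symm (φ p.2) ∈ ψ.source := by rwa [φ.left_inv hp1]
  have h6 := chartMetric_pullback (f := fun x => p.1 • x) (B := B) hφ hψ (φ.map_source hp1) hp3
    ((ContMDiffSMul.contMDiff_const_smul (I := 𝓘(ℝ, EG)) (n := ∞) p.1).mdifferentiableAt (by simp)) (hu p.1 _) v v
  rw [φ.left_inv hp1] at h6
  exact eq_div_of_mul_eq ((hB φ hφ).pos _ (φ.map_source hp1) v hv).ne' h6.symm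

/-- The chain rule makes `u` a cocycle. If `u_α(x) = exp (f(α x) - f(x))`, then `e^{-f} g` is
invariant. -/
theorem PreservesConformalClass.exists_invariant_metric
    {g : ContMDiffRiemannianMetric 𝓘(ℝ, E) ∞ E (fun x : M => TangentSpace 𝓘(ℝ, E) x)}
    (hg : PreservesConformalClass G g)
    (hH : Subsingleton (DiffCohomology EG
      (smoothFunAction EG (EM := E) (M := M) (1 : G →* (ℝ →L[ℝ] ℝ))) 1)) :
    ∃ B : M → E →L[ℝ] E →L[ℝ] ℝ, IsSmoothMetric B ∧ ∀ (α : G) (x : M) (v w : E), B (α • x)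
      (mfderiv 𝓘(ℝ, E) 𝓘(ℝ, E) (fun y : M => α • y) x v)
      (mfderiv 𝓘(ℝ, E) 𝓘(ℝ, E) (fun y : M => α • y) x w) = B x v w := by
  let B : M → E →L[ℝ] E →L[ℝ] ℝ := fun x => g.inner x
  have hB : IsSmoothMetric B := isSmoothMetric_inner g
  choose u _ hpos hu using hg
  have hu' : ∀ (α : G) (x : M) (v w : E), B (α • x)
      (mfderiv 𝓘(ℝ, E) 𝓘(ℝ, E) (fun y : M => α • y) x v)
      (mfderiv 𝓘(ℝ, E) 𝓘(ℝ, E) (fun y : M => α • y) x w) = u α x * B x v w := hu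
  -- In dimension `0` there is no vector from which to read off `u`, but every form vanishes.
  rcases subsingleton_or_nontrivial E with hE | hE
  · refine ⟨B, hB, fun α x v w => ?_⟩
    rw [hu' α x v w, Subsingleton.elim v 0, map_zero, zero_apply, mul_zero]
  have hmul : ∀ α β x, u (α * β) x = u α (β • x) * u β x := by
    intro α β x
    obtain ⟨v, hv⟩ := exists_ne (0 : E)
    have hne : B x v v ≠ 0 := (g.pos x v hv).ne'
    have h1 := comp_smul_mfderiv (E := E) (M := M) (G := G)
      (ContMDiffSMul.contMDiff_const_smul (I := 𝓘(ℝ, EG))) (fun x L => B x (L v) (L v)) α β x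
    have h2 := (hu' (α * β) x v v).symm.trans (h1.trans ((hu' α (β • x) _ _).trans
      (congrArg (u α (β • x) * ·) (hu' β x v v))))
    exact mul_right_cancel₀ hne (h2.trans (mul_assoc _ _ _).symm)
  obtain ⟨f, hf, hfu⟩ := exists_abs_eq_exp_sub hH (contMDiff_conformal_factor hB hu')
    (fun α x => (hpos α x).ne') hmul
  have hexp : ContMDiff 𝓘(ℝ, E) 𝓘(ℝ, ℝ) ∞ fun x => Real.exp (-f x) :=
    Real.contDiff_exp.contMDiff.comp hf.neg
  refine ⟨_, hB.smul hexp fun x => Real.exp_pos _, fun α x v w => ?_⟩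
  change Real.exp (-f (α • x)) * B (α • x) (mfderiv 𝓘(ℝ, E) 𝓘(ℝ, E) (fun y : M => α • y) x v)
    (mfderiv 𝓘(ℝ, E) 𝓘(ℝ, E) (fun y : M => α • y) x w) = Real.exp (-f x) * B x v w
  rw [hu', ← abs_of_pos (hpos α x), hfu, ← mul_assoc, ← Real.exp_add]
  congr 2
  ring

end Conformal

/-! ### One-forms in charts -/

section Forms

variable {E : Type*} [NormedAddCommGroup E] [NormedSpace ℝ E]

/-- The exterior derivative of a one-form on a vector space, as a bilinear map. -/
def dForm (η : E → E →L[ℝ] ℝ) (y : E) : E →L[ℝ] E →L[ℝ] ℝ :=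
  fderiv ℝ η y - (fderiv ℝ η y).flip

theorem dForm_apply (η : E → E →L[ℝ] ℝ) (y v w : E) :
    dForm η y v w = fderiv ℝ η y v w - fderiv ℝ η y w v := rfl

/-- Differentiating the relation produces a term `η₂ (D²τ(v, w))`, which disappears on
antisymmetrizing because `D²τ` is symmetric. -/
theorem dForm_pullback {η₁ η₂ : E → E →L[ℝ] ℝ} {τ : E → E} {y : E} {c : ℝ}
    (hη₁ : DifferentiableAt ℝ η₁ y) (hη₂ : DifferentiableAt ℝ η₂ (τ y)) (hτ : ContDiffAt ℝ ∞ τ y)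
    (h : (fun z => (η₂ (τ z)).comp (fderiv ℝ τ z)) =ᶠ[𝓝 y] fun z => c • η₁ z) (v w : E) :
    dForm η₂ (τ y) (fderiv ℝ τ y v) (fderiv ℝ τ y w) = c * dForm η₁ y v w := by
  have hτ1 : DifferentiableAt ℝ τ y := hτ.differentiableAt (by simp)
  have hτ2 : DifferentiableAt ℝ (fderiv ℝ τ) y :=
    (hτ.fderiv_right (m := ∞) (by simp)).differentiableAt (by simp)
  have hsymm : IsSymmSndFDerivAt ℝ τ y := hτ.isSymmSndFDerivAt (by simpa using ENat.LEInfty.out)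
  have hd : ∀ v w, c * fderiv ℝ η₁ y v w = fderiv ℝ η₂ (τ y) (fderiv ℝ τ y v) (fderiv ℝ τ y w) +
      η₂ (τ y) (fderiv ℝ (fderiv ℝ τ) y v w) := by
    intro v w
    have h1 := h.fderiv_eq (𝕜 := ℝ)
    have h2 : HasFDerivAt (fun z => η₂ (τ z)) ((fderiv ℝ η₂ (τ y)).comp (fderiv ℝ τ y)) y :=
      hη₂.hasFDerivAt.comp y hτ1.hasFDerivAt
    have h3 := (h2.clm_comp hτ2.hasFDerivAt).fderiv
    rw [h1, fderiv_fun_const_smul hη₁ c] at h3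
    have h4 := DFunLike.congr_fun (DFunLike.congr_fun h3 v) w
    simpa [add_comm] using h4
  rw [dForm_apply, dForm_apply, mul_sub, hd, hd, hsymm.eq v w]
  ring

/-- The extra term `dk ∧ η` vanishes on `ker η`. -/
theorem dForm_smul {k : E → ℝ} {η : E → E →L[ℝ] ℝ} {y : E} (hk : DifferentiableAt ℝ k y)
    (hη : DifferentiableAt ℝ η y) {v w : E} (hv : η y v = 0) (hw : η y w = 0) :
    dForm (fun z => k z • η z) y v w = k y * dForm η y v w := by
  rw [dForm_apply, dForm_apply, fderiv_fun_smul hk hη]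
  simp [hv, hw, mul_sub]

variable {M : Type*} [TopologicalSpace M] [ChartedSpace E M]

/-- The coordinate expression of a one-form in a chart. -/
def chartForm (θ : M → E →L[ℝ] ℝ) (e : OpenPartialHomeomorph M E) (y : E) : E →L[ℝ] ℝ :=
  (θ (e.symm y)).comp (mfderiv 𝓘(ℝ, E) 𝓘(ℝ, E) e.symm y : E →L[ℝ] E)

/-- A smooth one-form on `M`, described in charts. -/
def IsSmoothForm (θ : M → E →L[ℝ] ℝ) : Prop :=
  ∀ e ∈ IsManifold.maximalAtlas 𝓘(ℝ, E) ∞ M, ContDiffOn ℝ ∞ (chartForm θ e) e.target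

/-- The exterior derivative of a one-form on `M`, as a field of bilinear maps. -/
def formDeriv (θ : M → E →L[ℝ] ℝ) (x : M) : E →L[ℝ] E →L[ℝ] ℝ :=
  (dForm (chartForm θ (chartAt E x)) (chartAt E x x)).bilinearComp
    (mfderiv 𝓘(ℝ, E) 𝓘(ℝ, E) (chartAt E x) x : E →L[ℝ] E)
    (mfderiv 𝓘(ℝ, E) 𝓘(ℝ, E) (chartAt E x) x : E →L[ℝ] E)

theorem chartForm_apply_mfderiv (θ : M → E →L[ℝ] ℝ) {e : OpenPartialHomeomorph M E}
    (he : e ∈ IsManifold.maximalAtlas 𝓘(ℝ, E) ∞ M) {x : M} (hx : x ∈ e.source) (v : E) :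
    chartForm θ e (e x) (mfderiv 𝓘(ℝ, E) 𝓘(ℝ, E) e x v) = θ x v := by
  have h1 := mfderiv_symm_mfderiv he hx v
  calc _ = θ (e.symm (e x)) v := congrArg (fun a : E => θ (e.symm (e x)) a) h1
    _ = _ := by rw [e.left_inv hx]

theorem chartForm_pullback {θ₁ θ₂ : M → E →L[ℝ] ℝ} {f : M → M} {c : ℝ}
    {φ ψ : OpenPartialHomeomorph M E} (hφ : φ ∈ IsManifold.maximalAtlas 𝓘(ℝ, E) ∞ M)
    (hψ : ψ ∈ IsManifold.maximalAtlas 𝓘(ℝ, E) ∞ M) {y : E} (hy : y ∈ φ.target)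
    (hfy : f (φ.symm y) ∈ ψ.source) (hf : MDifferentiableAt 𝓘(ℝ, E) 𝓘(ℝ, E) f (φ.symm y))
    (h : ∀ v : E, θ₂ (f (φ.symm y)) (mfderiv 𝓘(ℝ, E) 𝓘(ℝ, E) f (φ.symm y) v) =
      c * θ₁ (φ.symm y) v) (v : E) :
    chartForm θ₂ ψ (ψ (f (φ.symm y))) (fderiv ℝ (fun y => ψ (f (φ.symm y))) y v) =
      c * chartForm θ₁ φ y v := by
  rw [fderiv_chart_comp hφ hψ hy hfy hf]
  exact (chartForm_apply_mfderiv θ₂ hψ hfy _).trans (h _)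

theorem dForm_chartForm_pullback {θ₁ θ₂ : M → E →L[ℝ] ℝ} (hθ₁ : IsSmoothForm θ₁)
    (hθ₂ : IsSmoothForm θ₂) {f : M → M} {c : ℝ} (hf : ContMDiff 𝓘(ℝ, E) 𝓘(ℝ, E) ∞ f)
    {φ ψ : OpenPartialHomeomorph M E} (hφ : φ ∈ IsManifold.maximalAtlas 𝓘(ℝ, E) ∞ M)
    (hψ : ψ ∈ IsManifold.maximalAtlas 𝓘(ℝ, E) ∞ M) {x : M} (hx : x ∈ φ.source)
    (hfx : f x ∈ ψ.source)
    (h : ∀ᶠ z in 𝓝 x, ∀ v : E, θ₂ (f z) (mfderiv 𝓘(ℝ, E) 𝓘(ℝ, E) f z v) = c * θ₁ z v) (v w : E) :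
    dForm (chartForm θ₂ ψ) (ψ (f x)) (fderiv ℝ (fun y => ψ (f (φ.symm y))) (φ x) v)
      (fderiv ℝ (fun y => ψ (f (φ.symm y))) (φ x) w) = c * dForm (chartForm θ₁ φ) (φ x) v w := by
  have hs : Tendsto φ.symm (𝓝 (φ x)) (𝓝 x) := φ.tendsto_symm hx
  have hF : ContDiffAt ℝ ∞ (fun y => ψ (f (φ.symm y))) (φ x) := by
    rw [← contMDiffAt_iff_contDiffAt]
    refine (contMDiffAt_of_mem_maximalAtlas hψ (x := f (φ.symm (φ x))) ?_).comp (φ x)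
      (hf.contMDiffAt.comp (φ x) (contMDiffAt_symm_of_mem_maximalAtlas hφ (φ.map_source hx)))
    rwa [φ.left_inv hx]
  have h1 := dForm_pullback (η₁ := chartForm θ₁ φ) (η₂ := chartForm θ₂ ψ)
    (τ := fun y => ψ (f (φ.symm y))) (y := φ x) (c := c)
    (((hθ₁ φ hφ).contDiffAt (φ.open_target.mem_nhds (φ.map_source hx))).differentiableAt (by simp))
    (by
      rw [φ.left_inv hx]
      exact ((hθ₂ ψ hψ).contDiffAt
        (ψ.open_target.mem_nhds (ψ.map_source hfx))).differentiableAt (by simp)) hF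
    (by
      filter_upwards [hs.eventually h, φ.open_target.mem_nhds (φ.map_source hx),
        (hf.continuous.continuousAt.tendsto.comp hs).eventually (ψ.open_source.mem_nhds hfx)]
        with y hy1 hy2 hy3
      ext v
      exact chartForm_pullback hφ hψ hy2 hy3 (hf.mdifferentiableAt (by simp)) hy1 v) v w
  rwa [φ.left_inv hx] at h1

theorem fderiv_chart_apply_mfderiv {f : M → M} (hf : ContMDiff 𝓘(ℝ, E) 𝓘(ℝ, E) ∞ f)
    {φ ψ : OpenPartialHomeomorph M E} (hφ : φ ∈ IsManifold.maximalAtlas 𝓘(ℝ, E) ∞ M)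
    (hψ : ψ ∈ IsManifold.maximalAtlas 𝓘(ℝ, E) ∞ M) {x : M} (hx : x ∈ φ.source)
    (hfx : f x ∈ ψ.source) (v : E) :
    fderiv ℝ (fun y => ψ (f (φ.symm y))) (φ x) (mfderiv 𝓘(ℝ, E) 𝓘(ℝ, E) φ x v) =
      mfderiv 𝓘(ℝ, E) 𝓘(ℝ, E) ψ (f x) (mfderiv 𝓘(ℝ, E) 𝓘(ℝ, E) f x v) := by
  have h3 : ψ ∘ f =ᶠ[𝓝 x] (fun y => ψ (f (φ.symm y))) ∘ φ := by
    filter_upwards [φ.open_source.mem_nhds hx] with z hz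
    simp [φ.left_inv hz]
  have hfx' : f (φ.symm (φ x)) ∈ ψ.source := by rwa [φ.left_inv hx]
  have hf1 : MDifferentiable 𝓘(ℝ, E) 𝓘(ℝ, E) f := hf.mdifferentiable (by simp)
  have h4 : MDifferentiableAt 𝓘(ℝ, E) 𝓘(ℝ, E) (fun y => ψ (f (φ.symm y))) (φ x) :=
    MDifferentiableAt.comp _ ((mdifferentiable_of_mem_maximalAtlas hψ).mdifferentiableAt hfx')
      ((hf1 _).comp _ ((mdifferentiable_of_mem_maximalAtlas hφ).mdifferentiableAt_symm
        (φ.map_source hx)))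
  have h5 := mfderiv_comp x h4 ((mdifferentiable_of_mem_maximalAtlas hφ).mdifferentiableAt hx)
  have h6 := mfderiv_comp x ((mdifferentiable_of_mem_maximalAtlas hψ).mdifferentiableAt hfx) (hf1 x)
  have h7 := h6.symm.trans (h3.mfderiv_eq.trans h5)
  rw [mfderiv_eq_fderiv] at h7
  exact (DFunLike.congr_fun h7 v).symm

/-- Independence of the chart is naturality of the exterior derivative under the identity map, read
in two charts. -/
theorem formDeriv_eq [IsManifold 𝓘(ℝ, E) ∞ M] {θ : M → E →L[ℝ] ℝ} (hθ : IsSmoothForm θ)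
    {e : OpenPartialHomeomorph M E} (he : e ∈ IsManifold.maximalAtlas 𝓘(ℝ, E) ∞ M) {x : M}
    (hx : x ∈ e.source) (v w : E) :
    formDeriv θ x v w = dForm (chartForm θ e) (e x) (mfderiv 𝓘(ℝ, E) 𝓘(ℝ, E) e x v)
      (mfderiv 𝓘(ℝ, E) 𝓘(ℝ, E) e x w) := by
  have hφ := IsManifold.chart_mem_maximalAtlas (I := 𝓘(ℝ, E)) (n := ∞) x
  have hxφ := mem_chart_source E x
  have h1 := dForm_chartForm_pullback hθ hθ (f := id) (c := 1) contMDiff_id hφ he hxφ hx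
    (Eventually.of_forall fun z v => by rw [mfderiv_id, one_mul]; rfl)
    (mfderiv 𝓘(ℝ, E) 𝓘(ℝ, E) (chartAt E x) x v) (mfderiv 𝓘(ℝ, E) 𝓘(ℝ, E) (chartAt E x) x w)
  rw [one_mul] at h1
  refine h1.symm.trans ?_
  rw [fderiv_chart_apply_mfderiv contMDiff_id hφ he hxφ hx,
    fderiv_chart_apply_mfderiv contMDiff_id hφ he hxφ hx, mfderiv_id]
  rfl

theorem formDeriv_pullback [IsManifold 𝓘(ℝ, E) ∞ M] {θ₁ θ₂ : M → E →L[ℝ] ℝ}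
    (hθ₁ : IsSmoothForm θ₁)
    (hθ₂ : IsSmoothForm θ₂) {f : M → M} {c : ℝ} (hf : ContMDiff 𝓘(ℝ, E) 𝓘(ℝ, E) ∞ f) {x : M}
    (h : ∀ᶠ z in 𝓝 x, ∀ v : E, θ₂ (f z) (mfderiv 𝓘(ℝ, E) 𝓘(ℝ, E) f z v) = c * θ₁ z v) (v w : E) :
    formDeriv θ₂ (f x) (mfderiv 𝓘(ℝ, E) 𝓘(ℝ, E) f x v) (mfderiv 𝓘(ℝ, E) 𝓘(ℝ, E) f x w) =
      c * formDeriv θ₁ x v w := by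
  have hφ := IsManifold.chart_mem_maximalAtlas (I := 𝓘(ℝ, E)) (n := ∞) x
  have hψ := IsManifold.chart_mem_maximalAtlas (I := 𝓘(ℝ, E)) (n := ∞) (f x)
  have hx := mem_chart_source E x
  have hfx := mem_chart_source E (f x)
  have h1 := dForm_chartForm_pullback hθ₁ hθ₂ hf hφ hψ hx hfx h
    (mfderiv 𝓘(ℝ, E) 𝓘(ℝ, E) (chartAt E x) x v) (mfderiv 𝓘(ℝ, E) 𝓘(ℝ, E) (chartAt E x) x w)
  rw [fderiv_chart_apply_mfderiv hf hφ hψ hx hfx,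
    fderiv_chart_apply_mfderiv hf hφ hψ hx hfx] at h1
  exact (formDeriv_eq hθ₂ hψ hfx _ _).trans
    (h1.trans (congrArg (c * ·) (formDeriv_eq hθ₁ hφ hx v w).symm))

theorem IsSmoothForm.smul {θ : M → E →L[ℝ] ℝ} (hθ : IsSmoothForm θ) {h : M → ℝ}
    (hh : ContMDiff 𝓘(ℝ, E) 𝓘(ℝ, ℝ) ∞ h) : IsSmoothForm fun x => h x • θ x := fun e he =>
  (contMDiffOn_iff_contDiffOn.1 (hh.comp_contMDiffOn
      (contMDiffOn_symm_of_mem_maximalAtlas he))).smul (hθ e he)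

variable [IsManifold 𝓘(ℝ, E) ∞ M]

theorem chartMetric_formDeriv {θ : M → E →L[ℝ] ℝ} (hθ : IsSmoothForm θ)
    {e : OpenPartialHomeomorph M E} (he : e ∈ IsManifold.maximalAtlas 𝓘(ℝ, E) ∞ M) {y : E}
    (hy : y ∈ e.target) : chartMetric (formDeriv θ) e y = dForm (chartForm θ e) y := by
  ext v w
  have h1 := formDeriv_eq hθ he (e.map_target hy) (mfderiv 𝓘(ℝ, E) 𝓘(ℝ, E) e.symm y v)
    (mfderiv 𝓘(ℝ, E) 𝓘(ℝ, E) e.symm y w)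
  have h2 := mfderiv_mfderiv_symm he hy
  refine h1.trans ?_
  rw [e.right_inv hy]
  exact congrArg₂ (fun a b => dForm (chartForm θ e) y a b) (h2 v) (h2 w)

theorem formDeriv_smul {θ : M → E →L[ℝ] ℝ} (hθ : IsSmoothForm θ) {h : M → ℝ}
    (hh : ContMDiff 𝓘(ℝ, E) 𝓘(ℝ, ℝ) ∞ h) {x : M} {v w : E} (hv : θ x v = 0) (hw : θ x w = 0) :
    formDeriv (fun x => h x • θ x) x v w = h x * formDeriv θ x v w := by
  have he := IsManifold.chart_mem_maximalAtlas (I := 𝓘(ℝ, E)) (n := ∞) x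
  have hx := mem_chart_source E x
  have ht := (chartAt E x).open_target.mem_nhds ((chartAt E x).map_source hx)
  have h1 := (contMDiffOn_iff_contDiffOn.1 (hh.comp_contMDiffOn
    (contMDiffOn_symm_of_mem_maximalAtlas he))).contDiffAt ht
  have h2 := dForm_smul (h1.differentiableAt (by simp))
    (((hθ _ he).contDiffAt ht).differentiableAt (by simp))
    ((chartForm_apply_mfderiv θ he hx v).trans hv) ((chartForm_apply_mfderiv θ he hx w).trans hw)
  refine h2.trans ?_
  rw [Function.comp_apply, (chartAt E x).left_inv hx]
  rfl

variable [FiniteDimensional ℝ E]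

theorem isSmoothForm_of_contMDiff {θ : ∀ x : M, TangentSpace 𝓘(ℝ, E) x →L[ℝ] ℝ}
    (h : ContMDiff 𝓘(ℝ, E) (𝓘(ℝ, E).prod 𝓘(ℝ, E →L[ℝ] ℝ)) ∞ fun x => TotalSpace.mk' (E →L[ℝ] ℝ)
      (E := fun x : M => TangentSpace 𝓘(ℝ, E) x →L[ℝ] ℝ) x (θ x)) :
    IsSmoothForm (M := M) (E := E) θ := by
  refine fun e he => contDiffOn_clm_apply.2 fun v => ?_
  have h1 := ContMDiffOn.clm_bundle_apply (s := e.target) (F₂ := ℝ) (E₂ := fun _ : M => ℝ)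
    (h.comp_contMDiffOn (contMDiffOn_symm_of_mem_maximalAtlas he))
    (contMDiffOn_mfderiv_symm_apply he (contDiffOn_const (c := v)))
  intro y hy
  have h2 := contMDiffWithinAt_totalSpace.1 (h1 y hy)
  exact contMDiffWithinAt_iff_contDiffWithinAt.1 h2.2

theorem contDiffOn_dForm {η : E → E →L[ℝ] ℝ} {U : Set E} (hU : IsOpen U)
    (hη : ContDiffOn ℝ ∞ η U) : ContDiffOn ℝ ∞ (dForm η) U := by
  have h := hη.fderiv_of_isOpen hU (m := ∞) (by simp)
  refine contDiffOn_clm_apply.2 fun v => contDiffOn_clm_apply.2 fun w => ?_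
  exact ((h.clm_apply contDiffOn_const).clm_apply contDiffOn_const).sub
    ((h.clm_apply contDiffOn_const).clm_apply contDiffOn_const)

end Forms

/-! ### Contact forms and Reeb fields -/

section ContactPair

variable {E : Type*} [NormedAddCommGroup E] [NormedSpace ℝ E]

/-- A linear form `θ` and an alternating bilinear form `Ω` which is nondegenerate on `ker θ`. -/
structure IsContactPair (θ : E →L[ℝ] ℝ) (Ω : E →L[ℝ] E →L[ℝ] ℝ) : Prop where
  ne_zero : θ ≠ 0
  alt : ∀ v w, Ω v w = -Ω w v
  nondeg : ∀ v, θ v = 0 → (∀ w, θ w = 0 → Ω v w = 0) → v = 0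

/-- The operator `v ↦ Ω(v, ·) + θ(v) θ`. -/
def contactOp (θ : E →L[ℝ] ℝ) (Ω : E →L[ℝ] E →L[ℝ] ℝ) : E →L[ℝ] E →L[ℝ] ℝ :=
  Ω + θ.smulRight θ

variable {θ : E →L[ℝ] ℝ} {Ω : E →L[ℝ] E →L[ℝ] ℝ}

theorem IsContactPair.self (h : IsContactPair θ Ω) (v : E) : Ω v v = 0 := by
  have := h.alt v v
  linarith

theorem IsContactPair.bilinearComp (h : IsContactPair θ Ω) {L : E →L[ℝ] E}
    (hL : Function.Bijective L) : IsContactPair (θ.comp L) (Ω.bilinearComp L L) where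
  ne_zero h0 := h.ne_zero <| by
    ext w
    obtain ⟨v, rfl⟩ := hL.2 w
    exact DFunLike.congr_fun h0 v
  alt v w := h.alt _ _
  nondeg v hv hw := by
    refine hL.1 ((h.nondeg (L v) hv fun w hw' => ?_).trans (map_zero L).symm)
    obtain ⟨w, rfl⟩ := hL.2 w
    exact hw w hw'

variable [FiniteDimensional ℝ E]

/-- If `Ω(v, ·) + θ(v)θ = 0`, evaluation at `v` gives `θ(v)² = 0`; then `Ω(v, ·) = 0`, and
nondegeneracy on `ker θ` gives `v = 0`. -/
theorem IsContactPair.exists_equiv (h : IsContactPair θ Ω) :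
    ∃ A : E ≃L[ℝ] (E →L[ℝ] ℝ), (A : E →L[ℝ] E →L[ℝ] ℝ) = contactOp θ Ω := by
  have hinj : Function.Injective (contactOp θ Ω) := by
    refine (injective_iff_map_eq_zero _).2 fun v hv => ?_
    have hv' : ∀ w, Ω v w + θ v * θ w = 0 := fun w => DFunLike.congr_fun hv w
    have h1 := hv' v
    rw [h.self, zero_add, mul_self_eq_zero] at h1
    exact h.nondeg v h1 fun w _ => by simpa [h1] using hv' w
  have hfin : Module.finrank ℝ E = Module.finrank ℝ (E →L[ℝ] ℝ) := by
    rw [← (LinearMap.toContinuousLinearMap (𝕜 := ℝ) (E := E) (F' := ℝ)).finrank_eq]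
    exact Subspace.dual_finrank_eq.symm
  let A := LinearEquiv.ofInjectiveOfFinrankEq (contactOp θ Ω).toLinearMap hinj hfin
  exact ⟨A.toContinuousLinearEquiv, ContinuousLinearMap.ext fun v => rfl⟩

/-- The preimage `ξ` of `θ` under `contactOp` satisfies `Ω(ξ, ·) + θ(ξ)θ = θ`. At `ξ` this reads
`θ(ξ)² = θ(ξ)`, and `θ(ξ) = 0` would force `ξ = 0`, hence `θ = 0`. -/
theorem IsContactPair.exists_reeb (h : IsContactPair θ Ω) :
    ∃ ξ : E, θ ξ = 1 ∧ ∀ w, Ω ξ w = 0 := by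
  obtain ⟨A, hA⟩ := h.exists_equiv
  have h1 : ∀ w, Ω (A.symm θ) w + θ (A.symm θ) * θ w = θ w := fun w => by
    have h2 : contactOp θ Ω (A.symm θ) = θ := by
      rw [← hA]
      exact A.apply_symm_apply θ
    exact DFunLike.congr_fun h2 w
  set ξ := A.symm θ with hξ
  have h2 := h1 ξ
  rw [h.self, zero_add] at h2
  have h3 : θ ξ = 1 := by
    by_contra hne
    have h4 : θ ξ = 0 := by
      rcases mul_eq_zero.1 (show θ ξ * (θ ξ - 1) = 0 by linarith) with h5 | h5
      · exact h5
      · exact absurd (sub_eq_zero.1 h5) hne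
    have h5 : ξ = 0 := h.nondeg ξ h4 fun w hw => by simpa [h4, hw] using h1 w
    exact h.ne_zero (A.symm.injective ((hξ.symm.trans h5).trans (map_zero _).symm))
  exact ⟨ξ, h3, fun w => by simpa [h3] using h1 w⟩

/-- A formula for the Reeb vector by operator inversion; it gives both its uniqueness and its smooth
dependence on the point. -/
theorem IsContactPair.inverse_contactOp (h : IsContactPair θ Ω) {ξ : E} (h1 : θ ξ = 1)
    (h2 : ∀ w, Ω ξ w = 0) : (contactOp θ Ω).inverse θ = ξ := by
  obtain ⟨A, hA⟩ := h.exists_equiv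
  rw [← hA, ContinuousLinearMap.inverse_equiv]
  refine (A.symm_apply_eq).2 ?_
  have h3 : A ξ = contactOp θ Ω ξ := DFunLike.congr_fun hA ξ
  rw [h3]
  ext w
  simp [contactOp, h1, h2]

theorem IsContactPair.reeb_unique (h : IsContactPair θ Ω) {ξ ξ' : E} (h1 : θ ξ = 1)
    (h2 : ∀ w, Ω ξ w = 0) (h1' : θ ξ' = 1) (h2' : ∀ w, Ω ξ' w = 0) : ξ = ξ' :=
  (h.inverse_contactOp h1 h2).symm.trans (h.inverse_contactOp h1' h2')

theorem contDiffOn_inverse_contactOp {η : E → E →L[ℝ] ℝ} {Ω : E → E →L[ℝ] E →L[ℝ] ℝ} {U : Set E}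
    (hη : ContDiffOn ℝ ∞ η U) (hΩ : ContDiffOn ℝ ∞ Ω U)
    (h : ∀ y ∈ U, IsContactPair (η y) (Ω y)) :
    ContDiffOn ℝ ∞ (fun y => (contactOp (η y) (Ω y)).inverse (η y)) U := by
  have : CompleteSpace E := FiniteDimensional.complete ℝ E
  intro y hy
  have h1 : ContDiffOn ℝ ∞ (fun y => contactOp (η y) (Ω y)) U :=
    contDiffOn_clm_apply.2 fun v => (hΩ.clm_apply contDiffOn_const).add
      ((hη.clm_apply contDiffOn_const).smul hη)
  obtain ⟨A, hA⟩ := (h y hy).exists_equiv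
  have h2 := contDiffAt_map_inverse (n := ∞) A
  rw [hA] at h2
  exact (h2.comp_contDiffWithinAt y (h1 y hy)).clm_apply (hη y hy)

end ContactPair

/-! ### The metric defined by a pseudo-Hermitian structure -/

section LeviForm

variable {E : Type*} [NormedAddCommGroup E] [NormedSpace ℝ E]
  {M : Type*} [TopologicalSpace M] [ChartedSpace E M]

theorem tangentBundle_mk_congr {x x' : M} (h : x' = x) {a b : E} (hab : a = b) :
    (⟨x', a⟩ : TangentBundle 𝓘(ℝ, E) M) = ⟨x, b⟩ := by
  subst h hab
  rfl

variable [IsManifold 𝓘(ℝ, E) ∞ M]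

theorem contDiffOn_mfderiv_section {e : OpenPartialHomeomorph M E}
    (he : e ∈ IsManifold.maximalAtlas 𝓘(ℝ, E) ∞ M) {X : M → E}
    (hX : ContMDiffOn 𝓘(ℝ, E) 𝓘(ℝ, E).tangent ∞
      (fun x => (⟨x, X x⟩ : TangentBundle 𝓘(ℝ, E) M)) e.source) :
    ContDiffOn ℝ ∞ (fun y => (mfderiv 𝓘(ℝ, E) 𝓘(ℝ, E) e (e.symm y) (X (e.symm y)) : E))
      e.target := by
  have h1 := (contMDiffOn_of_mem_maximalAtlas he).contMDiffOn_tangentMapWithin (m := ∞)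
    (by simp) e.open_source.uniqueMDiffOn
  have h2 := h1.comp (hX.comp (contMDiffOn_symm_of_mem_maximalAtlas he) fun y hy =>
    e.map_target hy) fun y hy => e.map_target hy
  refine contMDiffOn_vectorSpace_iff_contDiffOn.1 (h2.congr fun y hy => ?_)
  refine tangentBundle_mk_congr (M := E) (e.right_inv hy).symm ?_
  simp only [Function.comp_apply]
  rw [mfderivWithin_of_isOpen e.open_source (e.map_target hy)]

/-- A smooth contact form inducing the given strictly pseudo-convex structure. -/
structure CRStructure.IsLeviForm (S : CRStructure E M) (θ : M → E →L[ℝ] ℝ) : Prop where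
  smooth : IsSmoothForm θ
  ne_zero : ∀ x, θ x ≠ 0
  mem_iff : ∀ x (v : E), v ∈ S.D x ↔ θ x v = 0
  levi_invariant : ∀ x (v w : S.D x),
    formDeriv θ x (S.J x v : TangentSpace 𝓘(ℝ, E) x) (S.J x w : TangentSpace 𝓘(ℝ, E) x) =
      formDeriv θ x (v : TangentSpace 𝓘(ℝ, E) x) (w : TangentSpace 𝓘(ℝ, E) x)
  levi_pos : ∀ x (v : S.D x), v ≠ 0 →
    0 < formDeriv θ x (S.J x v : TangentSpace 𝓘(ℝ, E) x) (v : TangentSpace 𝓘(ℝ, E) x)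

namespace CRStructure.IsLeviForm

variable {S : CRStructure E M} {θ : M → E →L[ℝ] ℝ}

theorem smul (h : S.IsLeviForm θ) {k : M → ℝ} (hk : ContMDiff 𝓘(ℝ, E) 𝓘(ℝ, ℝ) ∞ k)
    (hpos : ∀ x, 0 < k x) : S.IsLeviForm fun x => k x • θ x where
  smooth := h.smooth.smul hk
  ne_zero x := smul_ne_zero (hpos x).ne' (h.ne_zero x)
  mem_iff x v := (h.mem_iff x v).trans (by simp [(hpos x).ne'])
  levi_invariant x v w := by
    have hD : ∀ v : S.D x, θ x (v : TangentSpace 𝓘(ℝ, E) x) = 0 := fun v =>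
      (h.mem_iff x _).1 v.2
    rw [formDeriv_smul h.smooth hk (hD _) (hD _), formDeriv_smul h.smooth hk (hD _) (hD _),
      h.levi_invariant]
  levi_pos x v hv := by
    have hD : ∀ v : S.D x, θ x (v : TangentSpace 𝓘(ℝ, E) x) = 0 := fun v =>
      (h.mem_iff x _).1 v.2
    rw [formDeriv_smul h.smooth hk (hD _) (hD _)]
    exact mul_pos (hpos x) (h.levi_pos x v hv)

/-- Nondegeneracy on the distribution: a vector `v` in the kernel would be orthogonal to `J v`,
against positivity of the Levi form. -/
theorem isContactPair (h : S.IsLeviForm θ) (x : M) : IsContactPair (θ x) (formDeriv θ x) where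
  ne_zero := h.ne_zero x
  alt v w := by
    change dForm _ _ _ _ = -dForm _ _ _ _
    rw [dForm_apply, dForm_apply, neg_sub]
  nondeg v hv hw := by
    by_contra hne
    have h1 := h.levi_pos x ⟨v, (h.mem_iff x v).2 hv⟩ fun h0 => hne (congrArg Subtype.val h0)
    have h2 : formDeriv θ x v (S.J x ⟨v, (h.mem_iff x v).2 hv⟩ : TangentSpace 𝓘(ℝ, E) x) = 0 :=
      hw _ ((h.mem_iff x _).1 (S.J x ⟨v, (h.mem_iff x v).2 hv⟩).2)
    have h3 : formDeriv θ x (S.J x ⟨v, (h.mem_iff x v).2 hv⟩ : TangentSpace 𝓘(ℝ, E) x) v =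
        -formDeriv θ x v (S.J x ⟨v, (h.mem_iff x v).2 hv⟩ : TangentSpace 𝓘(ℝ, E) x) := by
      change dForm _ _ _ _ = -dForm _ _ _ _
      rw [dForm_apply, dForm_apply, neg_sub]
    rw [h2, neg_zero] at h3
    exact h1.ne' h3

theorem isContactPair_chart (h : S.IsLeviForm θ) {e : OpenPartialHomeomorph M E}
    (he : e ∈ IsManifold.maximalAtlas 𝓘(ℝ, E) ∞ M) {y : E} (hy : y ∈ e.target) :
    IsContactPair (chartForm θ e y) (dForm (chartForm θ e) y) := by
  rw [← chartMetric_formDeriv h.smooth he hy]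
  exact (h.isContactPair (e.symm y)).bilinearComp
    ((mdifferentiable_of_mem_maximalAtlas he).symm.mfderiv_bijective hy)

variable [FiniteDimensional ℝ E]

/-- The Reeb field of a contact form. -/
def reeb (h : S.IsLeviForm θ) (x : M) : E := (h.isContactPair x).exists_reeb.choose

theorem apply_reeb (h : S.IsLeviForm θ) (x : M) : θ x (h.reeb x) = 1 :=
  (h.isContactPair x).exists_reeb.choose_spec.1

theorem formDeriv_reeb (h : S.IsLeviForm θ) (x : M) (w : E) : formDeriv θ x (h.reeb x) w = 0 :=
  (h.isContactPair x).exists_reeb.choose_spec.2 w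

theorem eq_reeb (h : S.IsLeviForm θ) {x : M} {ξ : E} (h1 : θ x ξ = 1)
    (h2 : ∀ w, formDeriv θ x ξ w = 0) : ξ = h.reeb x :=
  (h.isContactPair x).reeb_unique h1 h2 (h.apply_reeb x) (h.formDeriv_reeb x)

/-- The projection onto the contact distribution along the Reeb field. -/
def proj (h : S.IsLeviForm θ) (x : M) : E →ₗ[ℝ] S.D x where
  toFun v := ⟨v - θ x v • h.reeb x, (h.mem_iff x _).2 (by simp [h.apply_reeb x])⟩
  map_add' v w := Subtype.ext (by
    change v + w - θ x (v + w) • h.reeb x = v - θ x v • h.reeb x + (w - θ x w • h.reeb x)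
    rw [map_add, add_smul]
    abel)
  map_smul' c v := Subtype.ext (by
    change c • v - θ x (c • v) • h.reeb x = c • (v - θ x v • h.reeb x)
    rw [map_smul, smul_sub, smul_assoc])

theorem coe_proj (h : S.IsLeviForm θ) (x : M) (v : E) :
    (h.proj x v : TangentSpace 𝓘(ℝ, E) x) = (v - θ x v • h.reeb x : E) := rfl

/-- The endomorphism `J ∘ π` of the tangent space. -/
def Jproj (h : S.IsLeviForm θ) (x : M) : E →L[ℝ] E :=
  LinearMap.toContinuousLinearMap ((S.D x).subtype ∘ₗ S.J x ∘ₗ h.proj x : E →ₗ[ℝ] E)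

theorem Jproj_apply (h : S.IsLeviForm θ) (x : M) (v : E) :
    h.Jproj x v = (S.J x (h.proj x v) : TangentSpace 𝓘(ℝ, E) x) := rfl

theorem formDeriv_proj (h : S.IsLeviForm θ) (x : M) (v w : E) :
    formDeriv θ x v (h.proj x w : TangentSpace 𝓘(ℝ, E) x) = formDeriv θ x v w := by
  rw [h.coe_proj, map_sub, map_smul, (h.isContactPair x).alt v (h.reeb x), h.formDeriv_reeb]
  simp

/-- The metric `θ ⊗ θ + dθ(J π ·, ·)`. -/
def metric (h : S.IsLeviForm θ) (x : M) : E →L[ℝ] E →L[ℝ] ℝ :=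
  (θ x).smulRight (θ x) + (formDeriv θ x).comp (h.Jproj x)

theorem metric_apply (h : S.IsLeviForm θ) (x : M) (v w : E) :
    h.metric x v w = θ x v * θ x w + formDeriv θ x (h.Jproj x v) w := rfl

/-- On the distribution, `dθ(Jv, w) = dθ(JJv, Jw) = -dθ(v, Jw) = dθ(Jw, v)`. -/
theorem metric_symm (h : S.IsLeviForm θ) (x : M) (v w : E) :
    h.metric x v w = h.metric x w v := by
  rw [h.metric_apply, h.metric_apply, mul_comm]
  congr 1
  rw [← h.formDeriv_proj x _ w, ← h.formDeriv_proj x _ v, Jproj_apply, Jproj_apply,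
    ← h.levi_invariant, S.J_J]
  exact (DFunLike.congr_fun (map_neg (formDeriv θ x) _) _).trans
    ((h.isContactPair x).alt _ _).symm

theorem formDeriv_Jproj_self (h : S.IsLeviForm θ) (x : M) (v : E) :
    formDeriv θ x (h.Jproj x v) v = formDeriv θ x (S.J x (h.proj x v) : TangentSpace 𝓘(ℝ, E) x)
      (h.proj x v : TangentSpace 𝓘(ℝ, E) x) :=
  (h.formDeriv_proj x _ v).symm

theorem metric_pos (h : S.IsLeviForm θ) (x : M) (v : E) (hv : v ≠ 0) : 0 < h.metric x v v := by
  rw [h.metric_apply, h.formDeriv_Jproj_self]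
  by_cases h0 : h.proj x v = 0
  · have h1 : v - θ x v • h.reeb x = 0 := congrArg Subtype.val h0
    have h2 : θ x v ≠ 0 := fun h2 => hv (by simpa [h2] using h1)
    rw [h0]
    have h3 : formDeriv θ x (S.J x 0 : TangentSpace 𝓘(ℝ, E) x)
        ((0 : S.D x) : TangentSpace 𝓘(ℝ, E) x) = 0 := map_zero _
    rw [h3, add_zero]
    exact mul_self_pos.2 h2
  · exact add_pos_of_nonneg_of_pos (mul_self_nonneg _) (h.levi_pos x _ h0)

theorem inverse_contactOp_chart (h : S.IsLeviForm θ) {e : OpenPartialHomeomorph M E}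
    (he : e ∈ IsManifold.maximalAtlas 𝓘(ℝ, E) ∞ M) {x : M} (hx : x ∈ e.source) :
    (contactOp (chartForm θ e (e x)) (dForm (chartForm θ e) (e x))).inverse (chartForm θ e (e x)) =
      mfderiv 𝓘(ℝ, E) 𝓘(ℝ, E) e x (h.reeb x) := by
  refine (h.isContactPair_chart he (e.map_source hx)).inverse_contactOp
    ((chartForm_apply_mfderiv θ he hx _).trans (h.apply_reeb x)) fun w => ?_
  obtain ⟨w, rfl⟩ := (mdifferentiable_of_mem_maximalAtlas he).mfderiv_surjective hx w
  exact (formDeriv_eq h.smooth he hx _ _).symm.trans (h.formDeriv_reeb x w)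

/-- Projections of constant coordinate fields are smooth sections of the distribution, to which
`smooth_J` applies; this is how smoothness of `J` enters the metric. -/
theorem contMDiffOn_proj (h : S.IsLeviForm θ) {e : OpenPartialHomeomorph M E}
    (he : e ∈ IsManifold.maximalAtlas 𝓘(ℝ, E) ∞ M) (v : E) :
    ContMDiffOn 𝓘(ℝ, E) 𝓘(ℝ, E).tangent ∞
      (fun x => (⟨x, (h.proj x (mfderiv 𝓘(ℝ, E) 𝓘(ℝ, E) e.symm (e x) v) :
        TangentSpace 𝓘(ℝ, E) x)⟩ : TangentBundle 𝓘(ℝ, E) M)) e.source := by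
  have hη := h.smooth e he
  have hV : ContDiffOn ℝ ∞ (fun y => v - chartForm θ e y v •
      (contactOp (chartForm θ e y) (dForm (chartForm θ e) y)).inverse (chartForm θ e y))
      e.target :=
    contDiffOn_const.sub ((hη.clm_apply contDiffOn_const).smul (contDiffOn_inverse_contactOp hη
      (contDiffOn_dForm e.open_target hη) fun y hy => h.isContactPair_chart he hy))
  refine ((contMDiffOn_mfderiv_symm_apply he hV).comp (contMDiffOn_of_mem_maximalAtlas he)
    fun x hx => e.map_source hx).congr fun x hx => ?_
  refine tangentBundle_mk_congr (e.left_inv hx).symm ?_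
  rw [h.inverse_contactOp_chart he hx]
  let T : E →L[ℝ] E := mfderiv 𝓘(ℝ, E) 𝓘(ℝ, E) e.symm (e x)
  let ξ : E := mfderiv 𝓘(ℝ, E) 𝓘(ℝ, E) e x (h.reeb x)
  have h1 : θ x (T v) = chartForm θ e (e x) v :=
    congrArg (fun z => θ z (T v)) (e.left_inv hx).symm
  have h2 : T ξ = h.reeb x := mfderiv_symm_mfderiv he hx _
  change T v - θ x (T v) • h.reeb x = T (v - chartForm θ e (e x) v • ξ)
  rw [map_sub, map_smul, h1, h2]

theorem isSmoothMetric (h : S.IsLeviForm θ) : IsSmoothMetric h.metric := by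
  refine isSmoothMetric_of_apply h.metric_symm h.metric_pos fun e he v w => ?_
  have hη := h.smooth e he
  have h1 := contDiffOn_mfderiv_section he (S.smooth_J e.source e.open_source _
    (h.contMDiffOn_proj he v))
  have h2 : ContDiffOn ℝ ∞ (fun y => chartForm θ e y v * chartForm θ e y w +
      dForm (chartForm θ e) y _ w) e.target :=
    ((hη.clm_apply contDiffOn_const).mul (hη.clm_apply contDiffOn_const)).add
      (((contDiffOn_dForm e.open_target hη).clm_apply h1).clm_apply contDiffOn_const)
  refine h2.congr fun y hy => ?_
  refine congrArg (chartForm θ e y v * chartForm θ e y w + ·) ?_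
  have h3 := formDeriv_eq h.smooth he (e.map_target hy)
    (h.Jproj (e.symm y) (mfderiv 𝓘(ℝ, E) 𝓘(ℝ, E) e.symm y v))
    (mfderiv 𝓘(ℝ, E) 𝓘(ℝ, E) e.symm y w)
  refine h3.trans ?_
  rw [e.right_inv hy]
  exact congrArg (dForm (chartForm θ e) y _) (mfderiv_mfderiv_symm he hy w)

end CRStructure.IsLeviForm

end LeviForm

/-! ### Invariant metrics for groups of CR automorphisms -/

section CRInvariant

variable {E : Type*} [NormedAddCommGroup E] [NormedSpace ℝ E] [FiniteDimensional ℝ E]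
  {M : Type*} [TopologicalSpace M] [ChartedSpace E M] [IsManifold 𝓘(ℝ, E) ∞ M]

theorem IsPseudoHermitian.isLeviForm {S : CRStructure E M}
    {θ : ∀ x : M, TangentSpace 𝓘(ℝ, E) x →L[ℝ] ℝ} (h : IsPseudoHermitian S.D S.J θ) :
    S.IsLeviForm θ where
  smooth := isSmoothForm_of_contMDiff h.contMDiff
  ne_zero := h.ne_zero
  mem_iff := h.mem_iff
  levi_invariant := h.levi_invariant
  levi_pos := h.levi_pos

namespace CRStructure.IsLeviForm

variable {S : CRStructure E M} {θ : M → E →L[ℝ] ℝ}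

theorem formDeriv_Jproj_nonneg (h : S.IsLeviForm θ) (x : M) (v : E) :
    0 ≤ formDeriv θ x (h.Jproj x v) v := by
  by_cases h0 : h.proj x v = 0
  · have h1 : h.Jproj x v = 0 := by
      rw [Jproj_apply, h0]
      exact congrArg Subtype.val (map_zero (S.J x))
    rw [h1, map_zero, zero_apply]
  · rw [h.formDeriv_Jproj_self]
    exact (h.levi_pos x _ h0).le

theorem Jproj_eq_zero (h : S.IsLeviForm θ) {x : M} {v : E}
    (h0 : formDeriv θ x (h.Jproj x v) v ≤ 0) : h.Jproj x v = 0 := by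
  by_cases h1 : h.proj x v = 0
  · rw [Jproj_apply, h1]
    exact congrArg Subtype.val (map_zero (S.J x))
  · rw [h.formDeriv_Jproj_self] at h0
    exact absurd (h.levi_pos x _ h1) h0.not_gt

variable {G : Type*} [Group G] [MulAction G M]

/-- A diffeomorphism with `α^*θ = sθ`, `s = ±1`, carries the Reeb field to `s` times itself, hence
commutes with the projection and with `J`. It multiplies `θ ⊗ θ` by `s² = 1` and the Levi form by
`s`. -/
theorem metric_smul (h : S.IsLeviForm θ) (hS : S.IsPreservedBy G)
    (hsm : ∀ α : G, ContMDiff 𝓘(ℝ, E) 𝓘(ℝ, E) ∞ fun x : M => α • x) (α : G) (x : M) {s : ℝ}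
    (hs : s * s = 1) (hθ : ∀ᶠ z in 𝓝 x, ∀ v : E,
      θ (α • z) (mfderiv 𝓘(ℝ, E) 𝓘(ℝ, E) (fun y : M => α • y) z v) = s * θ z v) (v w : E) :
    h.metric (α • x) (mfderiv 𝓘(ℝ, E) 𝓘(ℝ, E) (fun y : M => α • y) x v)
      (mfderiv 𝓘(ℝ, E) 𝓘(ℝ, E) (fun y : M => α • y) x w) = h.metric x v w := by
  let L : E →L[ℝ] E := mfderiv 𝓘(ℝ, E) 𝓘(ℝ, E) (fun y : M => α • y) x
  have hL : Function.Surjective L := by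
    refine (LinearMap.injective_iff_surjective (f := L.toLinearMap)).1
      (Function.LeftInverse.injective (g := fun w : E =>
        (mfderiv 𝓘(ℝ, E) 𝓘(ℝ, E) (fun y : M => α⁻¹ • y) (α • x) w : E)) fun v => ?_)
    have h0 := congrArg (fun f : M → M => (mfderiv 𝓘(ℝ, E) 𝓘(ℝ, E) f x v : E))
      (show (fun y : M => (α⁻¹ * α) • y) = id from funext fun y => by simp)
    refine (comp_smul_mfderiv hsm (fun _ T => T v) α⁻¹ α x).symm.trans (h0.trans ?_)
    simp only [mfderiv_id]
    rfl
  have h1 : ∀ v, θ (α • x) (L v) = s * θ x v := hθ.self_of_nhds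
  have h2 : ∀ v w, formDeriv θ (α • x) (L v) (L w) = s * formDeriv θ x v w :=
    formDeriv_pullback h.smooth h.smooth (hsm α) hθ
  have h3 : s • L (h.reeb x) = h.reeb (α • x) := by
    refine h.eq_reeb ?_ fun w => ?_
    · rw [map_smul, h1, h.apply_reeb, mul_one, smul_eq_mul, hs]
    · obtain ⟨w, rfl⟩ := hL w
      rw [map_smul, smul_apply, h2, h.formDeriv_reeb, mul_zero, smul_zero]
  have h4 : ∀ v, (h.proj (α • x) (L v) : TangentSpace 𝓘(ℝ, E) (α • x)) =
      L (h.proj x v : TangentSpace 𝓘(ℝ, E) x) := fun v => by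
    change L v - θ (α • x) (L v) • h.reeb (α • x) = L (v - θ x v • h.reeb x)
    rw [map_sub, map_smul, h1, ← h3, smul_smul, mul_right_comm, hs, one_mul]
  have h5 : ∀ v, h.Jproj (α • x) (L v) = L (h.Jproj x v) := fun v =>
    (hS α x).2 (h.proj x v) (h.proj (α • x) (L v)) (h4 v)
  change h.metric (α • x) (L v) (L w) = _
  rw [metric_apply, metric_apply, h1, h1, h5, h2,
    show s * θ x v * (s * θ x w) = s * s * (θ x v * θ x w) by ring, hs, one_mul]
  -- For `s = -1` positivity of the Levi form at both points forces its part of the metric to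
  -- vanish, as when the distribution is zero and `M` is one-dimensional.
  rcases mul_self_eq_one_iff.1 hs with rfl | rfl
  · rw [one_mul]
  · have h6 : h.Jproj x v = 0 := by
      refine h.Jproj_eq_zero ?_
      have h7 := h.formDeriv_Jproj_nonneg (α • x) (L v)
      rw [h5, h2] at h7
      linarith
    rw [h6, map_zero, zero_apply, mul_zero]

variable (G) in
/-- The factor `u` with `α^*θ = u θ`. -/
def factor (h : S.IsLeviForm θ) (α : G) (x : M) : ℝ :=
  θ (α • x) (mfderiv 𝓘(ℝ, E) 𝓘(ℝ, E) (fun y : M => α • y) x (h.reeb x))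

/-- Since `α` preserves the distribution, `α^*θ` vanishes on `ker θ` and is a multiple of `θ`; the
multiple is read off on the Reeb vector. -/
theorem apply_mfderiv_smul (h : S.IsLeviForm θ) (hS : S.IsPreservedBy G) (α : G) (x : M) (v : E) :
    θ (α • x) (mfderiv 𝓘(ℝ, E) 𝓘(ℝ, E) (fun y : M => α • y) x v) =
      h.factor G α x * θ x v := by
  let L : E →L[ℝ] E := mfderiv 𝓘(ℝ, E) 𝓘(ℝ, E) (fun y : M => α • y) x
  have h1 : θ (α • x) (L (v - θ x v • h.reeb x)) = 0 := by
    refine (h.mem_iff _ _).1 ?_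
    rw [← (hS α x).1]
    exact ⟨_, (h.proj x v).2, rfl⟩
  have h2 : L (v - θ x v • h.reeb x) = L v - θ x v • L (h.reeb x) := by rw [map_sub, map_smul]
  rw [h2, map_sub, map_smul, sub_eq_zero] at h1
  exact h1.trans (mul_comm _ _)

theorem factor_mul (h : S.IsLeviForm θ) (hS : S.IsPreservedBy G)
    (hsm : ∀ α : G, ContMDiff 𝓘(ℝ, E) 𝓘(ℝ, E) ∞ fun x : M => α • x) (α β : G) (x : M) :
    h.factor G (α * β) x = h.factor G α (β • x) * h.factor G β x :=
  (comp_smul_mfderiv hsm (fun x' L => θ x' (L (h.reeb x))) α β x).trans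
    (h.apply_mfderiv_smul hS α (β • x) _)

theorem factor_one (h : S.IsLeviForm θ) (x : M) : h.factor G 1 x = 1 := by
  have h1 := congrArg (fun f : M → M => θ (f x) (mfderiv 𝓘(ℝ, E) 𝓘(ℝ, E) f x (h.reeb x)))
    (show (fun y : M => (1 : G) • y) = id from funext fun y => one_smul G y)
  refine h1.trans ?_
  simp only [mfderiv_id]
  exact h.apply_reeb x

theorem factor_ne_zero (h : S.IsLeviForm θ) (hS : S.IsPreservedBy G)
    (hsm : ∀ α : G, ContMDiff 𝓘(ℝ, E) 𝓘(ℝ, E) ∞ fun x : M => α • x) (α : G) (x : M) :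
    h.factor G α x ≠ 0 := by
  have h1 := h.factor_mul hS hsm α⁻¹ α x
  rw [inv_mul_cancel, h.factor_one] at h1
  exact right_ne_zero_of_mul (h1 ▸ one_ne_zero)

variable {EG : Type*} [NormedAddCommGroup EG] [NormedSpace ℝ EG] [FiniteDimensional ℝ EG]
  [TopologicalSpace G] [ChartedSpace EG G] [LieGroup 𝓘(ℝ, EG) ∞ G]
  [ContMDiffSMul 𝓘(ℝ, EG) 𝓘(ℝ, E) ∞ G M]

/-- Locally a quotient of chart expressions of `θ`, evaluated on a constant coordinate vector at
which the denominator is nonzero near the base point. -/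
theorem contMDiff_factor (h : S.IsLeviForm θ) (hS : S.IsPreservedBy G) :
    ContMDiff (𝓘(ℝ, EG).prod 𝓘(ℝ, E)) 𝓘(ℝ, ℝ) ∞ fun p : G × M => h.factor G p.1 p.2 := by
  intro p₀
  have hφ := IsManifold.chart_mem_maximalAtlas (I := 𝓘(ℝ, E)) (n := ∞) p₀.2
  have hψ := IsManifold.chart_mem_maximalAtlas (I := 𝓘(ℝ, E)) (n := ∞) (p₀.1 • p₀.2)
  have hx := mem_chart_source E p₀.2
  have hp := mem_chart_source E (p₀.1 • p₀.2)
  set φ := chartAt E p₀.2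
  set ψ := chartAt E (p₀.1 • p₀.2)
  obtain ⟨v, hv⟩ : ∃ v, chartForm θ φ (φ p₀.2) v ≠ 0 :=
    ⟨_, ne_of_eq_of_ne ((chartForm_apply_mfderiv θ hφ hx _).trans (h.apply_reeb p₀.2)) one_ne_zero⟩
  have h1 := contMDiffAt_chart_smul (EG := EG) hψ hp
  have h2 : ContMDiffAt (𝓘(ℝ, EG).prod 𝓘(ℝ, E)) 𝓘(ℝ, E) ∞
      (fun p : G × M => fderiv ℝ (fun y => ψ (p.1 • φ.symm y)) (φ p.2) v) p₀ :=
    (contMDiffAt_fderiv_smul (EG := EG) hφ hψ hx hp).clm_apply contMDiffAt_const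
  have h3 : ContMDiffAt (𝓘(ℝ, EG).prod 𝓘(ℝ, E)) 𝓘(ℝ, E →L[ℝ] ℝ) ∞
      (fun p : G × M => chartForm θ ψ (ψ (p.1 • p.2))) p₀ :=
    ContMDiffAt.comp (g := chartForm θ ψ) p₀ (((h.smooth ψ hψ).contDiffAt
      (ψ.open_target.mem_nhds (ψ.map_source hp))).contMDiffAt) h1
  have h4 : ContMDiffAt (𝓘(ℝ, EG).prod 𝓘(ℝ, E)) 𝓘(ℝ, E →L[ℝ] ℝ) ∞
      (fun p : G × M => chartForm θ φ (φ p.2)) p₀ :=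
    ContMDiffAt.comp (g := fun x => chartForm θ φ (φ x)) p₀
      (ContMDiffAt.comp (g := chartForm θ φ) p₀.2 (((h.smooth φ hφ).contDiffAt
        (φ.open_target.mem_nhds (φ.map_source hx))).contMDiffAt)
        (contMDiffAt_of_mem_maximalAtlas hφ hx)) contMDiffAt_snd
  have h4' := h4.clm_apply (contMDiffAt_const (c := v))
  have h5 := (h3.clm_apply h2).div₀ h4' hv
  refine h5.congr_of_eventuallyEq ?_
  filter_upwards [(continuous_snd.tendsto p₀).eventually (φ.open_source.mem_nhds hx),
    (ContMDiff.smul (I := 𝓘(ℝ, EG)) (I' := 𝓘(ℝ, E)) (n := ∞) (M := M) contMDiff_fst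
      contMDiff_snd).continuous.tendsto p₀ |>.eventually (ψ.open_source.mem_nhds hp),
    h4'.continuousAt.eventually_ne hv] with p hp1 hp2 hp4
  have hp3 : p.1 • φ.symm (φ p.2) ∈ ψ.source := by rwa [φ.left_inv hp1]
  have h6 := chartForm_pullback (f := fun x => p.1 • x) (θ₁ := θ) (θ₂ := θ) hφ hψ
    (φ.map_source hp1) hp3
    ((ContMDiffSMul.contMDiff_const_smul (I := 𝓘(ℝ, EG)) (n := ∞) p.1).mdifferentiableAt (by simp))
    (h.apply_mfderiv_smul hS p.1 _) v
  rw [φ.left_inv hp1] at h6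
  exact eq_div_of_mul_eq hp4 h6.symm

end CRStructure.IsLeviForm

variable {EG : Type*} [NormedAddCommGroup EG] [NormedSpace ℝ EG] [FiniteDimensional ℝ EG]
  {G : Type*} [Group G] [TopologicalSpace G] [ChartedSpace EG G] [LieGroup 𝓘(ℝ, EG) ∞ G]
  [MulAction G M] [ContMDiffSMul 𝓘(ℝ, EG) 𝓘(ℝ, E) ∞ G M]

/-- With `|u_α(x)| = exp (f(α x) - f(x))`, the form `e^{-f}θ` is still a Levi form and is preserved
up to sign; its associated metric is invariant. -/
theorem CRStructure.IsPreservedBy.exists_invariant_metric {S : CRStructure E M}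
    (hS : S.IsPreservedBy G)
    (hH : Subsingleton (DiffCohomology EG
      (smoothFunAction EG (EM := E) (M := M) (1 : G →* (ℝ →L[ℝ] ℝ))) 1)) :
    ∃ B : M → E →L[ℝ] E →L[ℝ] ℝ, IsSmoothMetric B ∧ ∀ (α : G) (x : M) (v w : E), B (α • x)
      (mfderiv 𝓘(ℝ, E) 𝓘(ℝ, E) (fun y : M => α • y) x v)
      (mfderiv 𝓘(ℝ, E) 𝓘(ℝ, E) (fun y : M => α • y) x w) = B x v w := by
  obtain ⟨θ, hθ⟩ := S.exists_pseudoHermitian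
  have h := hθ.isLeviForm
  have hsm : ∀ α : G, ContMDiff 𝓘(ℝ, E) 𝓘(ℝ, E) ∞ fun x : M => α • x :=
    ContMDiffSMul.contMDiff_const_smul (I := 𝓘(ℝ, EG))
  have hu := h.contMDiff_factor (EG := EG) hS
  obtain ⟨f, hf, hfu⟩ := exists_abs_eq_exp_sub hH hu (h.factor_ne_zero hS hsm)
    (h.factor_mul hS hsm)
  have hexp : ContMDiff 𝓘(ℝ, E) 𝓘(ℝ, ℝ) ∞ fun x => Real.exp (-f x) :=
    Real.contDiff_exp.contMDiff.comp hf.neg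
  have h' := h.smul hexp fun x => Real.exp_pos _
  refine ⟨h'.metric, h'.isSmoothMetric, fun α x v w => ?_⟩
  have hα : Continuous (h.factor G α) := hu.continuous.comp (by fun_prop : Continuous fun x : M => (α, x))
  have key : ∀ (s : ℝ) (z : M), h.factor G α z = s * |h.factor G α z| → ∀ v : E,
      (Real.exp (-f (α • z)) • θ (α • z) : E →L[ℝ] ℝ)
        (mfderiv 𝓘(ℝ, E) 𝓘(ℝ, E) (fun y : M => α • y) z v) =
      s * (Real.exp (-f z) • θ z : E →L[ℝ] ℝ) v := by
    intro s z hz v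
    change _ = s * (Real.exp (-f z) * θ z v)
    refine (congrArg (Real.exp (-f (α • z)) * ·) (h.apply_mfderiv_smul hS α z v)).trans ?_
    change Real.exp (-f (α • z)) * (h.factor G α z * θ z v) = _
    rw [hz, hfu, show Real.exp (-f (α • z)) * (s * Real.exp (f (α • z) - f z) * θ z v) =
      s * ((Real.exp (-f (α • z)) * Real.exp (f (α • z) - f z)) * θ z v) by ring, ← Real.exp_add]
    congr 4
    ring
  -- By continuity the sign of the factor is constant near `x`, which is all that the exterior
  -- derivative sees.
  rcases (h.factor_ne_zero hS hsm α x).lt_or_gt with h0 | h0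
  · refine h'.metric_smul hS hsm α x (s := -1) (by norm_num) ?_ v w
    filter_upwards [hα.continuousAt.eventually_lt_const h0] with z hz
    exact key _ z (by rw [abs_of_neg hz]; ring)
  · refine h'.metric_smul hS hsm α x (s := 1) (by norm_num) ?_ v w
    filter_upwards [hα.continuousAt.eventually_const_lt h0] with z hz
    exact key _ z (by rw [abs_of_pos hz]; ring)

end CRInvariant

end DiffCoh

end

theorem mainTheorem2
    {EG : Type uEG} [NormedAddCommGroup EG] [NormedSpace ℝ EG] [FiniteDimensional ℝ EG]
    {G : Type uG} [Group G] [TopologicalSpace G] [T2Space G] [SecondCountableTopology G]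
    [ChartedSpace EG G] [LieGroup 𝓘(ℝ, EG) ∞ G]
    {EM : Type uEM} [NormedAddCommGroup EM] [NormedSpace ℝ EM] [FiniteDimensional ℝ EM]
    {M : Type uM} [TopologicalSpace M] [T2Space M] [SecondCountableTopology M] [ConnectedSpace M]
    [ChartedSpace EM M] [IsManifold 𝓘(ℝ, EM) ∞ M]
    [MulAction G M] [FaithfulSMul G M] [ContMDiffSMul 𝓘(ℝ, EG) 𝓘(ℝ, EM) ∞ G M]
    (hclosed : DiffCoh.IsClosedInDiff EM M EG G)
    (hG : (∃ S : DiffCoh.CRStructure EM M, S.IsPreservedBy G) ∨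
      (∃ g : ContMDiffRiemannianMetric 𝓘(ℝ, EM) ∞ EM (fun x : M => TangentSpace 𝓘(ℝ, EM) x),
        DiffCoh.PreservesConformalClass G g)) :
    List.TFAE [
      ProperSMul G M,
      Subsingleton (DiffCoh.DiffCohomology EG
        (DiffCoh.smoothFunAction EG (EM := EM) (M := M) (1 : G →* (ℝ →L[ℝ] ℝ))) 1),
      ∀ (V : Type w) [AddCommGroup V] [Module ℝ V] [UniformSpace V] [IsUniformAddGroup V]
        [ContinuousSMul ℝ V] [T2Space V] [LocallyConvexSpace ℝ V] [QuasiCompleteSpace ℝ V]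
        (ρ : G →* (V →L[ℝ] V)), DiffCoh.IsDifferentiableModule EG ρ →
        ∀ r : ℕ, 0 < r → Subsingleton (DiffCoh.DiffCohomology EG
          (DiffCoh.smoothFunAction EG (EM := EM) (M := M) ρ) r)] := by
  tfae_have 1 → 3 := fun _ V _ _ _ _ _ _ _ _ ρ _ r hr =>
    DiffCoh.subsingleton_diffCohomology_of_properSMul ρ hr
  tfae_have 3 → 2 := fun h => by
    -- `PUnit → ℝ` is a copy of the trivial module in the universe of `V`, and `ℝ` is an equivariant
    -- retract of it.
    refine DiffCoh.exists_coboundary_eq_of_retract (V := ℝ) (V' := PUnit.{w + 1} → ℝ)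
      (ContinuousLinearMap.pi fun _ => ContinuousLinearMap.id ℝ ℝ)
      (ContinuousLinearMap.proj PUnit.unit) (fun _ _ => rfl) (fun _ _ => rfl) (fun _ => rfl) 0
      (h (PUnit.{w + 1} → ℝ) 1 (DiffCoh.isDifferentiableModule_one _) 1 one_pos)
  tfae_have 2 → 1 := fun h => by
    obtain ⟨B, hB, hinv⟩ : ∃ B : M → EM →L[ℝ] EM →L[ℝ] ℝ, DiffCoh.IsSmoothMetric B ∧
        ∀ (α : G) (x : M) (v w : EM), B (α • x)
          (mfderiv 𝓘(ℝ, EM) 𝓘(ℝ, EM) (fun y : M => α • y) x v)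
          (mfderiv 𝓘(ℝ, EM) 𝓘(ℝ, EM) (fun y : M => α • y) x w) = B x v w := by
      rcases hG with ⟨S, hS⟩ | ⟨g, hg⟩
      · exact hS.exists_invariant_metric h
      · exact hg.exists_invariant_metric h
    exact DiffCoh.properSMul_of_isClosedInDiff hclosed hB hinv
  tfae_finish
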